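/- Fix an integer $p\ge 1$ and real constants $\ell^->0$, $\ell^+$, $d_{\min}>0$, $d_{\max}$, $\tilde d_{\min}>0$, $\tilde d_{\max}$, $a_{\max}$, $M$. Write $\mathbb R^+=[0,\infty)$, and let $\|\cdot\|$ denote the Euclidean norm of a vector and the spectral norm of a matrix. There exist polynomials $\Phi_p$ and $\Psi_p$ with non-negative real coefficients, depending only on $p$ and on these constants, such that the following holds. Let $N,n\ge 1$ be integers with $\ell^-\le N/n\le \ell^+$; let $D_n$ ($N\times N$) and $\tilde D_n$ ($n\times n$) be real diagonal matrices with non-negative entries satisfying $\|D_n\|\le d_{\max}$, $\|\tilde D_n\|\le\tilde d_{\max}$, $\frac1N\mathrm{Tr}\,D_n\ge d_{\min}$, $\frac1n\mathrm{Tr}\,\tilde D_n\ge\tilde d_{\min}$; and let $A_n$ be a deterministic complex $N\times n$ matrix with $\|A_n\|\le a_{\max}$. Then the system $$ \begin{aligned} \delta(z) &= \tfrac1n \mathrm{Tr}\, D_n\left(-z(I_N+\tilde\delta(z)D_n)+A_n(I_n+\delta(z)\tilde D_n)^{-1}A_n^*\right)^{-1},\\ \tilde\delta(z) &= \tfrac1n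 \mathrm{Tr}\, \tilde D_n\left(-z(I_n+\delta(z)\tilde D_n)+A_n^*(I_N+\tilde\delta(z)D_n)^{-1}A_n\right)^{-1}, \end{aligned} \qquad z\in\mathbb C\setminus\mathbb R^+, $$ has a unique solution $(\delta,\tilde\delta)$ in the class of pairs of Stieltjes transforms $z\mapsto\int (t-z)^{-1}\mu(dt)$ on $\mathbb C\setminus\mathbb R^+$ of finite non-negative measures carried by $\mathbb R^+$. With this solution put $$ T_n(z)=\left(-z(I_N+\tilde\delta(z)D_n)+A_n(I_n+\delta(z)\tilde D_n)^{-1}A_n^*\right)^{-1}. $$ Let moreover $X_n=(X^n_{ij})$ be an $N\times n$ random matrix whose entries are i.i.d. complex random variables with $\mathbb E X^n_{ij}=0$, $\mathbb E|X^n_{ij}|^2=1$ and $\mathbb E|X_{ij}^n|^{8p}\le M$, and put $$ \Sigma_n=\frac{D_n^{1/2}X_n\tilde D_n^{1/2}}{\sqrt n}+A_n,\qquad Q_n(z)=(\Sigma_n\Sigma_n^*-zI_N)^{-1}. $$ Then for all deterministic vectors $u_n,v_n\in\mathbb C^N$ and all $z\in\mathbb C\setminus\mathbb R^+$, $$ \mathbb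 E\left|u_n^*\left(Q_n(z)-T_n(z)\right)v_n\right|^{2p}\le \frac1{n^p}\,\Phi_p(|z|)\,\Psi_p\!\left(\frac1{\mathrm{dist}(z,\mathbb R^+)}\right)\|u_n\|^{2p}\|v_n\|^{2p}. $$ -/

import Mathlib

open scoped Matrix Matrix.Norms.L2Operator

noncomputable section

namespace BilinearResolvent

/-- The closed half-line `ℝ⁺ = [0, ∞)`, seen inside `ℂ`. -/
def nonnegReals : Set ℂ := (fun t : ℝ => (t : ℂ)) '' Set.Ici 0

/-- The complex diagonal matrix with real diagonal entries `d`. -/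
def diagC {k : ℕ} (d : Fin k → ℝ) : Matrix (Fin k) (Fin k) ℂ :=
  Matrix.diagonal fun i => (d i : ℂ)

/-- The matrix `Σ = n^{-1/2} D^{1/2} X D̃^{1/2} + A` for `D = diag d`, `D̃ = diag d'`. -/
def sigmaMat {N n : ℕ} (d : Fin N → ℝ) (d' : Fin n → ℝ) (A X : Matrix (Fin N) (Fin n) ℂ) :
    Matrix (Fin N) (Fin n) ℂ :=
  ((Real.sqrt n : ℝ) : ℂ)⁻¹ •
      (diagC (fun i => Real.sqrt (d i)) * X * diagC (fun j => Real.sqrt (d' j))) + A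

/-- The resolvent `Q(z) = (S S^* - z I)⁻¹`. -/
def resolventMat {N n : ℕ} (S : Matrix (Fin N) (Fin n) ℂ) (z : ℂ) : Matrix (Fin N) (Fin N) ℂ :=
  (S * Sᴴ - z • (1 : Matrix (Fin N) (Fin N) ℂ))⁻¹

/-- `T(z) = (-z (I + δ̃ D) + A (I + δ D̃)⁻¹ A^*)⁻¹`, where `a = δ(z)` and `a' = δ̃(z)`. -/
def detEquiv {N n : ℕ} (d : Fin N → ℝ) (d' : Fin n → ℝ) (A : Matrix (Fin N) (Fin n) ℂ)
    (a a' z : ℂ) : Matrix (Fin N) (Fin N) ℂ :=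
  ((-z) • (1 + a' • diagC d) + A * (1 + a • diagC d')⁻¹ * Aᴴ)⁻¹

/-- `T̃(z) = (-z (I + δ D̃) + A^* (I + δ̃ D)⁻¹ A)⁻¹`, where `a = δ(z)` and `a' = δ̃(z)`. -/
def detEquivTilde {N n : ℕ} (d : Fin N → ℝ) (d' : Fin n → ℝ) (A : Matrix (Fin N) (Fin n) ℂ)
    (a a' z : ℂ) : Matrix (Fin n) (Fin n) ℂ :=
  ((-z) • (1 + a • diagC d') + Aᴴ * (1 + a' • diagC d)⁻¹ * A)⁻¹

/-- On `ℂ ∖ ℝ⁺`, `f` is the Stieltjes transform `z ↦ ∫ (t - z)⁻¹ dμ(t)` of a finite nonnegative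
measure `μ` carried by `ℝ⁺`. The values of `f` on `ℝ⁺` are irrelevant. -/
def IsStieltjesTransform (f : ℂ → ℂ) : Prop :=
  ∃ μ : MeasureTheory.Measure ℝ, MeasureTheory.IsFiniteMeasure μ ∧ μ (Set.Iio 0) = 0 ∧
    ∀ z : ℂ, z ∉ nonnegReals → f z = MeasureTheory.resolventTransform μ z

/-- `(δ, δ̃)` solves the canonical system on `ℂ ∖ ℝ⁺` in the class of Stieltjes transforms of
finite nonnegative measures carried by `ℝ⁺`. -/
structure IsCanonicalSolution {N n : ℕ} (d : Fin N → ℝ) (d' : Fin n → ℝ)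
    (A : Matrix (Fin N) (Fin n) ℂ) (δ δ' : ℂ → ℂ) : Prop where
  stieltjes : IsStieltjesTransform δ
  stieltjes_tilde : IsStieltjesTransform δ'
  eq : ∀ z : ℂ, z ∉ nonnegReals →
    δ z = (1 / (n : ℂ)) * (diagC d * detEquiv d d' A (δ z) (δ' z) z).trace
  eq_tilde : ∀ z : ℂ, z ∉ nonnegReals →
    δ' z = (1 / (n : ℂ)) * (diagC d' * detEquivTilde d d' A (δ z) (δ' z) z).trace

/-- The bounds on the deterministic part of the model: aspect ratio, spectral norms, and
normalized traces of the nonnegative diagonal matrices. -/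
structure ModelBounds {N n : ℕ} (ratioMin ratioMax dMin dMax dMin' dMax' aMax : ℝ)
    (d : Fin N → ℝ) (d' : Fin n → ℝ) (A : Matrix (Fin N) (Fin n) ℂ) : Prop where
  n_pos : 0 < n
  ratio_ge : ratioMin ≤ (N : ℝ) / n
  ratio_le : (N : ℝ) / n ≤ ratioMax
  d_nonneg : ∀ i, 0 ≤ d i
  d_nonneg' : ∀ j, 0 ≤ d' j
  d_norm_le : ‖diagC d‖ ≤ dMax
  d_norm_le' : ‖diagC d'‖ ≤ dMax'
  d_trace_ge : dMin ≤ (1 / (N : ℝ)) * (Matrix.diagonal d).trace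
  d_trace_ge' : dMin' ≤ (1 / (n : ℝ)) * (Matrix.diagonal d').trace
  A_norm_le : ‖A‖ ≤ aMax

/-- The entries `X i j` are i.i.d. complex random variables with mean `0`, variance `1` and
moment of order `8p` at most `M`. -/
structure IsIIDArray {Ω : Type*} [MeasurableSpace Ω] (P : MeasureTheory.Measure Ω) (p : ℕ) (M : ℝ)
    {N n : ℕ} (X : Fin N → Fin n → Ω → ℂ) : Prop where
  measurable : ∀ i j, Measurable (X i j)
  indep : ProbabilityTheory.iIndepFun (fun ij : Fin N × Fin n => X ij.1 ij.2) P
  identDistrib : ∀ i j i' j', ProbabilityTheory.IdentDistrib (X i j) (X i' j') P P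
  mean_zero : ∀ i j, ∫ ω, X i j ω ∂P = 0
  variance_one : ∀ i j, ∫ ω, ‖X i j ω‖ ^ 2 ∂P = 1
  memLp : ∀ i j, MeasureTheory.MemLp (X i j) ((8 * p : ℕ) : ENNReal) P
  moment_le : ∀ i j, ∫ ω, ‖X i j ω‖ ^ (8 * p) ∂P ≤ M

/-- The bilinear form `u^* B v`. -/
def bilin {N : ℕ} (u : EuclideanSpace ℂ (Fin N)) (B : Matrix (Fin N) (Fin N) ℂ)
    (v : EuclideanSpace ℂ (Fin N)) : ℂ :=
  star (WithLp.ofLp u) ⬝ᵥ (B *ᵥ WithLp.ofLp v)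

end BilinearResolvent

end

noncomputable section

namespace BilinearResolvent

set_option linter.unusedSectionVars false

section Accretive

variable {I : Type*} [Fintype I]

/-- The squared `ℓ²` norm of a complex vector. -/
def normSq2 (v : I → ℂ) : ℝ := ∑ i, ‖v i‖ ^ 2

lemma normSq2_nonneg (v : I → ℂ) : 0 ≤ normSq2 v :=
  Finset.sum_nonneg fun _ _ => by positivity

lemma normSq2_star (v : I → ℂ) : normSq2 (star v) = normSq2 v := by
  simp [normSq2]

lemma norm_sq_le_normSq2 (v : I → ℂ) (i : I) : ‖v i‖ ^ 2 ≤ normSq2 v :=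
  Finset.single_le_sum (f := fun i => ‖v i‖ ^ 2) (fun _ _ => by positivity) (Finset.mem_univ i)

lemma normSq2_single [DecidableEq I] (i : I) : normSq2 (Pi.single i (1 : ℂ)) = 1 := by
  unfold normSq2
  rw [Finset.sum_eq_single i]
  · simp
  · intro j _ hj; simp [hj]
  · simp

lemma norm_dotProduct_sq_le (u v : I → ℂ) :
    ‖u ⬝ᵥ v‖ ^ 2 ≤ normSq2 u * normSq2 v := by
  have h1 : ‖u ⬝ᵥ v‖ ≤ ∑ i, ‖u i‖ * ‖v i‖ := by
    refine (norm_sum_le _ _).trans_eq ?_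
    simp
  calc ‖u ⬝ᵥ v‖ ^ 2 ≤ (∑ i, ‖u i‖ * ‖v i‖) ^ 2 := by gcongr
    _ ≤ _ := Finset.sum_mul_sq_le_sq_mul_sq _ _ _

lemma norm_dotProduct_le (u v : I → ℂ) :
    ‖u ⬝ᵥ v‖ ≤ √(normSq2 u) * √(normSq2 v) := by
  rw [← Real.sqrt_mul (normSq2_nonneg u)]
  exact Real.le_sqrt_of_sq_le (norm_dotProduct_sq_le u v)

/-- `M` is accretive with constant `σ`: its Hermitian part is at least `σ`. -/
def Accretive (σ : ℝ) (M : Matrix I I ℂ) : Prop :=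
  ∀ v : I → ℂ, σ * normSq2 v ≤ (star v ⬝ᵥ (M *ᵥ v)).re

lemma dot_star_mulVec (M : Matrix I I ℂ) (v : I → ℂ) :
    star (star v ⬝ᵥ (M *ᵥ v)) = star v ⬝ᵥ (Mᴴ *ᵥ v) := by
  rw [Matrix.star_dotProduct, star_star, Matrix.star_mulVec, Matrix.dotProduct_mulVec,
    dotProduct_comm, dotProduct_comm]

lemma Accretive.conjTranspose {σ : ℝ} {M : Matrix I I ℂ} (h : Accretive σ M) :
    Accretive σ Mᴴ := by
  intro v
  rw [← dot_star_mulVec]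
  simpa using h v

lemma accretive_diagonal_add [DecidableEq I] {σ : ℝ} {θ : I → ℂ} {K : Matrix I I ℂ} (hK : Kᴴ = -K)
    (hθ : ∀ i, σ ≤ (θ i).re) : Accretive σ (Matrix.diagonal θ + K) := by
  intro v
  have hK0 : (star v ⬝ᵥ (K *ᵥ v)).re = 0 := by
    have := congrArg Complex.re (dot_star_mulVec K v)
    rw [hK, Matrix.neg_mulVec, dotProduct_neg] at this
    simp at this
    linarith
  rw [Matrix.add_mulVec, dotProduct_add, Complex.add_re, hK0, add_zero, normSq2, Finset.mul_sum,
    dotProduct, Complex.re_sum]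
  refine Finset.sum_le_sum fun i _ => ?_
  rw [Matrix.mulVec_diagonal]
  have : (star v) i * (θ i * v i) = θ i * ((‖v i‖ ^ 2 : ℝ) : ℂ) := by
    have := Complex.conj_mul' (v i)
    simp only [Pi.star_apply, RCLike.star_def]
    push_cast
    rw [← this]; ring
  rw [this, Complex.re_mul_ofReal]
  exact mul_le_mul_of_nonneg_right (hθ i) (by positivity)

lemma Accretive.normSq2_le {σ : ℝ} (hσ : 0 < σ) {M : Matrix I I ℂ} (h : Accretive σ M)
    (w : I → ℂ) : normSq2 w ≤ (1 / σ) ^ 2 * normSq2 (M *ᵥ w) := by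
  have h1 := h w
  have h2 : (star w ⬝ᵥ (M *ᵥ w)).re ≤ ‖star w ⬝ᵥ (M *ᵥ w)‖ := Complex.re_le_norm _
  have h3 := norm_dotProduct_sq_le (star w) (M *ᵥ w)
  rw [normSq2_star] at h3
  have h4 : (σ * normSq2 w) ^ 2 ≤ normSq2 w * normSq2 (M *ᵥ w) :=
    (pow_le_pow_left₀ (mul_nonneg hσ.le (normSq2_nonneg w)) (h1.trans h2) 2).trans h3
  rcases (normSq2_nonneg w).eq_or_lt with h0 | h0
  · rw [← h0]; exact mul_nonneg (by positivity) (normSq2_nonneg _)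
  · have h5 : σ ^ 2 * normSq2 w ≤ normSq2 (M *ᵥ w) := by
      have : normSq2 w * (σ ^ 2 * normSq2 w) ≤ normSq2 w * normSq2 (M *ᵥ w) := by
        calc _ = (σ * normSq2 w) ^ 2 := by ring
          _ ≤ _ := h4
      exact le_of_mul_le_mul_left this h0
    rw [one_div, inv_pow, inv_mul_eq_div, le_div_iff₀ (by positivity)]
    linarith

variable [DecidableEq I]

lemma Accretive.isUnit {σ : ℝ} (hσ : 0 < σ) {M : Matrix I I ℂ} (h : Accretive σ M) :
    IsUnit M := by
  rw [← Matrix.mulVec_injective_iff_isUnit]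
  intro v w hvw
  have h1 := h.normSq2_le hσ (v - w)
  have h2 : M *ᵥ (v - w) = 0 := by rw [Matrix.mulVec_sub]; exact sub_eq_zero.2 hvw
  rw [h2] at h1
  have h3 : normSq2 (0 : I → ℂ) = 0 := by simp [normSq2]
  rw [h3, mul_zero] at h1
  funext i
  have h4 := (norm_sq_le_normSq2 (v - w) i).trans h1
  have h5 : ‖(v - w) i‖ = 0 := by
    have := norm_nonneg ((v - w) i)
    nlinarith
  exact sub_eq_zero.1 (norm_eq_zero.1 h5)

lemma Accretive.mul_inv {σ : ℝ} (hσ : 0 < σ) {M : Matrix I I ℂ} (h : Accretive σ M) :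
    M * M⁻¹ = 1 :=
  Matrix.mul_nonsing_inv _ ((Matrix.isUnit_iff_isUnit_det _).1 (h.isUnit hσ))

lemma Accretive.inv_mul {σ : ℝ} (hσ : 0 < σ) {M : Matrix I I ℂ} (h : Accretive σ M) :
    M⁻¹ * M = 1 :=
  Matrix.nonsing_inv_mul _ ((Matrix.isUnit_iff_isUnit_det _).1 (h.isUnit hσ))

lemma Accretive.normSq2_inv_mulVec_le {σ : ℝ} (hσ : 0 < σ) {M : Matrix I I ℂ}
    (h : Accretive σ M) (v : I → ℂ) :
    normSq2 (M⁻¹ *ᵥ v) ≤ (1 / σ) ^ 2 * normSq2 v := by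
  have := h.normSq2_le hσ (M⁻¹ *ᵥ v)
  rwa [Matrix.mulVec_mulVec, h.mul_inv hσ, Matrix.one_mulVec] at this

lemma Accretive.normSq2_vecMul_inv_le {σ : ℝ} (hσ : 0 < σ) {M : Matrix I I ℂ}
    (h : Accretive σ M) (v : I → ℂ) :
    normSq2 (v ᵥ* M⁻¹) ≤ (1 / σ) ^ 2 * normSq2 v := by
  have := h.conjTranspose.normSq2_inv_mulVec_le hσ (star v)
  rwa [← Matrix.conjTranspose_nonsing_inv, ← normSq2_star, Matrix.star_mulVec, star_star,
    Matrix.conjTranspose_conjTranspose, normSq2_star] at this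

lemma Accretive.sum_row_inv_le {σ : ℝ} (hσ : 0 < σ) {M : Matrix I I ℂ}
    (h : Accretive σ M) (i : I) : ∑ j, ‖M⁻¹ i j‖ ^ 2 ≤ (1 / σ) ^ 2 := by
  have := h.normSq2_vecMul_inv_le hσ (Pi.single i 1)
  rw [normSq2_single, mul_one, Matrix.single_one_vecMul] at this
  exact this

lemma Accretive.norm_inv_apply_le {σ : ℝ} (hσ : 0 < σ) {M : Matrix I I ℂ}
    (h : Accretive σ M) (i j : I) : ‖M⁻¹ i j‖ ≤ 1 / σ := by
  have h1 := h.sum_row_inv_le hσ i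
  have h2 : ‖M⁻¹ i j‖ ^ 2 ≤ ∑ j, ‖M⁻¹ i j‖ ^ 2 :=
    Finset.single_le_sum (f := fun j => ‖M⁻¹ i j‖ ^ 2) (fun _ _ => by positivity)
      (Finset.mem_univ j)
  exact le_of_sq_le_sq (h2.trans h1) (by positivity)

/-- First resolvent identity. -/
lemma inv_sub_inv_of_isUnit {M M' : Matrix I I ℂ} (h : IsUnit M) (h' : IsUnit M') :
    M⁻¹ - M'⁻¹ = M⁻¹ * (M' - M) * M'⁻¹ := by
  rw [Matrix.mul_sub, Matrix.sub_mul, Matrix.nonsing_inv_mul _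
    ((Matrix.isUnit_iff_isUnit_det _).1 h), Matrix.one_mul, Matrix.mul_assoc,
    Matrix.mul_nonsing_inv _ ((Matrix.isUnit_iff_isUnit_det _).1 h'), Matrix.mul_one]

lemma inv_add_conjTranspose_inv_row {θ : I → ℂ} {K : Matrix I I ℂ} (hK : Kᴴ = -K)
    {W : Matrix I I ℂ} (hW : W * (Matrix.diagonal θ + K) = 1) :
    W + Wᴴ = W * Matrix.diagonal (fun i => ((2 * (θ i).re : ℝ) : ℂ)) * Wᴴ := by
  have h1 : Matrix.diagonal (fun i => ((2 * (θ i).re : ℝ) : ℂ))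
      = (Matrix.diagonal θ + K) + (Matrix.diagonal θ + K)ᴴ := by
    rw [Matrix.conjTranspose_add, hK, Matrix.diagonal_conjTranspose]
    have : Matrix.diagonal θ + K + (Matrix.diagonal (star θ) + -K)
        = Matrix.diagonal θ + Matrix.diagonal (star θ) := by abel
    rw [this, Matrix.diagonal_add]
    congr 1
    funext i
    simp [Complex.add_conj]
  have h2 : (Matrix.diagonal θ + K)ᴴ * Wᴴ = 1 := by
    rw [← Matrix.conjTranspose_mul, hW, Matrix.conjTranspose_one]
  rw [h1, Matrix.mul_add, hW, Matrix.add_mul, Matrix.one_mul, Matrix.mul_assoc, h2, Matrix.mul_one,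
    add_comm]

/-- Ward identity, along a row. -/
lemma re_inv_apply_row {θ : I → ℂ} {K : Matrix I I ℂ} (hK : Kᴴ = -K)
    {W : Matrix I I ℂ} (hW : W * (Matrix.diagonal θ + K) = 1) (i : I) :
    (W i i).re = ∑ k, ‖W i k‖ ^ 2 * (θ k).re := by
  have h := congrFun (congrFun (inv_add_conjTranspose_inv_row hK hW) i) i
  rw [Matrix.add_apply, Matrix.conjTranspose_apply, Matrix.mul_apply] at h
  have h1 : ∀ k, (W * Matrix.diagonal (fun i => ((2 * (θ i).re : ℝ) : ℂ))) i k * Wᴴ k i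
      = ((2 * (‖W i k‖ ^ 2 * (θ k).re) : ℝ) : ℂ) := by
    intro k
    rw [Matrix.mul_diagonal, Matrix.conjTranspose_apply]
    have := Complex.mul_conj' (W i k)
    simp only [RCLike.star_def]
    push_cast
    rw [← this]; ring
  simp only [h1] at h
  rw [RCLike.star_def, Complex.add_conj, ← Complex.ofReal_sum, Complex.ofReal_inj,
    ← Finset.mul_sum] at h
  linarith

/-- Ward identity, along a column. -/
lemma re_inv_apply_col {θ : I → ℂ} {K : Matrix I I ℂ} (hK : Kᴴ = -K)
    {W : Matrix I I ℂ} (hW : (Matrix.diagonal θ + K) * W = 1) (i : I) :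
    (W i i).re = ∑ k, ‖W k i‖ ^ 2 * (θ k).re := by
  have hW' : Wᴴ * (Matrix.diagonal (star θ) + Kᴴ) = 1 := by
    rw [← Matrix.diagonal_conjTranspose, ← Matrix.conjTranspose_add, ← Matrix.conjTranspose_mul,
      hW, Matrix.conjTranspose_one]
  have := re_inv_apply_row (K := Kᴴ) (by rw [hK, Matrix.conjTranspose_neg, hK]) hW' i
  simpa using this

end Accretive

section ProductAverage

open MeasureTheory

/-- A measurable function which is bounded. -/
structure BddMeas {α β : Type*} [MeasurableSpace α] [MeasurableSpace β] [Norm β] (f : α → β) :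
    Prop where
  meas : Measurable f
  bdd : ∃ C : ℝ, ∀ x, ‖f x‖ ≤ C

section BddMeas

variable {α : Type*} [MeasurableSpace α]

lemma BddMeas.integrable {β : Type*} [NormedAddCommGroup β] [MeasurableSpace β] [BorelSpace β]
    [SecondCountableTopology β] {f : α → β} (hf : BddMeas f) (μ : Measure α) [IsFiniteMeasure μ] :
    Integrable f μ := by
  obtain ⟨C, hC⟩ := hf.bdd
  exact Integrable.of_bound hf.meas.aestronglyMeasurable C (Filter.Eventually.of_forall hC)

lemma BddMeas.mul {β : Type*} [NormedRing β] [MeasurableSpace β] [BorelSpace β]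
    [SecondCountableTopology β] {f g : α → β} (hf : BddMeas f) (hg : BddMeas g) :
    BddMeas fun x => f x * g x := by
  obtain ⟨C, hC⟩ := hf.bdd
  obtain ⟨D, hD⟩ := hg.bdd
  refine ⟨hf.meas.mul hg.meas, C * D, fun x => (norm_mul_le _ _).trans ?_⟩
  exact mul_le_mul (hC x) (hD x) (norm_nonneg _) ((norm_nonneg _).trans (hC x))

lemma BddMeas.add {β : Type*} [NormedAddCommGroup β] [MeasurableSpace β] [BorelSpace β]
    [SecondCountableTopology β] {f g : α → β} (hf : BddMeas f) (hg : BddMeas g) :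
    BddMeas fun x => f x + g x := by
  obtain ⟨C, hC⟩ := hf.bdd
  obtain ⟨D, hD⟩ := hg.bdd
  exact ⟨hf.meas.add hg.meas, C + D, fun x => (norm_add_le _ _).trans (add_le_add (hC x) (hD x))⟩

lemma BddMeas.sub {β : Type*} [NormedAddCommGroup β] [MeasurableSpace β] [BorelSpace β]
    [SecondCountableTopology β] {f g : α → β} (hf : BddMeas f) (hg : BddMeas g) :
    BddMeas fun x => f x - g x := by
  obtain ⟨C, hC⟩ := hf.bdd
  obtain ⟨D, hD⟩ := hg.bdd
  exact ⟨hf.meas.sub hg.meas, C + D, fun x => (norm_sub_le _ _).trans (add_le_add (hC x) (hD x))⟩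

lemma BddMeas.const {β : Type*} [Norm β] [MeasurableSpace β] (c : β) :
    BddMeas fun _ : α => c :=
  ⟨measurable_const, ‖c‖, fun _ => le_rfl⟩

lemma BddMeas.norm {β : Type*} [NormedAddCommGroup β] [MeasurableSpace β] [BorelSpace β]
    {f : α → β} (hf : BddMeas f) : BddMeas fun x => ‖f x‖ := by
  obtain ⟨C, hC⟩ := hf.bdd
  exact ⟨hf.meas.norm, C, fun x => by simpa using hC x⟩

lemma BddMeas.pow {β : Type*} [NormedRing β] [MeasurableSpace β] [BorelSpace β]
    [SecondCountableTopology β] {f : α → β} (hf : BddMeas f) (k : ℕ) :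
    BddMeas fun x => f x ^ k := by
  induction k with
  | zero => simpa using BddMeas.const (α := α) (1 : β)
  | succ k ih => simpa only [pow_succ] using ih.mul hf

lemma BddMeas.sum {β κ : Type*} [NormedAddCommGroup β] [MeasurableSpace β] [BorelSpace β]
    [SecondCountableTopology β] {f : κ → α → β} (s : Finset κ) (hf : ∀ k, BddMeas (f k)) :
    BddMeas fun x => ∑ k ∈ s, f k x := by
  classical
  induction s using Finset.induction_on with
  | empty => simpa using BddMeas.const (α := α) (0 : β)
  | insert a s ha ih => simpa only [Finset.sum_insert ha] using (hf a).add ih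

lemma BddMeas.comp {β γ : Type*} [Norm β] [MeasurableSpace β] [MeasurableSpace γ] {f : α → β}
    (hf : BddMeas f) {φ : γ → α} (hφ : Measurable φ) : BddMeas fun x => f (φ x) := by
  obtain ⟨C, hC⟩ := hf.bdd
  exact ⟨hf.meas.comp hφ, C, fun x => hC _⟩

lemma BddMeas.ofReal {f : α → ℝ} (hf : BddMeas f) : BddMeas fun x => (f x : ℂ) := by
  obtain ⟨C, hC⟩ := hf.bdd
  exact ⟨Complex.measurable_ofReal.comp hf.meas, C, fun x => by simpa using hC x⟩

lemma BddMeas.conj {f : α → ℂ} (hf : BddMeas f) : BddMeas fun x => star (f x) := by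
  obtain ⟨C, hC⟩ := hf.bdd
  exact ⟨continuous_star.measurable.comp hf.meas, C, fun x => by simpa using hC x⟩

end BddMeas

variable {ι : Type*} [Fintype ι] [DecidableEq ι] {E : Type*} [MeasurableSpace E]
  (μ : ι → Measure E) [∀ i, IsProbabilityMeasure (μ i)]

lemma measurable_piecewise_prod (s : Finset ι) :
    Measurable fun q : (ι → E) × (ι → E) => s.piecewise q.1 q.2 := by
  refine measurable_pi_lambda _ fun i => ?_
  by_cases hi : i ∈ s
  · simp only [Finset.piecewise, hi, if_true]; fun_prop
  · simp only [Finset.piecewise, hi, if_false]; fun_prop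

lemma measurePreserving_piecewise (s : Finset ι) :
    MeasurePreserving (fun q : (ι → E) × (ι → E) => s.piecewise q.1 q.2)
      ((Measure.pi μ).prod (Measure.pi μ)) (Measure.pi μ) := by
  refine ⟨measurable_piecewise_prod s, ?_⟩
  symm
  refine Measure.pi_eq fun t ht => ?_
  rw [Measure.map_apply (measurable_piecewise_prod s) (MeasurableSet.univ_pi ht)]
  have hset : (fun q : (ι → E) × (ι → E) => s.piecewise q.1 q.2) ⁻¹' (Set.univ.pi t)
      = (Set.univ.pi fun i => if i ∈ s then t i else Set.univ) ×ˢ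
        (Set.univ.pi fun i => if i ∈ s then Set.univ else t i) := by
    ext q
    simp only [Set.mem_preimage, Set.mem_univ_pi, Set.mem_prod, ← forall_and]
    refine forall_congr' fun i => ?_
    by_cases hi : i ∈ s <;> simp [Finset.piecewise, hi]
  rw [hset, Measure.prod_prod, Measure.pi_pi, Measure.pi_pi, ← Finset.prod_mul_distrib]
  refine Finset.prod_congr rfl fun i _ => ?_
  by_cases hi : i ∈ s <;> simp [hi]

/-- Average of `f` over the coordinates outside `s`. -/
def avgOutside {F : Type*} [NormedAddCommGroup F] [NormedSpace ℝ F] (s : Finset ι)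
    (f : (ι → E) → F) (x : ι → E) : F :=
  ∫ y, f (s.piecewise x y) ∂(Measure.pi μ)

/-- `g` depends only on the coordinates in `s`. -/
def DependsOnFin {F : Type*} (s : Finset ι) (g : (ι → E) → F) : Prop :=
  ∀ x y, g (s.piecewise x y) = g x

/-- `g` does not depend on the coordinate `k`. -/
def IndepOfCoord {F : Type*} (k : ι) (g : (ι → E) → F) : Prop :=
  ∀ x e, g (Function.update x k e) = g x

lemma DependsOnFin.indepOfCoord {F : Type*} {s : Finset ι} {g : (ι → E) → F}
    (hg : DependsOnFin s g) {k : ι} (hk : k ∉ s) : IndepOfCoord k g := by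
  intro x e
  rw [← hg x (Function.update x k e)]
  congr 1
  funext i
  by_cases hi : i ∈ s
  · have : i ≠ k := fun h => hk (h ▸ hi)
    simp [Finset.piecewise, hi, this]
  · simp [Finset.piecewise, hi]

lemma IndepOfCoord.congr {F : Type*} {k : ι} {g : (ι → E) → F} (hg : IndepOfCoord k g)
    {x y : ι → E} (h : ∀ i, i ≠ k → x i = y i) : g x = g y := by
  rw [← hg x (y k)]
  congr 1
  funext i
  by_cases hi : i = k
  · subst hi; simp
  · simp [hi, h i hi]

lemma DependsOnFin.mono {F : Type*} {s t : Finset ι} (hst : s ⊆ t) {g : (ι → E) → F}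
    (hg : DependsOnFin s g) : DependsOnFin t g := by
  intro x y
  rw [← hg x (t.piecewise x y), ← hg (t.piecewise x y) (t.piecewise x y)]
  congr 1
  funext i
  by_cases hi : i ∈ s
  · simp [Finset.piecewise, hi, hst hi]
  · simp [Finset.piecewise, hi]

section avg

variable {F : Type*} [NormedAddCommGroup F] [NormedSpace ℝ F]

lemma dependsOnFin_avgOutside (s : Finset ι) (f : (ι → E) → F) :
    DependsOnFin s (avgOutside μ s f) := by
  intro x y
  unfold avgOutside
  congr 1
  funext z
  congr 1
  funext i
  by_cases hi : i ∈ s <;> simp [Finset.piecewise, hi]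

lemma avgOutside_empty (f : (ι → E) → F) (x : ι → E) :
    avgOutside μ ∅ f x = ∫ y, f y ∂(Measure.pi μ) := by
  simp [avgOutside]

lemma avgOutside_univ [CompleteSpace F] (f : (ι → E) → F) (x : ι → E) :
    avgOutside μ Finset.univ f x = f x := by
  simp [avgOutside]

lemma avgOutside_insert_of_indepOfCoord {s : Finset ι} {k : ι} {f : (ι → E) → F}
    (hf : IndepOfCoord k f) :
    avgOutside μ (insert k s) f = avgOutside μ s f := by
  funext x
  unfold avgOutside
  congr 1
  funext y
  refine hf.congr fun i hi => ?_
  by_cases his : i ∈ s <;> simp [Finset.piecewise, his, hi]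

variable [MeasurableSpace F] [BorelSpace F] [SecondCountableTopology F]

lemma BddMeas.avgOutside {s : Finset ι} {f : (ι → E) → F} (hf : BddMeas f) :
    BddMeas (avgOutside μ s f) := by
  obtain ⟨C, hC⟩ := hf.bdd
  constructor
  · have h1 : StronglyMeasurable (fun q : (ι → E) × (ι → E) => f (s.piecewise q.1 q.2)) :=
      (hf.meas.comp (measurable_piecewise_prod s)).stronglyMeasurable
    exact (h1.integral_prod_right (ν := Measure.pi μ)).measurable
  · refine ⟨C, fun x => ?_⟩
    refine (norm_integral_le_of_norm_le_const (C := C)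
      (Filter.Eventually.of_forall fun y => hC _)).trans_eq ?_
    simp

lemma integral_piecewise_prod (s : Finset ι) {f : (ι → E) → F} (hf : Measurable f) :
    ∫ x, f x ∂(Measure.pi μ)
      = ∫ q : (ι → E) × (ι → E), f (s.piecewise q.1 q.2)
          ∂((Measure.pi μ).prod (Measure.pi μ)) := by
  conv_lhs => rw [← (measurePreserving_piecewise μ s).map_eq]
  rw [integral_map (measurable_piecewise_prod s).aemeasurable hf.aestronglyMeasurable]

lemma integral_piecewise (s : Finset ι) {f : (ι → E) → F} (hf : BddMeas f) :
    ∫ x, ∫ y, f (s.piecewise x y) ∂(Measure.pi μ) ∂(Measure.pi μ)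
      = ∫ x, f x ∂(Measure.pi μ) := by
  rw [integral_piecewise_prod μ s hf.meas, integral_prod]
  exact (hf.comp (measurable_piecewise_prod s)).integrable _

end avg

section RCLike

variable {𝕜 : Type*} [RCLike 𝕜]

lemma integral_mul_avgOutside {s : Finset ι} {g φ : (ι → E) → 𝕜} (hg : BddMeas g)
    (hφ : BddMeas φ) (hgs : DependsOnFin s g) :
    ∫ x, g x * avgOutside μ s φ x ∂(Measure.pi μ) = ∫ x, g x * φ x ∂(Measure.pi μ) := by
  rw [← integral_piecewise μ s (hg.mul hφ)]
  refine integral_congr_ae (Filter.Eventually.of_forall fun x => ?_)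
  simp only [avgOutside, ← integral_const_mul]
  refine integral_congr_ae (Filter.Eventually.of_forall fun y => ?_)
  simp only [hgs x y]

lemma integral_avgOutside_mul_comm {s : Finset ι} {φ ψ : (ι → E) → 𝕜} (hφ : BddMeas φ)
    (hψ : BddMeas ψ) :
    ∫ x, avgOutside μ s φ x * ψ x ∂(Measure.pi μ)
      = ∫ x, φ x * avgOutside μ s ψ x ∂(Measure.pi μ) := by
  rw [← integral_mul_avgOutside μ (hφ.avgOutside μ) hψ (dependsOnFin_avgOutside μ s φ)]
  simp only [mul_comm (avgOutside μ s φ _), mul_comm (φ _)]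
  rw [integral_mul_avgOutside μ (hψ.avgOutside μ) hφ (dependsOnFin_avgOutside μ s ψ)]

/-- A function of the coordinate `k` and a function not depending on it are uncorrelated. -/
lemma integral_coord_mul {k : ι} {ψ : E → 𝕜} {Φ : (ι → E) → 𝕜} (hψ : Measurable ψ)
    (hΦ : Measurable Φ) (hk : IndepOfCoord k Φ) :
    ∫ x, ψ (x k) * Φ x ∂(Measure.pi μ) = (∫ e, ψ e ∂(μ k)) * ∫ x, Φ x ∂(Measure.pi μ) := by
  have hm : Measurable fun x : ι → E => ψ (x k) := hψ.comp (measurable_pi_apply k)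
  rw [integral_piecewise_prod μ {k} (f := fun x => ψ (x k) * Φ x) (hm.mul hΦ)]
  have h1 : ∀ q : (ι → E) × (ι → E), ψ ((({k} : Finset ι).piecewise q.1 q.2) k)
      * Φ (({k} : Finset ι).piecewise q.1 q.2) = ψ (q.1 k) * Φ q.2 := by
    intro q
    congr 1
    · simp [Finset.piecewise]
    · refine hk.congr fun i hi => ?_
      simp [Finset.piecewise, hi]
  simp only [h1]
  rw [integral_prod_mul (fun x : ι → E => ψ (x k)) Φ]
  congr 1
  rw [← (measurePreserving_eval μ k).map_eq]
  rw [integral_map (measurable_pi_apply k).aemeasurable hψ.aestronglyMeasurable]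

lemma integrable_coord_mul {k : ι} {ψ : E → 𝕜} {Φ : (ι → E) → 𝕜} (hψ : Integrable ψ (μ k))
    (hΦ : BddMeas Φ) : Integrable (fun x => ψ (x k) * Φ x) (Measure.pi μ) := by
  obtain ⟨C, hC⟩ := hΦ.bdd
  refine Integrable.mul_bdd (c := C) ?_ hΦ.meas.aestronglyMeasurable
    (Filter.Eventually.of_forall hC)
  exact (measurePreserving_eval μ k).integrable_comp_of_integrable hψ

end RCLike

lemma norm_avgOutside_pow_le {F : Type*} [NormedAddCommGroup F] [NormedSpace ℝ F]
    [MeasurableSpace F] [BorelSpace F] [SecondCountableTopology F]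
    {s : Finset ι} {f : (ι → E) → F} (hf : BddMeas f) (j : ℕ)
    (x : ι → E) : ‖avgOutside μ s f x‖ ^ j ≤ avgOutside μ s (fun x => ‖f x‖ ^ j) x := by
  have hm : Measurable fun y : ι → E => s.piecewise x y :=
    (measurable_piecewise_prod s).comp (measurable_const.prodMk measurable_id)
  calc ‖avgOutside μ s f x‖ ^ j
      ≤ (∫ y, ‖f (s.piecewise x y)‖ ∂(Measure.pi μ)) ^ j := by
        gcongr
        exact norm_integral_le_integral_norm _
    _ ≤ _ := by
        unfold avgOutside
        refine (convexOn_pow j).map_integral_le (by fun_prop) isClosed_Ici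
          (Filter.Eventually.of_forall fun y => norm_nonneg _)
          ((hf.norm.comp hm).integrable _) (((hf.norm.pow j).comp hm).integrable _)

end ProductAverage

section MomentInequality

open MeasureTheory

/-- The constant in the second order expansion of `‖a + b‖ ^ (2 * (q + 1))`. -/
def expansionConst : ℕ → ℝ
  | 0 => 1
  | q + 1 => 1 + 8 * (q + 1) + 8 * expansionConst q

lemma one_le_expansionConst (q : ℕ) : 1 ≤ expansionConst q := by
  induction q with
  | zero => simp [expansionConst]
  | succ q ih => simp only [expansionConst]; nlinarith [(Nat.cast_nonneg q : (0 : ℝ) ≤ q)]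

lemma norm_add_pow_le (q : ℕ) (a b : ℂ) :
    (‖a + b‖ ^ 2) ^ (q + 1) ≤ (‖a‖ ^ 2) ^ (q + 1)
      + 2 * (q + 1) * ((‖a‖ ^ 2) ^ q * (star a * b).re)
      + expansionConst q * ((‖a‖ ^ 2) ^ q * ‖b‖ ^ 2 + (‖b‖ ^ 2) ^ (q + 1)) := by
  have hN : ‖a + b‖ ^ 2 = ‖a‖ ^ 2 + 2 * (star a * b).re + ‖b‖ ^ 2 := by
    rw [Complex.sq_norm, Complex.sq_norm, Complex.sq_norm, Complex.normSq_add]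
    simp only [RCLike.star_def, Complex.mul_re, Complex.conj_re, Complex.conj_im]
    ring
  have hr : |(star a * b).re| ≤ ‖a‖ * ‖b‖ := by
    refine (Complex.abs_re_le_norm _).trans_eq ?_
    rw [norm_mul, norm_star]
  set r := (star a * b).re
  have hr2 : r ^ 2 ≤ ‖a‖ ^ 2 * ‖b‖ ^ 2 := by
    rw [← sq_abs, ← mul_pow]; gcongr
  have hrb : 2 * |r| ≤ ‖a‖ ^ 2 + ‖b‖ ^ 2 := by nlinarith [sq_nonneg (‖a‖ - ‖b‖)]
  induction q with
  | zero => simp [expansionConst, hN]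
  | succ q ih =>
    have hN0 : 0 ≤ ‖a + b‖ ^ 2 := by positivity
    have hX : 0 ≤ ‖a‖ ^ 2 := by positivity
    have hY : 0 ≤ ‖b‖ ^ 2 := by positivity
    have hC := one_le_expansionConst q
    set N := ‖a + b‖ ^ 2
    set X := ‖a‖ ^ 2
    set Y := ‖b‖ ^ 2
    set C := expansionConst q with hCdef
    have hstep := mul_le_mul_of_nonneg_right ih hN0
    rw [← pow_succ] at hstep
    refine hstep.trans ?_
    have hXq : 0 ≤ X ^ q := by positivity
    have hYq : 0 ≤ Y ^ q := by positivity
    have hNle : N ≤ 2 * (X + Y) := by rw [hN]; linarith [le_abs_self r]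
    have hG1 : X ^ q * Y ^ 2 ≤ X ^ (q + 1) * Y + Y ^ (q + 2) := by
      rcases le_total X Y with h | h
      · have : X ^ q * Y ^ 2 ≤ Y ^ q * Y ^ 2 := by gcongr
        have h2 : 0 ≤ X ^ (q + 1) * Y := by positivity
        calc _ ≤ Y ^ q * Y ^ 2 := this
          _ ≤ _ := by rw [← pow_add]; linarith
      · have : X ^ q * Y * Y ≤ X ^ q * Y * X := by gcongr
        have h2 : 0 ≤ Y ^ (q + 2) := by positivity
        calc _ = X ^ q * Y * Y := by ring
          _ ≤ _ := this
          _ = X ^ (q + 1) * Y := by ring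
          _ ≤ _ := by linarith
    have hG2 : X * Y ^ (q + 1) ≤ X ^ (q + 1) * Y + Y ^ (q + 2) := by
      rcases le_total X Y with h | h
      · have : X * Y ^ (q + 1) ≤ Y * Y ^ (q + 1) := by gcongr
        have h2 : 0 ≤ X ^ (q + 1) * Y := by positivity
        calc _ ≤ Y * Y ^ (q + 1) := this
          _ = Y ^ (q + 2) := by ring
          _ ≤ _ := by linarith
      · have : X * Y ^ q * Y ≤ X * X ^ q * Y := by gcongr
        have h2 : 0 ≤ Y ^ (q + 2) := by positivity
        calc _ = X * Y ^ q * Y := by ring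
          _ ≤ _ := this
          _ = X ^ (q + 1) * Y := by ring
          _ ≤ _ := by linarith
    set G := X ^ (q + 1) * Y + Y ^ (q + 2) with hG
    have hXY : X ^ (q + 1) * Y ≤ G := by
      have : 0 ≤ Y ^ (q + 2) := by positivity
      linarith
    have hYG : Y ^ (q + 2) ≤ G := by
      have : 0 ≤ X ^ (q + 1) * Y := by positivity
      linarith
    have hG0 : 0 ≤ G := by positivity
    have e1 : X ^ q * (2 * r ^ 2 + r * Y) ≤ 4 * G := by
      have h1 : r * Y ≤ (X + Y) * Y := by
        have : r ≤ X + Y := by linarith [le_abs_self r, abs_nonneg r]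
        gcongr
      calc X ^ q * (2 * r ^ 2 + r * Y) ≤ X ^ q * (2 * (X * Y) + (X + Y) * Y) := by gcongr
        _ = 3 * (X ^ (q + 1) * Y) + X ^ q * Y ^ 2 := by ring
        _ ≤ _ := by linarith
    have e2 : (X ^ q * Y + Y ^ (q + 1)) * N ≤ 8 * G := by
      calc (X ^ q * Y + Y ^ (q + 1)) * N ≤ (X ^ q * Y + Y ^ (q + 1)) * (2 * (X + Y)) := by
            gcongr
        _ = 2 * (X ^ (q + 1) * Y + X ^ q * Y ^ 2 + X * Y ^ (q + 1) + Y ^ (q + 2)) := by ring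
        _ ≤ _ := by linarith
    calc (X ^ (q + 1) + 2 * (q + 1) * (X ^ q * r) + C * (X ^ q * Y + Y ^ (q + 1))) * N
        = X ^ (q + 2) + 2 * (q + 2) * (X ^ (q + 1) * r) + X ^ (q + 1) * Y
          + 2 * (q + 1) * (X ^ q * (2 * r ^ 2 + r * Y))
          + C * ((X ^ q * Y + Y ^ (q + 1)) * N) := by rw [hN]; ring
      _ ≤ X ^ (q + 2) + 2 * (q + 2) * (X ^ (q + 1) * r) + G
          + 2 * (q + 1) * (4 * G) + C * (8 * G) := by gcongr
      _ = _ := by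
        simp only [expansionConst, ← hCdef]
        push_cast
        ring

lemma pow_succ_sub_pow_succ_le {x y : ℝ} (hy : 0 ≤ y) (hxy : y ≤ x) (j : ℕ) :
    x ^ (j + 1) - y ^ (j + 1) ≤ (j + 1) * ((x - y) * x ^ j) := by
  induction j with
  | zero => simp
  | succ j ih =>
    have h1 : y ^ (j + 1) ≤ x ^ (j + 1) := by gcongr
    have h2 := mul_le_mul_of_nonneg_left ih (hy.trans hxy)
    have h3 := mul_le_mul_of_nonneg_left h1 (sub_nonneg.2 hxy)
    push_cast
    calc x ^ (j + 1 + 1) - y ^ (j + 1 + 1)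
        = x * (x ^ (j + 1) - y ^ (j + 1)) + (x - y) * y ^ (j + 1) := by ring
      _ ≤ x * ((j + 1) * ((x - y) * x ^ j)) + (x - y) * x ^ (j + 1) := add_le_add h2 h3
      _ = _ := by ring

lemma pow_mul_le_add {η t a : ℝ} (hη : 0 < η) (ht : 0 ≤ t) (ha : 0 ≤ a) (q : ℕ) :
    t ^ q * a ≤ η * t ^ (q + 1) + (1 / η) ^ q * a ^ (q + 1) := by
  rcases le_total a (η * t) with h | h
  · have h1 : t ^ q * a ≤ t ^ q * (η * t) := by gcongr
    have h2 : 0 ≤ (1 / η) ^ q * a ^ (q + 1) := by positivity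
    calc _ ≤ _ := h1
      _ = η * t ^ (q + 1) := by ring
      _ ≤ _ := by linarith
  · have h0 : t ≤ 1 / η * a := by
      rw [one_div, inv_mul_eq_div, le_div_iff₀ hη]; linarith
    have h1 : t ^ q * a ≤ (1 / η * a) ^ q * a := by gcongr
    have h2 : 0 ≤ η * t ^ (q + 1) := by positivity
    calc _ ≤ _ := h1
      _ = (1 / η) ^ q * a ^ (q + 1) := by rw [mul_pow]; ring
      _ ≤ _ := by linarith

variable {ι : Type*} [Fintype ι] [DecidableEq ι] {E : Type*} [MeasurableSpace E]
  (μ : ι → Measure E) [∀ i, IsProbabilityMeasure (μ i)]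

lemma DependsOnFin.comp {F G : Type*} {s : Finset ι} {g : (ι → E) → F} (hg : DependsOnFin s g)
    (φ : F → G) : DependsOnFin s fun x => φ (g x) := fun x y => by
  show φ _ = φ _
  rw [hg x y]

lemma integral_sq_increment_le {s : Finset ι} {g : (ι → E) → ℝ} (hg : BddMeas g)
    (hg0 : ∀ x, 0 ≤ g x) (hgs : DependsOnFin s g) {h : (ι → E) → ℂ} (hh : BddMeas h) (j : ℕ) :
    ∫ x, g x * ‖avgOutside μ s h x‖ ^ j ∂(Measure.pi μ)
      ≤ ∫ x, g x * ‖h x‖ ^ j ∂(Measure.pi μ) := by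
  rw [← integral_mul_avgOutside μ hg (hh.norm.pow j) hgs]
  refine integral_mono ((hg.mul ((hh.avgOutside μ).norm.pow j)).integrable _)
    ((hg.mul ((hh.norm.pow j).avgOutside μ)).integrable _) fun x => ?_
  exact mul_le_mul_of_nonneg_left (norm_avgOutside_pow_le μ hh j x) (hg0 x)

/-- One step of the martingale decomposition. -/
lemma integral_step_le (q : ℕ) {s : Finset ι} {k : ι} {f f₀ : (ι → E) → ℂ}
    (hf : BddMeas f) (hf₀ : BddMeas f₀) (h₀ : IndepOfCoord k f₀) (c : ℂ) :
    ∫ x, (‖avgOutside μ (insert k s) f x - c‖ ^ 2) ^ (q + 1) ∂(Measure.pi μ)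
      ≤ ∫ x, (‖avgOutside μ s f x - c‖ ^ 2) ^ (q + 1) ∂(Measure.pi μ)
        + expansionConst q * 4 ^ (q + 1) *
          (∫ x, (‖avgOutside μ s f x - c‖ ^ 2) ^ q * ‖f x - f₀ x‖ ^ 2 ∂(Measure.pi μ)
            + ∫ x, (‖f x - f₀ x‖ ^ 2) ^ (q + 1) ∂(Measure.pi μ)) := by
  set S : (ι → E) → ℂ := fun x => avgOutside μ s f x - c with hS
  set h : (ι → E) → ℂ := fun x => f x - f₀ x with hh
  have hSb : BddMeas S := (hf.avgOutside μ).sub (BddMeas.const c)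
  have hhb : BddMeas h := hf.sub hf₀
  have hSd : DependsOnFin s S := (dependsOnFin_avgOutside μ s f).comp fun w => w - c
  set Δ : (ι → E) → ℂ := fun x => avgOutside μ (insert k s) f x - avgOutside μ s f x with hΔ
  have hΔb : BddMeas Δ := (hf.avgOutside μ).sub (hf.avgOutside μ)
  have hsub : ∀ t : Finset ι, ∀ x,
      avgOutside μ t h x = avgOutside μ t f x - avgOutside μ t f₀ x := by
    intro t x
    have hm : Measurable fun y : ι → E => t.piecewise x y :=
      (measurable_piecewise_prod t).comp (measurable_const.prodMk measurable_id)
    exact integral_sub ((hf.comp hm).integrable _) ((hf₀.comp hm).integrable _)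
  have hΔh : ∀ x, Δ x = avgOutside μ (insert k s) h x - avgOutside μ s h x := by
    intro x
    rw [hsub, hsub, avgOutside_insert_of_indepOfCoord μ h₀]
    simp [hΔ]
  have hΔnorm : ∀ x (j : ℕ), ‖Δ x‖ ^ (j + 1) ≤
      2 ^ j * (‖avgOutside μ (insert k s) h x‖ ^ (j + 1) + ‖avgOutside μ s h x‖ ^ (j + 1)) := by
    intro x j
    rw [hΔh x]
    refine (pow_le_pow_left₀ (norm_nonneg _) (norm_sub_le _ _) _).trans ?_
    exact add_pow_le (norm_nonneg _) (norm_nonneg _) (j + 1)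
  have hins : s ⊆ insert k s := Finset.subset_insert _ _
  have hgb : BddMeas fun x => (‖S x‖ ^ 2) ^ q := (hSb.norm.pow 2).pow q
  have hgd : DependsOnFin s fun x => (‖S x‖ ^ 2) ^ q := hSd.comp fun w => (‖w‖ ^ 2) ^ q
  have hpow : (4 : ℝ) ≤ 4 ^ (q + 1) := by
    rw [pow_succ]; linarith [one_le_pow₀ (by norm_num : (1 : ℝ) ≤ 4) (n := q)]
  -- quadratic term
  have hquad : ∫ x, (‖S x‖ ^ 2) ^ q * ‖Δ x‖ ^ 2 ∂(Measure.pi μ)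
      ≤ 4 ^ (q + 1) * ∫ x, (‖S x‖ ^ 2) ^ q * ‖h x‖ ^ 2 ∂(Measure.pi μ) := by
    have h1 := integral_sq_increment_le μ hgb (fun x => by positivity) hgd hhb 2
    have h2 := integral_sq_increment_le μ hgb (fun x => by positivity) (hgd.mono hins) hhb 2
    have h3 : ∫ x, (‖S x‖ ^ 2) ^ q * ‖Δ x‖ ^ 2 ∂(Measure.pi μ)
        ≤ ∫ x, 2 * ((‖S x‖ ^ 2) ^ q * ‖avgOutside μ (insert k s) h x‖ ^ 2)
            + 2 * ((‖S x‖ ^ 2) ^ q * ‖avgOutside μ s h x‖ ^ 2) ∂(Measure.pi μ) := by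
      refine integral_mono ((hgb.mul (hΔb.norm.pow 2)).integrable _) ?_ fun x => ?_
      · exact (((hgb.mul ((hhb.avgOutside μ).norm.pow 2)).integrable _).const_mul 2).add
          (((hgb.mul ((hhb.avgOutside μ).norm.pow 2)).integrable _).const_mul 2)
      · have := mul_le_mul_of_nonneg_left (hΔnorm x 1) (by positivity : 0 ≤ (‖S x‖ ^ 2) ^ q)
        simp only [pow_one, Nat.reduceAdd] at this
        simp only
        linarith
    rw [integral_add (((hgb.mul ((hhb.avgOutside μ).norm.pow 2)).integrable _).const_mul 2)
      (((hgb.mul ((hhb.avgOutside μ).norm.pow 2)).integrable _).const_mul 2),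
      integral_const_mul, integral_const_mul] at h3
    have h4 : 0 ≤ ∫ x, (‖S x‖ ^ 2) ^ q * ‖h x‖ ^ 2 ∂(Measure.pi μ) :=
      integral_nonneg fun x => by positivity
    nlinarith
  -- top power
  have htop : ∫ x, (‖Δ x‖ ^ 2) ^ (q + 1) ∂(Measure.pi μ)
      ≤ 4 ^ (q + 1) * ∫ x, (‖h x‖ ^ 2) ^ (q + 1) ∂(Measure.pi μ) := by
    have h1 := integral_sq_increment_le μ (s := s) (BddMeas.const (1 : ℝ)) (fun _ => zero_le_one)
      (fun _ _ => rfl) hhb (2 * q + 1 + 1)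
    have h2 := integral_sq_increment_le μ (s := insert k s) (BddMeas.const (1 : ℝ))
      (fun _ => zero_le_one) (fun _ _ => rfl) hhb (2 * q + 1 + 1)
    simp only [one_mul] at h1 h2
    have h3 : ∫ x, (‖Δ x‖ ^ 2) ^ (q + 1) ∂(Measure.pi μ)
        ≤ ∫ x, 2 ^ (2 * q + 1) * ‖avgOutside μ (insert k s) h x‖ ^ (2 * q + 1 + 1)
            + 2 ^ (2 * q + 1) * ‖avgOutside μ s h x‖ ^ (2 * q + 1 + 1) ∂(Measure.pi μ) := by
      refine integral_mono (((hΔb.norm.pow 2).pow _).integrable _) ?_ fun x => ?_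
      · exact ((((hhb.avgOutside μ).norm.pow _).integrable _).const_mul _).add
          ((((hhb.avgOutside μ).norm.pow _).integrable _).const_mul _)
      · have := hΔnorm x (2 * q + 1)
        rw [mul_add] at this
        rwa [show (‖Δ x‖ ^ 2) ^ (q + 1) = ‖Δ x‖ ^ (2 * q + 1 + 1) by ring]
    rw [integral_add ((((hhb.avgOutside μ).norm.pow _).integrable _).const_mul _)
      ((((hhb.avgOutside μ).norm.pow _).integrable _).const_mul _),
      integral_const_mul, integral_const_mul] at h3
    have h5 : ∀ x, (‖h x‖ ^ 2) ^ (q + 1) = ‖h x‖ ^ (2 * q + 1 + 1) := fun x => by ring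
    simp only [h5]
    have h6 : (4 : ℝ) ^ (q + 1) = 2 * 2 ^ (2 * q + 1) := by
      rw [← pow_succ', show 2 * q + 1 + 1 = 2 * (q + 1) by ring, pow_mul]; norm_num
    rw [h6]
    have h7 : (0 : ℝ) ≤ 2 ^ (2 * q + 1) := by positivity
    nlinarith [mul_le_mul_of_nonneg_left h1 h7, mul_le_mul_of_nonneg_left h2 h7]
  -- linear term
  have hlin : ∫ x, (‖S x‖ ^ 2) ^ q * (star (S x) * Δ x).re ∂(Measure.pi μ) = 0 := by
    have hGb : BddMeas fun x => (((‖S x‖ ^ 2) ^ q : ℝ) : ℂ) * star (S x) := hgb.ofReal.mul hSb.conj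
    have hGd : DependsOnFin s fun x => (((‖S x‖ ^ 2) ^ q : ℝ) : ℂ) * star (S x) :=
      hSd.comp fun w => (((‖w‖ ^ 2) ^ q : ℝ) : ℂ) * star w
    have h1 : ∫ x, (((‖S x‖ ^ 2) ^ q : ℝ) : ℂ) * star (S x) * Δ x ∂(Measure.pi μ) = 0 := by
      simp only [hΔ, mul_sub]
      rw [integral_sub ((hGb.mul (hf.avgOutside μ)).integrable _)
        ((hGb.mul (hf.avgOutside μ)).integrable _),
        integral_mul_avgOutside μ hGb hf hGd, integral_mul_avgOutside μ hGb hf (hGd.mono hins),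
        sub_self]
    have h2 := congrArg Complex.re h1
    rw [← RCLike.re_eq_complex_re, ← integral_re ((hGb.mul hΔb).integrable _)] at h2
    simp only [RCLike.re_eq_complex_re, mul_assoc, Complex.re_ofReal_mul, Complex.zero_re] at h2
    exact h2
  have hC := one_le_expansionConst q
  have hpt : ∀ x, (‖avgOutside μ (insert k s) f x - c‖ ^ 2) ^ (q + 1)
      ≤ (‖S x‖ ^ 2) ^ (q + 1) + 2 * (q + 1) * ((‖S x‖ ^ 2) ^ q * (star (S x) * Δ x).re)
        + expansionConst q * ((‖S x‖ ^ 2) ^ q * ‖Δ x‖ ^ 2 + (‖Δ x‖ ^ 2) ^ (q + 1)) := by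
    intro x
    have : avgOutside μ (insert k s) f x - c = S x + Δ x := by simp [hS, hΔ]
    rw [this]
    exact norm_add_pow_le q _ _
  have hre : BddMeas fun x => (star (S x) * Δ x).re := by
    have := hSb.conj.mul hΔb
    obtain ⟨C, hC⟩ := this.bdd
    exact ⟨Complex.measurable_re.comp this.meas, C,
      fun x => (Complex.abs_re_le_norm _).trans (hC x)⟩
  have i1 := ((hSb.norm.pow 2).pow (q + 1)).integrable (Measure.pi μ)
  have i2 := ((hgb.mul hre).integrable (Measure.pi μ)).const_mul (2 * ((q : ℝ) + 1))
  have i3 := (hgb.mul (hΔb.norm.pow 2)).integrable (Measure.pi μ)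
  have i4 := ((hΔb.norm.pow 2).pow (q + 1)).integrable (Measure.pi μ)
  have hint := integral_mono
    (((((hf.avgOutside μ (s := insert k s)).sub (BddMeas.const c)).norm.pow 2).pow
      (q + 1)).integrable (Measure.pi μ))
    ((i1.add i2).add ((i3.add i4).const_mul (expansionConst q))) hpt
  refine hint.trans ?_
  rw [integral_add' (i1.add i2) ((i3.add i4).const_mul _), integral_add' i1 i2, integral_const_mul,
    integral_const_mul, integral_add' i3 i4, hlin, mul_zero, add_zero, mul_assoc,
    mul_add (4 ^ (q + 1))]
  gcongr

/-- The constant in the moment inequality `integral_norm_sub_integral_pow_le`. -/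
def momentConst (q : ℕ) : ℝ :=
  2 * (expansionConst q * 4 ^ (q + 1)) *
    ((2 * (expansionConst q * 4 ^ (q + 1))) ^ q * (q + 1).factorial + 1)

/-- Moments of a compensator whose uncompensated version is bounded by `B`. -/
lemma integral_sum_avgOutside_pow_le {K : ℕ} {s : ℕ → Finset ι} (hs : Monotone s)
    {Z : ℕ → (ι → E) → ℝ} (hZ : ∀ m, BddMeas (Z m)) (hZ0 : ∀ m x, 0 ≤ Z m x) {B : ℝ}
    (hB : ∀ x, ∑ m ∈ Finset.range K, Z m x ≤ B) (j : ℕ) :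
    ∫ x, (∑ m ∈ Finset.range K, avgOutside μ (s m) (Z m) x) ^ j ∂(Measure.pi μ)
      ≤ j.factorial * B ^ j := by
  set a : ℕ → (ι → E) → ℝ := fun m => avgOutside μ (s m) (Z m) with ha
  set A : ℕ → (ι → E) → ℝ := fun M x => ∑ m ∈ Finset.range M, a m x with hA
  have ha0 : ∀ m x, 0 ≤ a m x := fun m x => integral_nonneg fun y => hZ0 m _
  have hab : ∀ m, BddMeas (a m) := fun m => (hZ m).avgOutside μ
  have hAb : ∀ M, BddMeas (A M) := fun M => BddMeas.sum _ hab
  have hA0 : ∀ M x, 0 ≤ A M x := fun M x => Finset.sum_nonneg fun m _ => ha0 m x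
  have hAmono : ∀ x, Monotone fun M => A M x := fun x =>
    monotone_nat_of_le_succ fun M => by
      simp only [hA, Finset.sum_range_succ]; linarith [ha0 M x]
  have hB0 : ∀ x : ι → E, 0 ≤ B := fun x =>
    (Finset.sum_nonneg fun m _ => hZ0 m x).trans (hB x)
  have hAd : ∀ m, DependsOnFin (s m) (A (m + 1)) := by
    intro m x y
    refine Finset.sum_congr rfl fun l hl => ?_
    exact ((dependsOnFin_avgOutside μ (s l) (Z l)).mono
      (hs (Nat.lt_succ_iff.1 (Finset.mem_range.1 hl)))) x y
  show ∫ x, A K x ^ j ∂(Measure.pi μ) ≤ _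
  induction j with
  | zero => simp
  | succ j ih =>
    have hpt : ∀ x, A K x ^ (j + 1)
        ≤ ∑ m ∈ Finset.range K, (j + 1) * (A (m + 1) x ^ j * a m x) := by
      intro x
      have h1 := Finset.sum_range_sub (fun M => A M x ^ (j + 1)) K
      have h2 : A 0 x ^ (j + 1) = 0 := by simp [hA]
      rw [h2, sub_zero] at h1
      rw [← h1]
      refine Finset.sum_le_sum fun m _ => ?_
      have h3 := pow_succ_sub_pow_succ_le (hA0 m x) (hAmono x (Nat.le_succ m)) j
      have h4 : A (m + 1) x - A m x = a m x := by simp [hA, Finset.sum_range_succ]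
      rw [Nat.succ_eq_add_one, h4] at h3
      rw [mul_comm (A (m + 1) x ^ j)]
      exact h3
    have hint : ∀ m, BddMeas fun x => A (m + 1) x ^ j * a m x := fun m =>
      ((hAb _).pow j).mul (hab m)
    calc ∫ x, A K x ^ (j + 1) ∂(Measure.pi μ)
        ≤ ∫ x, ∑ m ∈ Finset.range K, (j + 1) * (A (m + 1) x ^ j * a m x) ∂(Measure.pi μ) :=
          integral_mono (((hAb K).pow _).integrable _)
            (integrable_finsetSum _ fun m _ => ((hint m).integrable _).const_mul _) hpt
      _ = ∑ m ∈ Finset.range K, (j + 1) * ∫ x, A (m + 1) x ^ j * Z m x ∂(Measure.pi μ) := by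
          rw [integral_finsetSum _ fun m _ => ((hint m).integrable _).const_mul _]
          refine Finset.sum_congr rfl fun m _ => ?_
          rw [integral_const_mul]
          congr 1
          exact integral_mul_avgOutside μ ((hAb _).pow j) (hZ m) ((hAd m).comp fun w => w ^ j)
      _ ≤ ∑ m ∈ Finset.range K, (j + 1) * ∫ x, A K x ^ j * Z m x ∂(Measure.pi μ) := by
          refine Finset.sum_le_sum fun m hm => ?_
          refine mul_le_mul_of_nonneg_left (integral_mono
            ((((hAb (m + 1)).pow j).mul (hZ m)).integrable _)
            ((((hAb K).pow j).mul (hZ m)).integrable _) fun x => ?_) (by positivity)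
          have := hAmono x (Finset.mem_range.1 hm)
          exact mul_le_mul_of_nonneg_right (pow_le_pow_left₀ (hA0 _ x) this j) (hZ0 m x)
      _ = (j + 1) * ∫ x, A K x ^ j * ∑ m ∈ Finset.range K, Z m x ∂(Measure.pi μ) := by
          rw [← Finset.mul_sum, ← integral_finsetSum _
            fun m _ => (((hAb K).pow j).mul (hZ m)).integrable _]
          simp only [Finset.mul_sum]
      _ ≤ (j + 1) * ∫ x, B * A K x ^ j ∂(Measure.pi μ) := by
          gcongr (j + 1) * ?_
          refine integral_mono ((((hAb K).pow j).mul (BddMeas.sum _ hZ)).integrable _)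
            ((((hAb K).pow j).integrable _).const_mul _) fun x => ?_
          simp only
          rw [mul_comm B]
          exact mul_le_mul_of_nonneg_left (hB x) (pow_nonneg (hA0 K x) j)
      _ ≤ (j + 1).factorial * B ^ (j + 1) := by
          rw [integral_const_mul]
          have hB0' : 0 ≤ B := by
            have : Nonempty (ι → E) := (Measure.pi μ).nonempty_of_neZero
            exact hB0 (Classical.arbitrary _)
          have : B * ∫ x, A K x ^ j ∂(Measure.pi μ) ≤ B * (j.factorial * B ^ j) := by gcongr
          calc _ ≤ ((j : ℝ) + 1) * (B * (j.factorial * B ^ j)) := by gcongr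
            _ = _ := by rw [Nat.factorial_succ]; push_cast; ring

/-- A moment inequality of Burkholder type for functions of independent variables. The increment
`f - f k` in the direction of the coordinate `k` is controlled by `Z k`, tested against functions
not depending on this coordinate. -/
theorem integral_norm_sub_integral_pow_le (q : ℕ) {f : (ι → E) → ℂ} (hf : BddMeas f)
    {f₀ : ι → (ι → E) → ℂ} (hf₀ : ∀ k, BddMeas (f₀ k)) (h₀ : ∀ k, IndepOfCoord k (f₀ k))
    {Z : ι → (ι → E) → ℝ} (hZ : ∀ k, BddMeas (Z k)) (hZ0 : ∀ k x, 0 ≤ Z k x) {B : ℝ}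
    (hB : ∀ x, ∑ k, Z k x ≤ B)
    (h2 : ∀ k (g : (ι → E) → ℝ), BddMeas g → (∀ x, 0 ≤ g x) → IndepOfCoord k g →
      ∫ x, g x * ‖f x - f₀ k x‖ ^ 2 ∂(Measure.pi μ) ≤ ∫ x, g x * Z k x ∂(Measure.pi μ))
    (hp : ∀ k, ∫ x, (‖f x - f₀ k x‖ ^ 2) ^ (q + 1) ∂(Measure.pi μ)
      ≤ ∫ x, Z k x ^ (q + 1) ∂(Measure.pi μ)) :
    ∫ x, (‖f x - ∫ y, f y ∂(Measure.pi μ)‖ ^ 2) ^ (q + 1) ∂(Measure.pi μ)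
      ≤ momentConst q * B ^ (q + 1) := by
  have : Nonempty (ι → E) := (Measure.pi μ).nonempty_of_neZero
  have hB0 : 0 ≤ B := (Finset.sum_nonneg fun k _ => hZ0 k (Classical.arbitrary _)).trans (hB _)
  set c := ∫ y, f y ∂(Measure.pi μ) with hc
  set K := Fintype.card ι
  let e : ι ≃ Fin K := Fintype.equivFin ι
  let s : ℕ → Finset ι := fun m => Finset.univ.filter fun l => (e l : ℕ) < m
  have hs : Monotone s := fun m m' hmm l hl => by
    simp only [s, Finset.mem_filter, Finset.mem_univ, true_and] at hl ⊢
    omega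
  let Zn : ℕ → (ι → E) → ℝ := fun m x => if h : m < K then Z (e.symm ⟨m, h⟩) x else 0
  have hZn : ∀ m, BddMeas (Zn m) := by
    intro m
    by_cases h : m < K
    · simpa [Zn, h] using hZ (e.symm ⟨m, h⟩)
    · simpa [Zn, h] using BddMeas.const (α := ι → E) (0 : ℝ)
  have hZn0 : ∀ m x, 0 ≤ Zn m x := by
    intro m x
    by_cases h : m < K
    · simpa [Zn, h] using hZ0 (e.symm ⟨m, h⟩) x
    · simp [Zn, h]
  have hZnsum : ∀ x, ∑ m ∈ Finset.range K, Zn m x ≤ B := by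
    intro x
    rw [Finset.sum_range]
    refine le_trans (le_of_eq ?_) (hB x)
    rw [← e.symm.sum_comp]
    exact Finset.sum_congr rfl fun m _ => by simp [Zn]
  set F : (ι → E) → ℝ := fun x => ‖f x - c‖ ^ 2 with hF
  have hFb : BddMeas F := (hf.sub (BddMeas.const c)).norm.pow 2
  have hF0 : ∀ x, 0 ≤ F x := fun x => by positivity
  set D := expansionConst q * 4 ^ (q + 1) with hD
  have hD0 : 0 < D := by
    have := one_le_expansionConst q
    positivity
  have hstep : ∀ m ∈ Finset.range K,
      ∫ x, (‖avgOutside μ (s (m + 1)) f x - c‖ ^ 2) ^ (q + 1) ∂(Measure.pi μ)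
        - ∫ x, (‖avgOutside μ (s m) f x - c‖ ^ 2) ^ (q + 1) ∂(Measure.pi μ)
      ≤ D * (∫ x, F x ^ q * avgOutside μ (s m) (Zn m) x ∂(Measure.pi μ)
          + ∫ x, B ^ q * Zn m x ∂(Measure.pi μ)) := by
    intro m hm
    have hmK := Finset.mem_range.1 hm
    set k := e.symm ⟨m, hmK⟩ with hk
    have hZk : ∀ x, Zn m x = Z k x := fun x => by simp [Zn, hmK, hk]
    have hks : k ∉ s m := by simp [s, hk]
    have hins : s (m + 1) = insert k (s m) := by
      ext l
      simp only [s, Finset.mem_insert, Finset.mem_filter, Finset.mem_univ, true_and, hk,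
        Equiv.eq_symm_apply, Fin.ext_iff]
      omega
    have h1 := integral_step_le μ q (s := s m) hf (hf₀ k) (h₀ k) c
    rw [← hins] at h1
    have hSd : DependsOnFin (s m) fun x => (‖avgOutside μ (s m) f x - c‖ ^ 2) ^ q :=
      (dependsOnFin_avgOutside μ (s m) f).comp fun w => (‖w - c‖ ^ 2) ^ q
    have hSb : BddMeas fun x => (‖avgOutside μ (s m) f x - c‖ ^ 2) ^ q :=
      (((hf.avgOutside μ).sub (BddMeas.const c)).norm.pow 2).pow q
    have h3 := h2 k _ hSb (fun x => by positivity) (hSd.indepOfCoord hks)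
    have hjen : ∀ x, (‖avgOutside μ (s m) f x - c‖ ^ 2) ^ q
        ≤ avgOutside μ (s m) (fun x => F x ^ q) x := by
      intro x
      have hsubc : avgOutside μ (s m) f x - c = avgOutside μ (s m) (fun x => f x - c) x := by
        have hm : Measurable fun y : ι → E => (s m).piecewise x y :=
          (measurable_piecewise_prod (s m)).comp (measurable_const.prodMk measurable_id)
        unfold avgOutside
        rw [integral_sub ((hf.comp hm).integrable _) (integrable_const _)]
        simp
      rw [hsubc, ← pow_mul]
      simp only [hF, ← pow_mul]
      exact norm_avgOutside_pow_le μ (hf.sub (BddMeas.const c)) (2 * q) x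
    have h4 : ∫ x, (‖avgOutside μ (s m) f x - c‖ ^ 2) ^ q * Z k x ∂(Measure.pi μ)
        ≤ ∫ x, F x ^ q * avgOutside μ (s m) (Zn m) x ∂(Measure.pi μ) := by
      rw [← integral_avgOutside_mul_comm μ (hFb.pow q) (hZn m)]
      refine integral_mono ((hSb.mul (hZ k)).integrable _)
        ((((hFb.pow q).avgOutside μ).mul (hZn m)).integrable _) fun x => ?_
      simp only [hZk]
      exact mul_le_mul_of_nonneg_right (hjen x) (hZ0 k x)
    have h5 : ∫ x, Z k x ^ (q + 1) ∂(Measure.pi μ) ≤ ∫ x, B ^ q * Zn m x ∂(Measure.pi μ) := by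
      refine integral_mono (((hZ k).pow _).integrable _) (((hZn m).integrable _).const_mul _)
        fun x => ?_
      simp only [hZk, pow_succ]
      have : Z k x ≤ B :=
        (Finset.single_le_sum (f := fun k => Z k x) (fun k _ => hZ0 k x)
          (Finset.mem_univ k)).trans (hB x)
      exact mul_le_mul_of_nonneg_right (pow_le_pow_left₀ (hZ0 k x) this q) (hZ0 k x)
    have h6 := mul_le_mul_of_nonneg_left (add_le_add (h3.trans h4) ((hp k).trans h5)) hD0.le
    linarith
  have htel := Finset.sum_le_sum hstep
  rw [Finset.sum_range_sub (fun m => ∫ x, (‖avgOutside μ (s m) f x - c‖ ^ 2) ^ (q + 1)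
    ∂(Measure.pi μ)) K] at htel
  have hs0 : s 0 = ∅ := by simp [s]
  have hsK : s K = Finset.univ := by
    ext l; simp [s]
  simp only [hs0, hsK, avgOutside_empty, avgOutside_univ] at htel
  simp only [← hc, sub_self, norm_zero, ne_eq, OfNat.ofNat_ne_zero, not_false_eq_true, zero_pow,
    Nat.add_eq_zero_iff, one_ne_zero, and_false, integral_zero, sub_zero] at htel
  set A : (ι → E) → ℝ := fun x => ∑ m ∈ Finset.range K, avgOutside μ (s m) (Zn m) x with hA
  have hAb : BddMeas A := BddMeas.sum _ fun m => (hZn m).avgOutside μ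
  have hA0 : ∀ x, 0 ≤ A x := fun x =>
    Finset.sum_nonneg fun m _ => integral_nonneg fun y => hZn0 m _
  have hsum : ∑ m ∈ Finset.range K, D * (∫ x, F x ^ q * avgOutside μ (s m) (Zn m) x ∂(Measure.pi μ)
      + ∫ x, B ^ q * Zn m x ∂(Measure.pi μ))
      ≤ D * (∫ x, F x ^ q * A x ∂(Measure.pi μ) + B ^ (q + 1)) := by
    rw [← Finset.mul_sum, Finset.sum_add_distrib, ← integral_finsetSum _
      fun m _ => ((hFb.pow q).mul ((hZn m).avgOutside μ)).integrable _,
      ← integral_finsetSum _ fun m _ => ((hZn m).integrable _).const_mul _]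
    simp only [← Finset.mul_sum]
    gcongr
    calc ∫ x, B ^ q * ∑ m ∈ Finset.range K, Zn m x ∂(Measure.pi μ)
        ≤ ∫ _, B ^ q * B ∂(Measure.pi μ) := by
          refine integral_mono (((BddMeas.sum _ hZn).integrable _).const_mul _)
            (integrable_const _) fun x => ?_
          exact mul_le_mul_of_nonneg_left (hZnsum x) (by positivity)
      _ = B ^ (q + 1) := by simp [pow_succ]
  have hApow := integral_sum_avgOutside_pow_le μ hs hZn hZn0 hZnsum (q + 1)
  have hyoung : ∫ x, F x ^ q * A x ∂(Measure.pi μ)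
      ≤ 1 / (2 * D) * ∫ x, F x ^ (q + 1) ∂(Measure.pi μ)
        + (2 * D) ^ q * ∫ x, A x ^ (q + 1) ∂(Measure.pi μ) := by
    rw [← integral_const_mul, ← integral_const_mul,
      ← integral_add (((hFb.pow _).integrable _).const_mul _)
        (((hAb.pow _).integrable _).const_mul _)]
    refine integral_mono (((hFb.pow q).mul hAb).integrable _)
      ((((hFb.pow _).integrable _).const_mul _).add (((hAb.pow _).integrable _).const_mul _))
      fun x => ?_
    have := pow_mul_le_add (η := 1 / (2 * D)) (by positivity) (hF0 x) (hA0 x) q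
    simpa using this
  have hfin := htel.trans hsum
  set T := ∫ x, F x ^ (q + 1) ∂(Measure.pi μ) with hT
  have h7 : T ≤ D * (1 / (2 * D) * T + (2 * D) ^ q * ((q + 1).factorial * B ^ (q + 1))
      + B ^ (q + 1)) := by
    refine hfin.trans ?_
    gcongr
    refine hyoung.trans ?_
    gcongr
  have h8 : D * (1 / (2 * D) * T) = T / 2 := by field_simp
  have h9 : momentConst q * B ^ (q + 1)
      = 2 * (D * ((2 * D) ^ q * ((q + 1).factorial * B ^ (q + 1)) + B ^ (q + 1))) := by
    unfold momentConst; rw [← hD]; ring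
  rw [h9]
  nlinarith [h7, h8]

end MomentInequality

section RankTwo

variable {I : Type*} [Fintype I] [DecidableEq I]

/-- The skew-Hermitian matrix of rank at most two with entries `ζ` at `(a, b)` and `-ζ̄` at
`(b, a)`. -/
def rankTwo (a b : I) (ζ : ℂ) : Matrix I I ℂ := Matrix.single a b ζ - Matrix.single b a (star ζ)

lemma dotProduct_mul_rankTwo_mul (a b : I) (ζ : ℂ) (X Y : Matrix I I ℂ) (u v : I → ℂ) :
    u ⬝ᵥ ((X * rankTwo a b ζ * Y) *ᵥ v)
      = ζ * ((u ᵥ* X) a * (Y *ᵥ v) b) - star ζ * ((u ᵥ* X) b * (Y *ᵥ v) a) := by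
  rw [← Matrix.mulVec_mulVec, ← Matrix.mulVec_mulVec, Matrix.dotProduct_mulVec u X, rankTwo,
    Matrix.sub_mulVec, dotProduct_sub, Matrix.single_mulVec, Matrix.single_mulVec]
  have : ∀ (c : I) (w : ℂ), Function.update (0 : I → ℂ) c w = Pi.single c w := fun c w => rfl
  simp only [this, dotProduct_single]
  ring

lemma mul_rankTwo_mul_mulVec (a b c : I) (ζ : ℂ) (X Y : Matrix I I ℂ) (v : I → ℂ) :
    ((X * rankTwo a b ζ * Y) *ᵥ v) c
      = ζ * (X c a * (Y *ᵥ v) b) - star ζ * (X c b * (Y *ᵥ v) a) := by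
  have := dotProduct_mul_rankTwo_mul a b ζ X Y (Pi.single c 1) v
  rw [single_one_dotProduct, Matrix.single_one_vecMul] at this
  exact this

lemma vecMul_mul_rankTwo_mul (a b c : I) (ζ : ℂ) (X Y : Matrix I I ℂ) (u : I → ℂ) :
    (u ᵥ* (X * rankTwo a b ζ * Y)) c
      = ζ * ((u ᵥ* X) a * Y b c) - star ζ * ((u ᵥ* X) b * Y a c) := by
  have := dotProduct_mul_rankTwo_mul a b ζ X Y u (Pi.single c 1)
  rw [Matrix.dotProduct_mulVec, dotProduct_single_one, Matrix.mulVec_single_one] at this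
  exact this

variable {a b : I} {ζ : ℂ} {X X' : Matrix I I ℂ} {L : ℝ}

lemma norm_mul_sub_star_mul_le (ζ x y : ℂ) : ‖ζ * x - star ζ * y‖ ≤ ‖ζ‖ * (‖x‖ + ‖y‖) := by
  refine (norm_sub_le _ _).trans_eq ?_
  rw [norm_mul, norm_mul, norm_star]; ring

lemma norm_mul_rankTwo_mul_mulVec_le (hL : ∀ i j, ‖X i j‖ ≤ L) (c : I) (Y : Matrix I I ℂ)
    (v : I → ℂ) : ‖((X * rankTwo a b ζ * Y) *ᵥ v) c‖
      ≤ L * ‖ζ‖ * (‖(Y *ᵥ v) a‖ + ‖(Y *ᵥ v) b‖) := by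
  rw [mul_rankTwo_mul_mulVec]
  refine (norm_mul_sub_star_mul_le _ _ _).trans ?_
  rw [norm_mul, norm_mul]
  have h1 := mul_le_mul_of_nonneg_right (hL c a) (norm_nonneg ((Y *ᵥ v) b))
  have h2 := mul_le_mul_of_nonneg_right (hL c b) (norm_nonneg ((Y *ᵥ v) a))
  calc _ ≤ ‖ζ‖ * (L * ‖(Y *ᵥ v) b‖ + L * ‖(Y *ᵥ v) a‖) := by gcongr
    _ = _ := by ring

lemma norm_vecMul_mul_rankTwo_mul_le (hL : ∀ i j, ‖X i j‖ ≤ L) (c : I) (Y : Matrix I I ℂ)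
    (u : I → ℂ) : ‖(u ᵥ* (Y * rankTwo a b ζ * X)) c‖
      ≤ L * ‖ζ‖ * (‖(u ᵥ* Y) a‖ + ‖(u ᵥ* Y) b‖) := by
  rw [vecMul_mul_rankTwo_mul]
  refine (norm_mul_sub_star_mul_le _ _ _).trans ?_
  rw [norm_mul, norm_mul]
  have h1 := mul_le_mul_of_nonneg_left (hL b c) (norm_nonneg ((u ᵥ* Y) a))
  have h2 := mul_le_mul_of_nonneg_left (hL a c) (norm_nonneg ((u ᵥ* Y) b))
  calc _ ≤ ‖ζ‖ * (‖(u ᵥ* Y) a‖ * L + ‖(u ᵥ* Y) b‖ * L) := by gcongr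
    _ = _ := by ring

/-- The cross terms `|b_a q_b| + |b_b q_a|` for `b = u X` and `q = X v`. -/
def crossTerm (a b : I) (X : Matrix I I ℂ) (u v : I → ℂ) : ℝ :=
  ‖(u ᵥ* X) a‖ * ‖(X *ᵥ v) b‖ + ‖(u ᵥ* X) b‖ * ‖(X *ᵥ v) a‖

/-- The product `(|b_a| + |b_b|) (|q_a| + |q_b|)` for `b = u X` and `q = X v`. -/
def fullTerm (a b : I) (X : Matrix I I ℂ) (u v : I → ℂ) : ℝ :=
  (‖(u ᵥ* X) a‖ + ‖(u ᵥ* X) b‖) * (‖(X *ᵥ v) a‖ + ‖(X *ᵥ v) b‖)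

lemma crossTerm_nonneg (a b : I) (X : Matrix I I ℂ) (u v : I → ℂ) : 0 ≤ crossTerm a b X u v := by
  unfold crossTerm; positivity

lemma fullTerm_nonneg (a b : I) (X : Matrix I I ℂ) (u v : I → ℂ) : 0 ≤ fullTerm a b X u v := by
  unfold fullTerm; positivity

lemma second_order_expansion (h : X - X' = -(X' * rankTwo a b ζ * X))
    (h' : X - X' = -(X * rankTwo a b ζ * X')) :
    X - X' = -(X' * rankTwo a b ζ * X') + X' * rankTwo a b ζ * (X * rankTwo a b ζ * X') := by
  have hX : X = X' - X * rankTwo a b ζ * X' := by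
    calc X = X' + (X - X') := by abel
      _ = _ := by rw [h', sub_eq_add_neg]
  rw [h]
  conv_lhs => rw [hX]
  rw [Matrix.mul_sub]
  abel

lemma norm_form_sub_le (hL : ∀ i j, ‖X i j‖ ≤ L) (h : X - X' = -(X' * rankTwo a b ζ * X))
    (h' : X - X' = -(X * rankTwo a b ζ * X')) (u v : I → ℂ) :
    ‖u ⬝ᵥ (X *ᵥ v) - u ⬝ᵥ (X' *ᵥ v)‖
      ≤ ‖ζ‖ * crossTerm a b X' u v + L * ‖ζ‖ ^ 2 * fullTerm a b X' u v := by
  rw [← dotProduct_sub, ← Matrix.sub_mulVec, second_order_expansion h h', Matrix.add_mulVec,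
    dotProduct_add, Matrix.neg_mulVec, dotProduct_neg, dotProduct_mul_rankTwo_mul,
    dotProduct_mul_rankTwo_mul]
  refine (norm_add_le _ _).trans (add_le_add ?_ ?_)
  · rw [norm_neg]
    refine (norm_mul_sub_star_mul_le _ _ _).trans_eq ?_
    rw [norm_mul, norm_mul]; rfl
  · refine (norm_mul_sub_star_mul_le _ _ _).trans ?_
    rw [norm_mul, norm_mul]
    have h1 := norm_mul_rankTwo_mul_mulVec_le (a := a) (b := b) (ζ := ζ) hL a X' v
    have h2 := norm_mul_rankTwo_mul_mulVec_le (a := a) (b := b) (ζ := ζ) hL b X' v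
    calc _ ≤ ‖ζ‖ * (‖(u ᵥ* X') a‖ * (L * ‖ζ‖ * (‖(X' *ᵥ v) a‖ + ‖(X' *ᵥ v) b‖))
          + ‖(u ᵥ* X') b‖ * (L * ‖ζ‖ * (‖(X' *ᵥ v) a‖ + ‖(X' *ᵥ v) b‖))) := by gcongr
      _ = _ := by unfold fullTerm; ring

lemma norm_mulVec_le_of_perturb (hL : ∀ i j, ‖X' i j‖ ≤ L)
    (h : X - X' = -(X' * rankTwo a b ζ * X)) (v : I → ℂ) (c : I) :
    ‖(X' *ᵥ v) c‖ ≤ ‖(X *ᵥ v) c‖ + L * ‖ζ‖ * (‖(X *ᵥ v) a‖ + ‖(X *ᵥ v) b‖) := by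
  have hX : X' = X + X' * rankTwo a b ζ * X := by
    rw [← neg_eq_iff_eq_neg.2 h]; abel
  conv_lhs => rw [hX]
  rw [Matrix.add_mulVec, Pi.add_apply]
  exact (norm_add_le _ _).trans (add_le_add le_rfl (norm_mul_rankTwo_mul_mulVec_le hL c X v))

lemma norm_vecMul_le_of_perturb (hL : ∀ i j, ‖X' i j‖ ≤ L)
    (h : X - X' = -(X * rankTwo a b ζ * X')) (u : I → ℂ) (c : I) :
    ‖(u ᵥ* X') c‖ ≤ ‖(u ᵥ* X) c‖ + L * ‖ζ‖ * (‖(u ᵥ* X) a‖ + ‖(u ᵥ* X) b‖) := by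
  have hX : X' = X + X * rankTwo a b ζ * X' := by
    rw [← neg_eq_iff_eq_neg.2 h]; abel
  conv_lhs => rw [hX]
  rw [Matrix.vecMul_add, Pi.add_apply]
  exact (norm_add_le _ _).trans (add_le_add le_rfl (norm_vecMul_mul_rankTwo_mul_le hL c X u))

lemma crossTerm_le_of_perturb (hL0 : 0 ≤ L) (hL : ∀ i j, ‖X' i j‖ ≤ L)
    (h : X - X' = -(X' * rankTwo a b ζ * X)) (h' : X - X' = -(X * rankTwo a b ζ * X'))
    (u v : I → ℂ) :
    crossTerm a b X' u v ≤ crossTerm a b X u v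
      + (4 * (L * ‖ζ‖) + 2 * (L * ‖ζ‖) ^ 2) * fullTerm a b X u v := by
  have q1 := norm_mulVec_le_of_perturb hL h v a
  have q2 := norm_mulVec_le_of_perturb hL h v b
  have b1 := norm_vecMul_le_of_perturb hL h' u a
  have b2 := norm_vecMul_le_of_perturb hL h' u b
  unfold crossTerm fullTerm
  have ht : 0 ≤ L * ‖ζ‖ := by positivity
  set t := L * ‖ζ‖
  set ba := ‖(u ᵥ* X) a‖
  set bb := ‖(u ᵥ* X) b‖
  set qa := ‖(X *ᵥ v) a‖
  set qb := ‖(X *ᵥ v) b‖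
  have hba : 0 ≤ ba := norm_nonneg _
  have hbb : 0 ≤ bb := norm_nonneg _
  have hqa : 0 ≤ qa := norm_nonneg _
  have hqb : 0 ≤ qb := norm_nonneg _
  have m1 := mul_le_mul b1 q2 (norm_nonneg _) (by positivity)
  have m2 := mul_le_mul b2 q1 (norm_nonneg _) (by positivity)
  refine (add_le_add m1 m2).trans ?_
  have e1 : ba * (qa + qb) ≤ (ba + bb) * (qa + qb) := by gcongr; linarith
  have e2 : bb * (qa + qb) ≤ (ba + bb) * (qa + qb) := by gcongr; linarith
  have e3 : (ba + bb) * qa ≤ (ba + bb) * (qa + qb) := by gcongr; linarith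
  have e4 : (ba + bb) * qb ≤ (ba + bb) * (qa + qb) := by gcongr; linarith
  nlinarith [mul_le_mul_of_nonneg_left e1 ht, mul_le_mul_of_nonneg_left e2 ht,
    mul_le_mul_of_nonneg_left e3 ht, mul_le_mul_of_nonneg_left e4 ht]

lemma fullTerm_le_of_perturb (hL0 : 0 ≤ L) (hL : ∀ i j, ‖X' i j‖ ≤ L)
    (h : X - X' = -(X' * rankTwo a b ζ * X)) (h' : X - X' = -(X * rankTwo a b ζ * X'))
    (u v : I → ℂ) :
    fullTerm a b X' u v ≤ (1 + 2 * (L * ‖ζ‖)) ^ 2 * fullTerm a b X u v := by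
  have q1 := norm_mulVec_le_of_perturb hL h v a
  have q2 := norm_mulVec_le_of_perturb hL h v b
  have b1 := norm_vecMul_le_of_perturb hL h' u a
  have b2 := norm_vecMul_le_of_perturb hL h' u b
  unfold fullTerm
  have m := mul_le_mul (add_le_add b1 b2) (add_le_add q1 q2) (by positivity) (by positivity)
  refine m.trans (le_of_eq ?_)
  ring

end RankTwo

section Decoupling

open MeasureTheory

/-- A centred, normalized law on `ℂ` with moment of order `8 * p` at most `Mo`. -/
structure EntryLaw (p : ℕ) (Mo : ℝ) (μ : Measure ℂ) : Prop where
  mean_zero : ∫ e, e ∂μ = 0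
  variance_one : ∫ e, ‖e‖ ^ 2 ∂μ = 1
  integrable_moment : Integrable (fun e : ℂ => ‖e‖ ^ (8 * p)) μ
  moment_le : ∫ e, ‖e‖ ^ (8 * p) ∂μ ≤ Mo

lemma pow_le_one_add_pow {t : ℝ} (ht : 0 ≤ t) {j k : ℕ} (h : j ≤ k) : t ^ j ≤ 1 + t ^ k := by
  rcases le_total t 1 with h1 | h1
  · exact (pow_le_one₀ ht h1).trans (by linarith [pow_nonneg ht k])
  · exact (pow_le_pow_right₀ h1 h).trans (by linarith)

lemma sq_add_pow_four_pow_le {t : ℝ} (ht : 0 ≤ t) {j p : ℕ} (h : j ≤ p) :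
    (t ^ 2 + t ^ 4) ^ j ≤ 2 ^ j * (1 + t ^ (8 * p)) := by
  rcases le_total t 1 with h1 | h1
  · have h2 : t ^ 2 + t ^ 4 ≤ 2 := by
      linarith [pow_le_one₀ ht h1 (n := 2), pow_le_one₀ ht h1 (n := 4)]
    calc _ ≤ (2 : ℝ) ^ j := by gcongr
      _ ≤ _ := le_mul_of_one_le_right (by positivity) (by linarith [pow_nonneg ht (8 * p)])
  · have h2 : t ^ 2 + t ^ 4 ≤ 2 * t ^ 4 := by
      linarith [pow_le_pow_right₀ h1 (by norm_num : 2 ≤ 4)]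
    calc _ ≤ (2 * t ^ 4) ^ j := by gcongr
      _ = 2 ^ j * t ^ (4 * j) := by rw [mul_pow, pow_mul]
      _ ≤ 2 ^ j * (1 + t ^ (8 * p)) := by
        gcongr
        exact pow_le_one_add_pow ht (by omega)

section EntryLaw

variable {p : ℕ} {Mo : ℝ} {μ : Measure ℂ} [IsProbabilityMeasure μ]

lemma EntryLaw.nonneg (h : EntryLaw p Mo μ) : 0 ≤ Mo :=
  (integral_nonneg fun _ => by positivity).trans h.moment_le

lemma EntryLaw.integrable_pow (h : EntryLaw p Mo μ) {j : ℕ} (hj : j ≤ 8 * p) :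
    Integrable (fun e : ℂ => ‖e‖ ^ j) μ := by
  refine ((integrable_const (1 : ℝ)).add h.integrable_moment).mono'
    (by fun_prop) (Filter.Eventually.of_forall fun e => ?_)
  rw [Real.norm_of_nonneg (by positivity)]
  exact pow_le_one_add_pow (norm_nonneg e) hj

lemma EntryLaw.integral_pow_le (h : EntryLaw p Mo μ) {j : ℕ} (hj : j ≤ 8 * p) :
    ∫ e : ℂ, ‖e‖ ^ j ∂μ ≤ 1 + Mo := by
  calc ∫ e : ℂ, ‖e‖ ^ j ∂μ ≤ ∫ e : ℂ, (1 + ‖e‖ ^ (8 * p)) ∂μ :=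
        integral_mono (h.integrable_pow hj) ((integrable_const (1 : ℝ)).add h.integrable_moment)
          fun e => pow_le_one_add_pow (norm_nonneg e) hj
    _ ≤ 1 + Mo := by
        rw [integral_add (integrable_const _) h.integrable_moment]
        simpa using h.moment_le

lemma EntryLaw.integrable_sq_add_pow_four_pow (h : EntryLaw p Mo μ) {j : ℕ} (hj : j ≤ p) :
    Integrable (fun e : ℂ => (‖e‖ ^ 2 + ‖e‖ ^ 4) ^ j) μ := by
  refine (((integrable_const (1 : ℝ)).add h.integrable_moment).const_mul (2 ^ j)).mono'
    (by fun_prop) (Filter.Eventually.of_forall fun e => ?_)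
  rw [Real.norm_of_nonneg (by positivity)]
  exact sq_add_pow_four_pow_le (norm_nonneg e) hj

lemma EntryLaw.integral_sq_add_pow_four_pow_le (h : EntryLaw p Mo μ) {j : ℕ} (hj : j ≤ p) :
    ∫ e : ℂ, (‖e‖ ^ 2 + ‖e‖ ^ 4) ^ j ∂μ ≤ 2 ^ j * (1 + Mo) := by
  calc ∫ e : ℂ, (‖e‖ ^ 2 + ‖e‖ ^ 4) ^ j ∂μ ≤ ∫ e : ℂ, 2 ^ j * (1 + ‖e‖ ^ (8 * p)) ∂μ :=
        integral_mono (h.integrable_sq_add_pow_four_pow hj)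
          (((integrable_const (1 : ℝ)).add h.integrable_moment).const_mul (2 ^ j))
          fun e => sq_add_pow_four_pow_le (norm_nonneg e) hj
    _ ≤ 2 ^ j * (1 + Mo) := by
        rw [integral_const_mul, integral_add (integrable_const _) h.integrable_moment]
        gcongr
        · simp
        · exact h.moment_le

lemma EntryLaw.half_le_integral_indicator (h : EntryLaw p Mo μ) (hp : 1 ≤ p) :
    (1 / 2 : ℝ) ≤ ∫ e : ℂ, (if ‖e‖ ^ 2 ≤ 2 then 1 else 0 : ℝ) ∂μ := by
  have hm : Measurable fun e : ℂ => (if ‖e‖ ^ 2 ≤ 2 then 1 else 0 : ℝ) :=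
    Measurable.ite (measurableSet_le (by fun_prop) measurable_const) measurable_const
      measurable_const
  have hi : Integrable (fun e : ℂ => (if ‖e‖ ^ 2 ≤ 2 then 1 else 0 : ℝ)) μ :=
    Integrable.of_bound hm.aestronglyMeasurable 1
      (Filter.Eventually.of_forall fun e => by split_ifs <;> simp)
  have hi2 := h.integrable_pow (j := 2) (by omega)
  have h1 : ∫ _ : ℂ, (1 : ℝ) ∂μ
      ≤ ∫ e : ℂ, ((if ‖e‖ ^ 2 ≤ 2 then 1 else 0 : ℝ) + 1 / 2 * ‖e‖ ^ 2) ∂μ := by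
    refine integral_mono (integrable_const _) (hi.add (hi2.const_mul _)) fun e => ?_
    simp only
    split_ifs with he
    · have : 0 ≤ ‖e‖ ^ 2 := by positivity
      linarith
    · push Not at he; linarith
  rw [integral_add hi (hi2.const_mul _), integral_const_mul, h.variance_one] at h1
  simp at h1
  linarith

end EntryLaw

variable {ι : Type*} [Fintype ι] [DecidableEq ι]
  (μ : ι → Measure ℂ) [∀ i, IsProbabilityMeasure (μ i)]

/-- If `Φ₀` does not depend on `x k` and is dominated by `Φ` as long as `x k` is not large, then
the integral of `ψ (x k) * Φ₀ x` is dominated by the integral of `Φ`. -/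
lemma integral_coord_mul_le_of_decoupling {p : ℕ} {Mo : ℝ} {k : ι} (hμ : EntryLaw p Mo (μ k))
    (hp : 1 ≤ p) {ψ : ℂ → ℝ} (hψm : Measurable ψ) {C₁ C₂ : ℝ} (hC₁0 : 0 ≤ C₁)
    (hC₁ : ∫ e, ψ e ∂(μ k) ≤ C₁) {Φ₀ Φ : (ι → ℂ) → ℝ} (hΦ₀ : BddMeas Φ₀) (hΦ : BddMeas Φ)
    (hΦ₀0 : ∀ x, 0 ≤ Φ₀ x) (hΦ0 : ∀ x, 0 ≤ Φ x) (hC₂0 : 0 ≤ C₂) (hΦ₀k : IndepOfCoord k Φ₀)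
    (hle : ∀ x, ‖x k‖ ^ 2 ≤ 2 → Φ₀ x ≤ C₂ * Φ x) :
    ∫ x, ψ (x k) * Φ₀ x ∂(Measure.pi μ) ≤ 2 * C₁ * C₂ * ∫ x, Φ x ∂(Measure.pi μ) := by
  have hm : Measurable fun e : ℂ => (if ‖e‖ ^ 2 ≤ 2 then 1 else 0 : ℝ) :=
    Measurable.ite (measurableSet_le (by fun_prop) measurable_const) measurable_const
      measurable_const
  have h0 : 0 ≤ ∫ x, Φ₀ x ∂(Measure.pi μ) := integral_nonneg hΦ₀0
  have h1 : ∫ x, ψ (x k) * Φ₀ x ∂(Measure.pi μ) ≤ C₁ * ∫ x, Φ₀ x ∂(Measure.pi μ) := by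
    rw [integral_coord_mul μ hψm hΦ₀.meas hΦ₀k]
    exact mul_le_mul_of_nonneg_right hC₁ h0
  have h2 : 1 / 2 * ∫ x, Φ₀ x ∂(Measure.pi μ) ≤ C₂ * ∫ x, Φ x ∂(Measure.pi μ) := by
    calc 1 / 2 * ∫ x, Φ₀ x ∂(Measure.pi μ)
        ≤ (∫ e : ℂ, (if ‖e‖ ^ 2 ≤ 2 then 1 else 0 : ℝ) ∂(μ k)) * ∫ x, Φ₀ x ∂(Measure.pi μ) :=
          mul_le_mul_of_nonneg_right (hμ.half_le_integral_indicator hp) h0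
      _ = ∫ x, (if ‖x k‖ ^ 2 ≤ 2 then 1 else 0 : ℝ) * Φ₀ x ∂(Measure.pi μ) :=
          (integral_coord_mul μ hm hΦ₀.meas hΦ₀k).symm
      _ ≤ ∫ x, C₂ * Φ x ∂(Measure.pi μ) := by
          have hb : BddMeas fun x : ι → ℂ => (if ‖x k‖ ^ 2 ≤ 2 then 1 else 0 : ℝ) :=
            ⟨hm.comp (measurable_pi_apply k), 1, fun x => by split_ifs <;> simp⟩
          refine integral_mono ((hb.mul hΦ₀).integrable _) ((hΦ.integrable _).const_mul _)
            fun x => ?_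
          simp only
          split_ifs with hx
          · rw [one_mul]; exact hle x hx
          · rw [zero_mul]; exact mul_nonneg hC₂0 (hΦ0 x)
      _ = _ := integral_const_mul _ _
  have h3 := mul_le_mul_of_nonneg_left h2 hC₁0
  linarith

/-- A weighted version of `integral_coord_mul_le_of_decoupling`. -/
lemma integral_mul_le_of_decoupling {p : ℕ} {Mo : ℝ} {k : ι} (hμ : EntryLaw p Mo (μ k))
    (hp : 1 ≤ p) {ψ : ℂ → ℝ} (hψm : Measurable ψ) (hψi : Integrable ψ (μ k))
    {C₁ C₂ : ℝ} (hC₁0 : 0 ≤ C₁) (hC₁ : ∫ e, ψ e ∂(μ k) ≤ C₁)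
    {g H Φ₀ Φ : (ι → ℂ) → ℝ} (hg : BddMeas g) (hH : BddMeas H) (hΦ₀ : BddMeas Φ₀)
    (hΦ : BddMeas Φ) (hg0 : ∀ x, 0 ≤ g x) (hΦ₀0 : ∀ x, 0 ≤ Φ₀ x) (hΦ0 : ∀ x, 0 ≤ Φ x)
    (hC₂0 : 0 ≤ C₂) (hgk : IndepOfCoord k g) (hΦ₀k : IndepOfCoord k Φ₀)
    (hHle : ∀ x, H x ≤ ψ (x k) * Φ₀ x) (hle : ∀ x, ‖x k‖ ^ 2 ≤ 2 → Φ₀ x ≤ C₂ * Φ x) :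
    ∫ x, g x * H x ∂(Measure.pi μ) ≤ 2 * C₁ * C₂ * ∫ x, g x * Φ x ∂(Measure.pi μ) := by
  refine le_trans ?_ (integral_coord_mul_le_of_decoupling μ hμ hp hψm hC₁0 hC₁ (hg.mul hΦ₀)
    (hg.mul hΦ) (fun x => mul_nonneg (hg0 x) (hΦ₀0 x)) (fun x => mul_nonneg (hg0 x) (hΦ0 x)) hC₂0
    (fun x e => by simp only [hgk x e, hΦ₀k x e])
    fun x hx => (mul_le_mul_of_nonneg_left (hle x hx) (hg0 x)).trans_eq (by ring))
  refine integral_mono ((hg.mul hH).integrable _) (integrable_coord_mul μ hψi (hg.mul hΦ₀))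
    fun x => ?_
  exact (mul_le_mul_of_nonneg_left (hHle x) (hg0 x)).trans_eq (by ring)

end Decoupling

section Model

variable {m n : Type*} [Fintype m] [DecidableEq m] [Fintype n] [DecidableEq n]

/-- The skew-Hermitian block matrix with off-diagonal blocks `B` and `-Bᴴ`. -/
def skewBlock (B : Matrix m n ℂ) : Matrix (m ⊕ n) (m ⊕ n) ℂ := Matrix.fromBlocks 0 B (-Bᴴ) 0

lemma skewBlock_conjTranspose (B : Matrix m n ℂ) : (skewBlock B)ᴴ = -skewBlock B := by
  simp [skewBlock, Matrix.fromBlocks_conjTranspose, Matrix.fromBlocks_neg]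

lemma skewBlock_add (B B' : Matrix m n ℂ) :
    skewBlock (B + B') = skewBlock B + skewBlock B' := by
  simp [skewBlock, Matrix.fromBlocks_add, Matrix.conjTranspose_add, add_comm]

lemma skewBlock_single (i : m) (j : n) (ζ : ℂ) :
    skewBlock (Matrix.single i j ζ) = rankTwo (Sum.inl i) (Sum.inr j) ζ := by
  ext a b
  rcases a with a | a <;> rcases b with b | b <;>
    simp [skewBlock, rankTwo, Matrix.single_apply]

/-- The matrix with entries `c (i, j) * x (i, j)`. -/
def weighted (c : m × n → ℝ) (x : m × n → ℂ) : Matrix m n ℂ :=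
  Matrix.of fun i j => (c (i, j) : ℂ) * x (i, j)

/-- The linearization `s + skewBlock (A + weighted c x)`. -/
def linMat (c : m × n → ℝ) (A : Matrix m n ℂ) (s : ℂ) (x : m × n → ℂ) :
    Matrix (m ⊕ n) (m ⊕ n) ℂ :=
  Matrix.diagonal (fun _ => s) + skewBlock (A + weighted c x)

/-- The inverse of the linearization. -/
def linRes (c : m × n → ℝ) (A : Matrix m n ℂ) (s : ℂ) (x : m × n → ℂ) :
    Matrix (m ⊕ n) (m ⊕ n) ℂ := (linMat c A s x)⁻¹

variable (c : m × n → ℝ) (A : Matrix m n ℂ) {s : ℂ}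

lemma linMat_accretive (x : m × n → ℂ) : Accretive s.re (linMat c A s x) :=
  accretive_diagonal_add (skewBlock_conjTranspose _) fun _ => le_rfl

lemma linMat_sub_update (s : ℂ) (x : m × n → ℂ) (k : m × n) :
    linMat c A s x - linMat c A s (Function.update x k 0)
      = rankTwo (Sum.inl k.1) (Sum.inr k.2) (c k * x k) := by
  have h : weighted c x = weighted c (Function.update x k 0)
      + Matrix.single k.1 k.2 ((c k : ℂ) * x k) := by
    ext i j
    by_cases hij : (i, j) = k
    · subst hij; simp [weighted]
    · have : ¬ (k.1 = i ∧ k.2 = j) := fun h => hij (Prod.ext h.1.symm h.2.symm)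
      simp [weighted, hij, this]
  rw [linMat, linMat, h, ← add_assoc, skewBlock_add _ (Matrix.single _ _ _), skewBlock_single]
  abel

lemma linRes_sub_left (hs : 0 < s.re) (x : m × n → ℂ) (k : m × n) :
    linRes c A s x - linRes c A s (Function.update x k 0)
      = -(linRes c A s x * rankTwo (Sum.inl k.1) (Sum.inr k.2) (c k * x k)
          * linRes c A s (Function.update x k 0)) := by
  rw [linRes, linRes, inv_sub_inv_of_isUnit ((linMat_accretive c A x).isUnit hs)
    ((linMat_accretive c A _).isUnit hs), ← neg_sub, linMat_sub_update, Matrix.mul_neg,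
    Matrix.neg_mul]

lemma linRes_sub_right (hs : 0 < s.re) (x : m × n → ℂ) (k : m × n) :
    linRes c A s x - linRes c A s (Function.update x k 0)
      = -(linRes c A s (Function.update x k 0) * rankTwo (Sum.inl k.1) (Sum.inr k.2) (c k * x k)
          * linRes c A s x) := by
  rw [← neg_sub, linRes, linRes, inv_sub_inv_of_isUnit ((linMat_accretive c A _).isUnit hs)
    ((linMat_accretive c A _).isUnit hs), linMat_sub_update]

lemma norm_linRes_apply_le (hs : 0 < s.re) (x : m × n → ℂ) (i j : m ⊕ n) :
    ‖linRes c A s x i j‖ ≤ 1 / s.re :=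
  (linMat_accretive c A x).norm_inv_apply_le hs i j

lemma measurable_inv_apply {α I : Type*} [MeasurableSpace α] [Fintype I] [DecidableEq I]
    {M : α → Matrix I I ℂ} (hM : ∀ i j, Measurable fun x => M x i j) (i j : I) :
    Measurable fun x => (M x)⁻¹ i j := by
  have hdet : ∀ {M : α → Matrix I I ℂ}, (∀ i j, Measurable fun x => M x i j) →
      Measurable fun x => (M x).det := by
    intro M hM
    simp only [Matrix.det_apply]
    refine Finset.measurable_sum _ fun τ _ => ?_
    exact (Finset.measurable_prod _ fun a _ => hM _ _).const_smul _
  simp only [Matrix.inv_def, Matrix.smul_apply, Ring.inverse_eq_inv', Matrix.adjugate_apply,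
    smul_eq_mul]
  refine (hdet hM).inv.mul (hdet fun a b => ?_)
  by_cases ha : a = j
  · simp only [ha, Matrix.updateRow_self]; exact measurable_const
  · simp only [Matrix.updateRow_ne ha]; exact hM a b

lemma bddMeas_linRes_apply (hs : 0 < s.re) (i j : m ⊕ n) :
    BddMeas fun x => linRes c A s x i j := by
  refine ⟨measurable_inv_apply (fun a b => ?_) i j, 1 / s.re,
    fun x => norm_linRes_apply_le c A hs x i j⟩
  rcases a with a | a <;> rcases b with b | b <;>
    simp only [linMat, skewBlock, weighted, Matrix.add_apply, Matrix.fromBlocks_apply₁₁,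
      Matrix.fromBlocks_apply₁₂, Matrix.fromBlocks_apply₂₁, Matrix.fromBlocks_apply₂₂,
      Matrix.neg_apply, Matrix.conjTranspose_apply, Matrix.of_apply, RCLike.star_def] <;>
    fun_prop

lemma bddMeas_linRes_mulVec (hs : 0 < s.re) (v : m ⊕ n → ℂ) (i : m ⊕ n) :
    BddMeas fun x => (linRes c A s x *ᵥ v) i := by
  simp only [Matrix.mulVec, dotProduct]
  exact BddMeas.sum _ fun j => (bddMeas_linRes_apply c A hs i j).mul (BddMeas.const _)

lemma bddMeas_vecMul_linRes (hs : 0 < s.re) (u : m ⊕ n → ℂ) (i : m ⊕ n) :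
    BddMeas fun x => (u ᵥ* linRes c A s x) i := by
  simp only [Matrix.vecMul, dotProduct]
  exact BddMeas.sum _ fun j => (BddMeas.const _).mul (bddMeas_linRes_apply c A hs j i)

lemma bddMeas_linRes_form (hs : 0 < s.re) (u v : m ⊕ n → ℂ) :
    BddMeas fun x => u ⬝ᵥ (linRes c A s x *ᵥ v) := by
  simp only [dotProduct]
  exact BddMeas.sum _ fun j => (BddMeas.const _).mul (bddMeas_linRes_mulVec c A hs v j)

lemma indepOfCoord_update {F : Type*} (k : m × n) (g : (m × n → ℂ) → F) :
    IndepOfCoord k fun x => g (Function.update x k 0) := fun x e => by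
  simp

lemma measurable_update_zero (k : m × n) :
    Measurable fun x : m × n → ℂ => Function.update x k 0 := by
  refine measurable_pi_lambda _ fun l => ?_
  by_cases h : l = k
  · subst h; simp
  · simp only [Function.update_of_ne h]; fun_prop

end Model

section Concentration

open MeasureTheory

variable {m n : Type*} [Fintype m] [DecidableEq m] [Fintype n] [DecidableEq n]

lemma normSq2_sum_elim (b : m ⊕ n → ℂ) :
    normSq2 b = ∑ i, ‖b (Sum.inl i)‖ ^ 2 + ∑ j, ‖b (Sum.inr j)‖ ^ 2 := by
  simp [normSq2]

lemma sum_crossTerm_sq_le (X : Matrix (m ⊕ n) (m ⊕ n) ℂ) (u v : m ⊕ n → ℂ) :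
    ∑ k : m × n, crossTerm (Sum.inl k.1) (Sum.inr k.2) X u v ^ 2
      ≤ 4 * (normSq2 (u ᵥ* X) * normSq2 (X *ᵥ v)) := by
  set b := u ᵥ* X
  set q := X *ᵥ v
  have h1 : ∀ k : m × n, crossTerm (Sum.inl k.1) (Sum.inr k.2) X u v ^ 2
      ≤ 2 * (‖b (Sum.inl k.1)‖ ^ 2 * ‖q (Sum.inr k.2)‖ ^ 2)
        + 2 * (‖b (Sum.inr k.2)‖ ^ 2 * ‖q (Sum.inl k.1)‖ ^ 2) := by
    intro k
    unfold crossTerm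
    nlinarith [sq_nonneg (‖b (Sum.inl k.1)‖ * ‖q (Sum.inr k.2)‖
      - ‖b (Sum.inr k.2)‖ * ‖q (Sum.inl k.1)‖)]
  refine (Finset.sum_le_sum fun k _ => h1 k).trans ?_
  rw [Finset.sum_add_distrib, ← Finset.mul_sum, ← Finset.mul_sum, Fintype.sum_prod_type,
    Fintype.sum_prod_type_right]
  simp only [← Finset.mul_sum, ← Finset.sum_mul]
  rw [normSq2_sum_elim b, normSq2_sum_elim q]
  have e1 : 0 ≤ ∑ i, ‖b (Sum.inl i)‖ ^ 2 := Finset.sum_nonneg fun _ _ => by positivity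
  have e2 : 0 ≤ ∑ i, ‖b (Sum.inr i)‖ ^ 2 := Finset.sum_nonneg fun _ _ => by positivity
  have e3 : 0 ≤ ∑ i, ‖q (Sum.inl i)‖ ^ 2 := Finset.sum_nonneg fun _ _ => by positivity
  have e4 : 0 ≤ ∑ i, ‖q (Sum.inr i)‖ ^ 2 := Finset.sum_nonneg fun _ _ => by positivity
  nlinarith [mul_nonneg e1 e3, mul_nonneg e1 e4, mul_nonneg e2 e3, mul_nonneg e2 e4]

lemma norm_sq_inl_add_inr_le (b : m ⊕ n → ℂ) (i : m) (j : n) :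
    ‖b (Sum.inl i)‖ ^ 2 + ‖b (Sum.inr j)‖ ^ 2 ≤ normSq2 b := by
  rw [normSq2_sum_elim]
  exact add_le_add
    (Finset.single_le_sum (f := fun i => ‖b (Sum.inl i)‖ ^ 2) (fun _ _ => by positivity)
      (Finset.mem_univ i))
    (Finset.single_le_sum (f := fun i => ‖b (Sum.inr i)‖ ^ 2) (fun _ _ => by positivity)
      (Finset.mem_univ j))

lemma sum_fullTerm_sq_le (X : Matrix (m ⊕ n) (m ⊕ n) ℂ) (u v : m ⊕ n → ℂ) :
    ∑ k : m × n, fullTerm (Sum.inl k.1) (Sum.inr k.2) X u v ^ 2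
      ≤ 4 * ((Fintype.card m + Fintype.card n) * (normSq2 (u ᵥ* X) * normSq2 (X *ᵥ v))) := by
  set b := u ᵥ* X
  set q := X *ᵥ v
  have h1 : ∀ k : m × n, fullTerm (Sum.inl k.1) (Sum.inr k.2) X u v ^ 2
      ≤ (4 * normSq2 q) * (‖b (Sum.inl k.1)‖ ^ 2 + ‖b (Sum.inr k.2)‖ ^ 2) := by
    intro k
    have hq := norm_sq_inl_add_inr_le q k.1 k.2
    unfold fullTerm
    rw [mul_pow]
    have hb2 : (‖b (Sum.inl k.1)‖ + ‖b (Sum.inr k.2)‖) ^ 2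
        ≤ 2 * (‖b (Sum.inl k.1)‖ ^ 2 + ‖b (Sum.inr k.2)‖ ^ 2) := by
      nlinarith [sq_nonneg (‖b (Sum.inl k.1)‖ - ‖b (Sum.inr k.2)‖)]
    have hq2 : (‖q (Sum.inl k.1)‖ + ‖q (Sum.inr k.2)‖) ^ 2 ≤ 2 * normSq2 q := by
      nlinarith [sq_nonneg (‖q (Sum.inl k.1)‖ - ‖q (Sum.inr k.2)‖)]
    calc _ ≤ (2 * (‖b (Sum.inl k.1)‖ ^ 2 + ‖b (Sum.inr k.2)‖ ^ 2)) * (2 * normSq2 q) := by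
          gcongr
      _ = _ := by ring
  refine (Finset.sum_le_sum fun k _ => h1 k).trans ?_
  rw [← Finset.mul_sum, Finset.sum_add_distrib, Fintype.sum_prod_type,
    Fintype.sum_prod_type_right]
  simp only [Finset.sum_const, Finset.card_univ, nsmul_eq_mul, ← Finset.mul_sum]
  have hq0 := normSq2_nonneg q
  rw [normSq2_sum_elim b]
  have e1 : 0 ≤ ∑ i, ‖b (Sum.inl i)‖ ^ 2 := Finset.sum_nonneg fun _ _ => by positivity
  have e2 : 0 ≤ ∑ i, ‖b (Sum.inr i)‖ ^ 2 := Finset.sum_nonneg fun _ _ => by positivity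
  have hm : (0 : ℝ) ≤ Fintype.card m := Nat.cast_nonneg _
  have hn : (0 : ℝ) ≤ Fintype.card n := Nat.cast_nonneg _
  have := mul_nonneg hq0 (add_nonneg (mul_nonneg hm e1) (mul_nonneg hn e2))
  linarith [this]

variable (c : m × n → ℝ) (A : Matrix m n ℂ) {s : ℂ}

lemma bddMeas_crossTerm (hs : 0 < s.re) (a b : m ⊕ n) (u v : m ⊕ n → ℂ) :
    BddMeas fun x => crossTerm a b (linRes c A s x) u v :=
  ((bddMeas_vecMul_linRes c A hs u a).norm.mul (bddMeas_linRes_mulVec c A hs v b).norm).add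
    ((bddMeas_vecMul_linRes c A hs u b).norm.mul (bddMeas_linRes_mulVec c A hs v a).norm)

lemma bddMeas_fullTerm (hs : 0 < s.re) (a b : m ⊕ n) (u v : m ⊕ n → ℂ) :
    BddMeas fun x => fullTerm a b (linRes c A s x) u v :=
  ((bddMeas_vecMul_linRes c A hs u a).norm.add (bddMeas_vecMul_linRes c A hs u b).norm).mul
    ((bddMeas_linRes_mulVec c A hs v a).norm.add (bddMeas_linRes_mulVec c A hs v b).norm)

/-- The energy of the coordinate `k`, which controls the increments of a bilinear form of the
resolvent. -/
def entryEnergy (κ ν t : ℝ) (k : m × n) (u v : m ⊕ n → ℂ) (X : Matrix (m ⊕ n) (m ⊕ n) ℂ) : ℝ :=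
  κ / ν * (crossTerm (Sum.inl k.1) (Sum.inr k.2) X u v ^ 2
    + t / ν * fullTerm (Sum.inl k.1) (Sum.inr k.2) X u v ^ 2)

lemma entryEnergy_nonneg {κ ν t : ℝ} (hκ : 0 ≤ κ) (hν : 0 < ν) (ht : 0 ≤ t) (k : m × n)
    (u v : m ⊕ n → ℂ) (X : Matrix (m ⊕ n) (m ⊕ n) ℂ) : 0 ≤ entryEnergy κ ν t k u v X := by
  unfold entryEnergy; positivity

lemma bddMeas_entryEnergy (hs : 0 < s.re) (κ ν t : ℝ) (k : m × n) (u v : m ⊕ n → ℂ) :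
    BddMeas fun x => entryEnergy κ ν t k u v (linRes c A s x) :=
  (BddMeas.const _).mul (((bddMeas_crossTerm c A hs _ _ u v).pow 2).add
    ((BddMeas.const _).mul ((bddMeas_fullTerm c A hs _ _ u v).pow 2)))

variable {c} {κ ν : ℝ}

lemma norm_sq_form_sub_le (hs : 0 < s.re) (hν : 1 ≤ ν) (hκ : 0 ≤ κ) {k : m × n}
    (hc : c k ^ 2 ≤ κ / ν) (u v : m ⊕ n → ℂ) (x : m × n → ℂ) :
    ‖u ⬝ᵥ (linRes c A s x *ᵥ v) - u ⬝ᵥ (linRes c A s (Function.update x k 0) *ᵥ v)‖ ^ 2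
      ≤ 2 * (‖x k‖ ^ 2 + ‖x k‖ ^ 4) * entryEnergy κ ν ((1 / s.re) ^ 2 * κ) k u v
          (linRes c A s (Function.update x k 0)) := by
  have hν0 : 0 < ν := by linarith
  have h1 := norm_form_sub_le (norm_linRes_apply_le c A hs x) (linRes_sub_right c A hs x k)
    (linRes_sub_left c A hs x k) u v
  set L := 1 / s.re with hL
  have hL0 : 0 < L := by positivity
  have hC0 := crossTerm_nonneg (Sum.inl k.1) (Sum.inr k.2)
    (linRes c A s (Function.update x k 0)) u v
  have hF0 := fullTerm_nonneg (Sum.inl k.1) (Sum.inr k.2)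
    (linRes c A s (Function.update x k 0)) u v
  unfold entryEnergy
  set C := crossTerm (Sum.inl k.1) (Sum.inr k.2) (linRes c A s (Function.update x k 0)) u v
  set F := fullTerm (Sum.inl k.1) (Sum.inr k.2) (linRes c A s (Function.update x k 0)) u v
  have hζ : ‖(c k : ℂ) * x k‖ ^ 2 ≤ κ / ν * ‖x k‖ ^ 2 := by
    rw [norm_mul, mul_pow, Complex.norm_real, Real.norm_eq_abs, sq_abs]
    gcongr
  set z := ‖(c k : ℂ) * x k‖
  set t := ‖x k‖
  set a := κ / ν with ha
  have ha0 : 0 ≤ a := by positivity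
  calc _ ≤ (z * C + L * z ^ 2 * F) ^ 2 := by gcongr
    _ ≤ 2 * (z * C) ^ 2 + 2 * (L * z ^ 2 * F) ^ 2 := by
        nlinarith [sq_nonneg (z * C - L * z ^ 2 * F)]
    _ = 2 * (z ^ 2 * C ^ 2) + 2 * (L ^ 2 * (z ^ 2) ^ 2 * F ^ 2) := by ring
    _ ≤ 2 * ((a * t ^ 2) * C ^ 2) + 2 * (L ^ 2 * (a * t ^ 2) ^ 2 * F ^ 2) := by gcongr
    _ ≤ 2 * (t ^ 2 + t ^ 4) * (a * (C ^ 2 + L ^ 2 * a * F ^ 2)) := by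
        have e1 : 0 ≤ t ^ 4 * (a * C ^ 2) := by positivity
        have e2 : 0 ≤ t ^ 2 * (a * (L ^ 2 * a * F ^ 2)) := by positivity
        nlinarith
    _ = _ := by rw [ha]; ring

lemma energy_comparison {κ ν y w C F C' F' : ℝ} (hν : 1 ≤ ν) (hκ : 0 ≤ κ) (hy0 : 0 ≤ y)
    (hC0 : 0 ≤ C) (hF0 : 0 ≤ F) (hF0' : 0 ≤ F')
    (hζ : w ^ 2 ≤ 2 * y / ν) (h1 : C ≤ C' + (4 * w + 2 * w ^ 2) * F')
    (h2 : F ≤ (1 + 2 * w) ^ 2 * F') :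
    κ / ν * (C ^ 2 + y / ν * F ^ 2)
      ≤ 256 * (1 + y) ^ 3 * (κ / ν * (C' ^ 2 + 1 / ν * F' ^ 2)) := by
  have hν0 : 0 < ν := by linarith
  have hw1 : w ^ 2 ≤ 2 * y := hζ.trans (div_le_self (by positivity) hν)
  have hw4 : w ^ 4 ≤ 2 * y * (2 * y / ν) := by
    calc w ^ 4 = w ^ 2 * w ^ 2 := by ring
      _ ≤ _ := mul_le_mul hw1 hζ (by positivity) (by positivity)
  have e1 : (4 * w + 2 * w ^ 2) ^ 2 ≤ 32 * w ^ 2 + 8 * w ^ 4 := by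
    nlinarith [sq_nonneg (4 * w - 2 * w ^ 2)]
  have e2 : 2 * (4 * w + 2 * w ^ 2) ^ 2 ≤ (128 * y + 64 * y ^ 2) / ν := by
    calc _ ≤ 64 * (2 * y / ν) + 16 * (2 * y * (2 * y / ν)) := by linarith
      _ = _ := by ring
  have hCle : C ^ 2 ≤ 2 * C' ^ 2 + (128 * y + 64 * y ^ 2) / ν * F' ^ 2 := by
    calc C ^ 2 ≤ (C' + (4 * w + 2 * w ^ 2) * F') ^ 2 := pow_le_pow_left₀ hC0 h1 2
      _ ≤ 2 * C' ^ 2 + 2 * ((4 * w + 2 * w ^ 2) * F') ^ 2 := by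
          nlinarith [sq_nonneg (C' - (4 * w + 2 * w ^ 2) * F')]
      _ = 2 * C' ^ 2 + 2 * (4 * w + 2 * w ^ 2) ^ 2 * F' ^ 2 := by ring
      _ ≤ _ := by linarith [mul_le_mul_of_nonneg_right e2 (sq_nonneg F')]
  have e3 : (1 + 2 * w) ^ 2 ≤ 2 * (1 + 8 * y) := by nlinarith [sq_nonneg (1 - 2 * w)]
  have hFle : F ^ 2 ≤ 4 * (1 + 8 * y) ^ 2 * F' ^ 2 := by
    calc F ^ 2 ≤ (2 * (1 + 8 * y) * F') ^ 2 :=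
          pow_le_pow_left₀ hF0 (h2.trans (mul_le_mul_of_nonneg_right e3 hF0')) 2
      _ = _ := by ring
  have e4 : (2 : ℝ) ≤ 256 * (1 + y) ^ 3 := by nlinarith [pow_nonneg hy0 2, pow_nonneg hy0 3]
  have e5 : 132 * y + 128 * y ^ 2 + 256 * y ^ 3 ≤ 256 * (1 + y) ^ 3 := by
    nlinarith [pow_nonneg hy0 2, pow_nonneg hy0 3]
  calc κ / ν * (C ^ 2 + y / ν * F ^ 2)
      ≤ κ / ν * ((2 * C' ^ 2 + (128 * y + 64 * y ^ 2) / ν * F' ^ 2)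
        + y / ν * (4 * (1 + 8 * y) ^ 2 * F' ^ 2)) :=
        mul_le_mul_of_nonneg_left (add_le_add hCle
          (mul_le_mul_of_nonneg_left hFle (by positivity))) (by positivity)
    _ = κ / ν * (2 * C' ^ 2 + (132 * y + 128 * y ^ 2 + 256 * y ^ 3) * (1 / ν * F' ^ 2)) := by ring
    _ ≤ κ / ν * (256 * (1 + y) ^ 3 * C' ^ 2 + 256 * (1 + y) ^ 3 * (1 / ν * F' ^ 2)) :=
        mul_le_mul_of_nonneg_left (add_le_add (mul_le_mul_of_nonneg_right e4 (sq_nonneg C'))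
          (mul_le_mul_of_nonneg_right e5 (by positivity))) (by positivity)
    _ = _ := by ring

lemma entryEnergy_update_le (hs : 0 < s.re) (hν : 1 ≤ ν) (hκ : 0 ≤ κ) {k : m × n}
    (hc : c k ^ 2 ≤ κ / ν) (u v : m ⊕ n → ℂ) {x : m × n → ℂ} (hx : ‖x k‖ ^ 2 ≤ 2) :
    entryEnergy κ ν ((1 / s.re) ^ 2 * κ) k u v (linRes c A s (Function.update x k 0))
      ≤ 256 * (1 + (1 / s.re) ^ 2 * κ) ^ 3 * entryEnergy κ ν 1 k u v (linRes c A s x) := by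
  have hζ : (1 / s.re * ‖(c k : ℂ) * x k‖) ^ 2 ≤ 2 * ((1 / s.re) ^ 2 * κ) / ν := by
    rw [norm_mul, mul_pow, mul_pow, Complex.norm_real, Real.norm_eq_abs, sq_abs]
    calc (1 / s.re) ^ 2 * (c k ^ 2 * ‖x k‖ ^ 2) ≤ (1 / s.re) ^ 2 * (κ / ν * 2) := by gcongr
      _ = _ := by ring
  exact energy_comparison hν hκ (by positivity) (crossTerm_nonneg _ _ _ u v)
    (fullTerm_nonneg _ _ _ u v) (fullTerm_nonneg _ _ _ u v) hζ
    (crossTerm_le_of_perturb (by positivity)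
      (norm_linRes_apply_le c A hs (Function.update x k 0)) (linRes_sub_right c A hs x k)
      (linRes_sub_left c A hs x k) u v)
    (fullTerm_le_of_perturb (by positivity)
      (norm_linRes_apply_le c A hs (Function.update x k 0)) (linRes_sub_right c A hs x k)
      (linRes_sub_left c A hs x k) u v)

/-- The constant in `concentration`. -/
def concConst (Mo κ R L : ℝ) : ℝ := 8192 * (1 + Mo) * (1 + L ^ 2 * κ) ^ 3 * κ * (1 + R) * L ^ 4

variable (μ : m × n → Measure ℂ) [∀ k, IsProbabilityMeasure (μ k)]

/-- Bilinear forms of the resolvent are concentrated around their mean. -/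
theorem concentration (q : ℕ) {Mo R : ℝ} (hs : 0 < s.re) (hν : 1 ≤ ν) (hκ : 0 ≤ κ)
    (hMo : 0 ≤ Mo) (hc : ∀ k, c k ^ 2 ≤ κ / ν)
    (hR : (Fintype.card m + Fintype.card n : ℝ) ≤ R * ν)
    (hμ : ∀ k, EntryLaw (q + 1) Mo (μ k)) (u v : m ⊕ n → ℂ) :
    ∫ x, (‖u ⬝ᵥ (linRes c A s x *ᵥ v)
        - ∫ y, u ⬝ᵥ (linRes c A s y *ᵥ v) ∂(Measure.pi μ)‖ ^ 2) ^ (q + 1) ∂(Measure.pi μ)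
      ≤ momentConst q
        * (concConst Mo κ R (1 / s.re) * (normSq2 u * normSq2 v) / ν) ^ (q + 1) := by
  have hν0 : 0 < ν := by linarith
  set L := 1 / s.re with hL
  have hL0 : 0 < L := by positivity
  set y := L ^ 2 * κ with hy
  have hy0 : 0 ≤ y := by positivity
  set f : (m × n → ℂ) → ℂ := fun x => u ⬝ᵥ (linRes c A s x *ᵥ v) with hf
  have hfb : BddMeas f := bddMeas_linRes_form c A hs u v
  set G := 8 * (1 + Mo) * (256 * (1 + y) ^ 3) with hG
  have hG0 : 0 ≤ G := by positivity
  have key : ∀ (k : m × n) (j : ℕ), 1 ≤ j → j ≤ q + 1 → ∀ g : (m × n → ℂ) → ℝ, BddMeas g →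
      (∀ x, 0 ≤ g x) → IndepOfCoord k g →
      ∫ x, g x * (‖f x - f (Function.update x k 0)‖ ^ 2) ^ j ∂(Measure.pi μ)
        ≤ ∫ x, g x * (G * entryEnergy κ ν 1 k u v (linRes c A s x)) ^ j ∂(Measure.pi μ) := by
    intro k j hj1 hjq g hg hg0 hgk
    have hdec := integral_mul_le_of_decoupling μ (hμ k) (Nat.succ_le_succ (Nat.zero_le q))
      (ψ := fun e : ℂ => (‖e‖ ^ 2 + ‖e‖ ^ 4) ^ j) (by fun_prop)
      ((hμ k).integrable_sq_add_pow_four_pow hjq) (C₁ := 2 ^ j * (1 + Mo))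
      (C₂ := (256 * (1 + y) ^ 3) ^ j) (by positivity)
      ((hμ k).integral_sq_add_pow_four_pow_le hjq)
      (g := g) (H := fun x => (‖f x - f (Function.update x k 0)‖ ^ 2) ^ j)
      (Φ₀ := fun x => (2 * entryEnergy κ ν y k u v (linRes c A s (Function.update x k 0))) ^ j)
      (Φ := fun x => (2 * entryEnergy κ ν 1 k u v (linRes c A s x)) ^ j)
      hg (((hfb.sub (hfb.comp (measurable_update_zero k))).norm.pow 2).pow j)
      (((BddMeas.const _).mul
        ((bddMeas_entryEnergy c A hs κ ν y k u v).comp (measurable_update_zero k))).pow j)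
      (((BddMeas.const _).mul (bddMeas_entryEnergy c A hs κ ν 1 k u v)).pow j)
      hg0 (fun x => by
        have := entryEnergy_nonneg hκ hν0 hy0 k u v (linRes c A s (Function.update x k 0))
        positivity)
      (fun x => by
        have := entryEnergy_nonneg hκ hν0 zero_le_one k u v (linRes c A s x)
        positivity)
      (by positivity) hgk
      (indepOfCoord_update k fun x => (2 * entryEnergy κ ν y k u v (linRes c A s x)) ^ j)
      (fun x => by
        rw [← mul_pow]
        refine pow_le_pow_left₀ (by positivity) ?_ j
        refine (norm_sq_form_sub_le A hs hν hκ (hc k) u v x).trans_eq ?_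
        ring)
      (fun x hx => by
        rw [← mul_pow]
        have h0 := entryEnergy_nonneg hκ hν0 hy0 k u v (linRes c A s (Function.update x k 0))
        refine pow_le_pow_left₀ (by positivity) ?_ j
        have := entryEnergy_update_le A hs hν hκ (hc k) u v hx
        rw [← hL, ← hy] at this
        linarith)
    refine hdec.trans ?_
    rw [← integral_const_mul]
    refine integral_mono (((hg.mul (((BddMeas.const _).mul
      (bddMeas_entryEnergy c A hs κ ν 1 k u v)).pow j)).integrable _).const_mul _)
      ((hg.mul (((BddMeas.const _).mul
        (bddMeas_entryEnergy c A hs κ ν 1 k u v)).pow j)).integrable _) fun x => ?_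
    have he := entryEnergy_nonneg hκ hν0 zero_le_one k u v (linRes c A s x)
    set e := entryEnergy κ ν 1 k u v (linRes c A s x)
    have h2 : 2 * (1 + Mo) ≤ (2 * (1 + Mo)) ^ j :=
      le_self_pow₀ (by linarith) (by omega)
    calc 2 * (2 ^ j * (1 + Mo)) * (256 * (1 + y) ^ 3) ^ j * (g x * (2 * e) ^ j)
        = (2 * (1 + Mo)) * (g x * (2 ^ j * (256 * (1 + y) ^ 3) ^ j * (2 * e) ^ j)) := by ring
      _ ≤ (2 * (1 + Mo)) ^ j * (g x * (2 ^ j * (256 * (1 + y) ^ 3) ^ j * (2 * e) ^ j)) := by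
          gcongr
          exact mul_nonneg (hg0 x) (by positivity)
      _ = g x * ((2 * (1 + Mo)) * (2 * (256 * (1 + y) ^ 3) * (2 * e))) ^ j := by
          simp only [mul_pow]; ring
      _ = g x * (G * e) ^ j := by rw [hG]; congr 2; ring
  have hsum : ∀ x, ∑ k, G * entryEnergy κ ν 1 k u v (linRes c A s x)
      ≤ concConst Mo κ R L * (normSq2 u * normSq2 v) / ν := by
    intro x
    have hb := (linMat_accretive c A (s := s) x).normSq2_vecMul_inv_le hs u
    have hq := (linMat_accretive c A (s := s) x).normSq2_inv_mulVec_le hs v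
    have h1 := sum_crossTerm_sq_le (linRes c A s x) u v
    have h2 := sum_fullTerm_sq_le (linRes c A s x) u v
    have hbq : normSq2 (u ᵥ* linRes c A s x) * normSq2 (linRes c A s x *ᵥ v)
        ≤ L ^ 4 * (normSq2 u * normSq2 v) := by
      calc _ ≤ (L ^ 2 * normSq2 u) * (L ^ 2 * normSq2 v) :=
            mul_le_mul hb hq (normSq2_nonneg _)
              (mul_nonneg (by positivity) (normSq2_nonneg _))
        _ = _ := by ring
    have hbq0 : 0 ≤ normSq2 (u ᵥ* linRes c A s x) * normSq2 (linRes c A s x *ᵥ v) :=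
      mul_nonneg (normSq2_nonneg _) (normSq2_nonneg _)
    set bq := normSq2 (u ᵥ* linRes c A s x) * normSq2 (linRes c A s x *ᵥ v)
    have h3 : 1 / ν * ∑ k : m × n, fullTerm (Sum.inl k.1) (Sum.inr k.2) (linRes c A s x) u v ^ 2
        ≤ 4 * R * bq := by
      calc _ ≤ 1 / ν * (4 * ((R * ν) * bq)) := by
            gcongr
            exact h2.trans (by gcongr)
        _ = _ := by field_simp
    have hR0 : 0 ≤ R := by
      have h0 : 0 ≤ R * ν := le_trans (by positivity) hR
      exact nonneg_of_mul_nonneg_left h0 hν0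
    unfold entryEnergy
    rw [← Finset.mul_sum, ← Finset.mul_sum, Finset.sum_add_distrib, ← Finset.mul_sum]
    calc _ ≤ G * (κ / ν * (4 * bq + 4 * R * bq)) := by gcongr
      _ = G * (κ / ν * (4 * (1 + R))) * bq := by ring
      _ ≤ G * (κ / ν * (4 * (1 + R))) * (L ^ 4 * (normSq2 u * normSq2 v)) := by gcongr
      _ = _ := by rw [hG, concConst, ← hy]; ring
  refine integral_norm_sub_integral_pow_le μ q hfb (f₀ := fun k x => f (Function.update x k 0))
    (fun k => hfb.comp (measurable_update_zero k)) (fun k => indepOfCoord_update k f)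
    (Z := fun k x => G * entryEnergy κ ν 1 k u v (linRes c A s x))
    (fun k => (BddMeas.const _).mul (bddMeas_entryEnergy c A hs κ ν 1 k u v))
    (fun k x => mul_nonneg hG0 (entryEnergy_nonneg hκ hν0 zero_le_one k u v _)) hsum ?_ ?_
  · intro k g hg hg0 hgk
    simpa using key k 1 le_rfl (by omega) g hg hg0 hgk
  · intro k
    simpa using key k (q + 1) (by omega) le_rfl (fun _ => 1) (BddMeas.const 1)
      (fun _ => zero_le_one) (fun _ _ => rfl)

end Concentration

section EntryExpansion

variable {I : Type*} [Fintype I] [DecidableEq I] {a b : I} {X X' : Matrix I I ℂ} {L : ℝ}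

lemma norm_entry_remainder_le (hL0 : 0 ≤ L) (hL : ∀ i j, ‖X i j‖ ≤ L)
    (hL' : ∀ i j, ‖X' i j‖ ≤ L) {c : ℝ} {z : ℂ}
    (h : X - X' = -(X' * rankTwo a b (c * z) * X))
    (h' : X - X' = -(X * rankTwo a b (c * z) * X')) (v : I → ℂ) :
    ‖(c * z * (X *ᵥ v) b - (c ^ 2 : ℝ) * (X b b * (X *ᵥ v) a)) - c * z * (X' *ᵥ v) b
        - (c ^ 2 : ℝ) * (((‖z‖ ^ 2 - 1 : ℝ) : ℂ) * (X' b b * (X' *ᵥ v) a))‖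
      ≤ c ^ 2 * (‖z‖ ^ 2 * (‖X' b a‖ * ‖(X' *ᵥ v) b‖))
        + |c| ^ 3 * L ^ 2 * ((2 * ‖z‖ ^ 3 + 3 * ‖z‖) * (‖(X' *ᵥ v) a‖ + ‖(X' *ᵥ v) b‖)) := by
  set ζ : ℂ := c * z with hζ
  have hζn : ‖ζ‖ = |c| * ‖z‖ := by rw [hζ, norm_mul, Complex.norm_real, Real.norm_eq_abs]
  set qa := ‖(X' *ᵥ v) a‖
  set qb := ‖(X' *ᵥ v) b‖
  have hqa : 0 ≤ qa := norm_nonneg _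
  have hqb : 0 ≤ qb := norm_nonneg _
  set r : ℂ := ((X' * rankTwo a b ζ * (X * rankTwo a b ζ * X')) *ᵥ v) b with hr
  have hexp : (X *ᵥ v) b - (X' *ᵥ v) b
      = -(ζ * (X' b a * (X' *ᵥ v) b) - star ζ * (X' b b * (X' *ᵥ v) a)) + r := by
    have h1 := congrFun (congrArg (fun Y => Y *ᵥ v) (second_order_expansion h h')) b
    simp only [Matrix.add_mulVec, Matrix.sub_mulVec, Matrix.neg_mulVec, Pi.add_apply,
      Pi.sub_apply, Pi.neg_apply] at h1
    rw [h1, mul_rankTwo_mul_mulVec]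
  have hxa := norm_mul_rankTwo_mul_mulVec_le (a := a) (b := b) (ζ := ζ) hL a X' v
  have hxb := norm_mul_rankTwo_mul_mulVec_le (a := a) (b := b) (ζ := ζ) hL b X' v
  have hrn : ‖r‖ ≤ L * ‖ζ‖ * (2 * (L * ‖ζ‖ * (qa + qb))) := by
    refine (norm_mul_rankTwo_mul_mulVec_le hL' b _ v).trans ?_
    gcongr
    linarith
  have hqdiff : ‖(X *ᵥ v) a - (X' *ᵥ v) a‖ ≤ L * ‖ζ‖ * (qa + qb) := by
    have h1 := congrFun (congrArg (fun Y => Y *ᵥ v) h') a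
    simp only [Matrix.sub_mulVec, Matrix.neg_mulVec, Pi.sub_apply, Pi.neg_apply] at h1
    rw [h1, norm_neg]
    exact hxa
  have hbb : ‖X b b - X' b b‖ ≤ 2 * L ^ 2 * ‖ζ‖ := by
    have h1 := congrFun (congrArg (fun Y => Y *ᵥ (Pi.single b 1)) h') b
    simp only [Matrix.sub_mulVec, Matrix.neg_mulVec, Pi.sub_apply, Pi.neg_apply] at h1
    have h2 := norm_mul_rankTwo_mul_mulVec_le (a := a) (b := b) (ζ := ζ) hL b X' (Pi.single b 1)
    simp only [Matrix.mulVec_single_one, Matrix.col_apply] at h1 h2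
    rw [h1, norm_neg]
    refine h2.trans ?_
    have h3 : ‖X' a b‖ + ‖X' b b‖ ≤ 2 * L := by linarith [hL' a b, hL' b b]
    calc _ ≤ L * ‖ζ‖ * (2 * L) := by gcongr
      _ = _ := by ring
  have hzz : ζ * star ζ = ((c ^ 2 * ‖z‖ ^ 2 : ℝ) : ℂ) := by
    rw [RCLike.star_def, Complex.mul_conj', hζn]
    push_cast
    rw [mul_pow, ← Complex.ofReal_pow |c|, sq_abs]; push_cast; ring
  have hsplit : (ζ * (X *ᵥ v) b - (c ^ 2 : ℝ) * (X b b * (X *ᵥ v) a)) - ζ * (X' *ᵥ v) b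
        - (c ^ 2 : ℝ) * (((‖z‖ ^ 2 - 1 : ℝ) : ℂ) * (X' b b * (X' *ᵥ v) a))
      = -(ζ ^ 2 * (X' b a * (X' *ᵥ v) b)) + ζ * r
        - (c ^ 2 : ℝ) * ((X b b - X' b b) * (X' *ᵥ v) a
            + X b b * ((X *ᵥ v) a - (X' *ᵥ v) a)) := by
    have h1 : (X *ᵥ v) b = (X' *ᵥ v) b
        - (ζ * (X' b a * (X' *ᵥ v) b) - star ζ * (X' b b * (X' *ᵥ v) a)) + r := by
      linear_combination hexp
    rw [h1]
    push_cast at hzz ⊢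
    linear_combination (X' b b * (X' *ᵥ v) a) * hzz
  rw [hsplit]
  have hc2 : ‖((c ^ 2 : ℝ) : ℂ)‖ = c ^ 2 := by
    rw [Complex.norm_real, Real.norm_of_nonneg (sq_nonneg c)]
  have t1 : ‖-(ζ ^ 2 * (X' b a * (X' *ᵥ v) b))‖ = c ^ 2 * (‖z‖ ^ 2 * (‖X' b a‖ * qb)) := by
    rw [norm_neg, norm_mul, norm_mul, norm_pow, hζn, mul_pow, sq_abs]; ring
  have t2 : ‖ζ * r‖ ≤ |c| ^ 3 * L ^ 2 * (2 * ‖z‖ ^ 3 * (qa + qb)) := by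
    rw [norm_mul]
    calc _ ≤ ‖ζ‖ * (L * ‖ζ‖ * (2 * (L * ‖ζ‖ * (qa + qb)))) := by gcongr
      _ = _ := by rw [hζn]; ring
  have t3 : ‖((c ^ 2 : ℝ) : ℂ) * ((X b b - X' b b) * (X' *ᵥ v) a
      + X b b * ((X *ᵥ v) a - (X' *ᵥ v) a))‖ ≤ |c| ^ 3 * L ^ 2 * (3 * ‖z‖ * (qa + qb)) := by
    rw [norm_mul, hc2]
    have e1 : ‖(X b b - X' b b) * (X' *ᵥ v) a + X b b * ((X *ᵥ v) a - (X' *ᵥ v) a)‖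
        ≤ 2 * L ^ 2 * ‖ζ‖ * qa + L * (L * ‖ζ‖ * (qa + qb)) := by
      refine (norm_add_le _ _).trans ?_
      rw [norm_mul, norm_mul]
      gcongr
      exact hL b b
    have e2 : 2 * L ^ 2 * ‖ζ‖ * qa + L * (L * ‖ζ‖ * (qa + qb)) ≤ 3 * L ^ 2 * ‖ζ‖ * (qa + qb) := by
      have : 0 ≤ L ^ 2 * ‖ζ‖ * qb := by positivity
      linarith
    calc _ ≤ c ^ 2 * (3 * L ^ 2 * ‖ζ‖ * (qa + qb)) := by
          gcongr
          exact e1.trans e2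
      _ = _ := by rw [hζn, ← sq_abs c]; ring
  calc _ ≤ ‖-(ζ ^ 2 * (X' b a * (X' *ᵥ v) b))‖ + ‖ζ * r‖ + _ :=
        (norm_sub_le _ _).trans (add_le_add (norm_add_le _ _) le_rfl)
    _ ≤ c ^ 2 * (‖z‖ ^ 2 * (‖X' b a‖ * qb)) + |c| ^ 3 * L ^ 2 * (2 * ‖z‖ ^ 3 * (qa + qb))
        + |c| ^ 3 * L ^ 2 * (3 * ‖z‖ * (qa + qb)) := add_le_add (add_le_add t1.le t2) t3
    _ = _ := by ring

end EntryExpansion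

section Bias

open MeasureTheory

variable {m n : Type*} [Fintype m] [DecidableEq m] [Fintype n] [DecidableEq n]
  {c : m × n → ℝ} (A : Matrix m n ℂ) {s : ℂ}
  (μ : m × n → Measure ℂ) [∀ k, IsProbabilityMeasure (μ k)]

lemma norm_integral_entry_le {p : ℕ} {Mo : ℝ} (hs : 0 < s.re) (hp : 1 ≤ p) {k : m × n}
    (hμ : EntryLaw p Mo (μ k)) {φ : ℂ → ℂ} (hφm : Measurable φ) (hφn : ∀ e, ‖φ e‖ = ‖e‖)
    (hφ0 : ∫ e, φ e ∂(μ k) = 0) {a b : m ⊕ n}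
    (hE : ∀ e, rankTwo (Sum.inl k.1) (Sum.inr k.2) (c k * e)
      = (rankTwo a b (c k * φ e) : Matrix (m ⊕ n) (m ⊕ n) ℂ)) (v : m ⊕ n → ℂ) :
    Integrable (fun x => c k * φ (x k) * (linRes c A s x *ᵥ v) b
      - (c k ^ 2 : ℝ) * (linRes c A s x b b * (linRes c A s x *ᵥ v) a)) (Measure.pi μ) ∧
    ‖∫ x, (c k * φ (x k) * (linRes c A s x *ᵥ v) b
      - (c k ^ 2 : ℝ) * (linRes c A s x b b * (linRes c A s x *ᵥ v) a)) ∂(Measure.pi μ)‖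
      ≤ 2 * c k ^ 2 * ∫ x, ‖linRes c A s x b a‖ * ‖(linRes c A s x *ᵥ v) b‖ ∂(Measure.pi μ)
        + |c k| ^ 3 * ((1 / s.re) ^ 2 * (12 + 10 * (1 + Mo) * (1 + 4 * (1 / s.re) * |c k|)))
          * ∫ x, (‖(linRes c A s x *ᵥ v) a‖ + ‖(linRes c A s x *ᵥ v) b‖) ∂(Measure.pi μ) := by
  set L := 1 / s.re with hLdef
  have hL0 : 0 < L := by positivity
  have hMo := hμ.nonneg
  set W : (m × n → ℂ) → Matrix (m ⊕ n) (m ⊕ n) ℂ := fun x => linRes c A s x with hW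
  have hWL : ∀ x i j, ‖W x i j‖ ≤ L := fun x i j => norm_linRes_apply_le c A hs x i j
  have hleft : ∀ x, W x - W (Function.update x k 0)
      = -(W x * rankTwo a b (c k * φ (x k)) * W (Function.update x k 0)) := fun x => by
    rw [← hE]; exact linRes_sub_left c A hs x k
  have hright : ∀ x, W x - W (Function.update x k 0)
      = -(W (Function.update x k 0) * rankTwo a b (c k * φ (x k)) * W x) := fun x => by
    rw [← hE]; exact linRes_sub_right c A hs x k
  have hWb : ∀ i j, BddMeas fun x => W x i j := fun i j => bddMeas_linRes_apply c A hs i j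
  have hqb : ∀ i, BddMeas fun x => (W x *ᵥ v) i := fun i => bddMeas_linRes_mulVec c A hs v i
  have hup := measurable_update_zero (m := m) (n := n) k
  have hφi : Integrable φ (μ k) := by
    refine ((hμ.integrable_pow (j := 1) (by omega))).mono' hφm.aestronglyMeasurable
      (Filter.Eventually.of_forall fun e => ?_)
    rw [hφn, pow_one]
  have hφci : Integrable (fun e => (c k : ℂ) * φ e) (μ k) := hφi.const_mul _
  have hi1 : Integrable (fun x => c k * φ (x k) * (W x *ᵥ v) b) (Measure.pi μ) :=
    integrable_coord_mul μ hφci (hqb b)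
  have hi2 : Integrable (fun x => ((c k ^ 2 : ℝ) : ℂ) * (W x b b * (W x *ᵥ v) a))
      (Measure.pi μ) := (((hWb b b).mul (hqb a)).integrable _).const_mul _
  have hi := hi1.sub hi2
  refine ⟨hi, ?_⟩
  have hsqi : Integrable (fun e : ℂ => ((‖e‖ ^ 2 - 1 : ℝ) : ℂ)) (μ k) :=
    ((hμ.integrable_pow (j := 2) (by omega)).sub (integrable_const 1)).ofReal
  have hi3 : Integrable (fun x => c k * φ (x k) * (W (Function.update x k 0) *ᵥ v) b)
      (Measure.pi μ) := integrable_coord_mul μ hφci ((hqb b).comp hup)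
  have hi4 : Integrable (fun x => ((c k ^ 2 : ℝ) : ℂ) * (((‖x k‖ ^ 2 - 1 : ℝ) : ℂ)
      * (W (Function.update x k 0) b b * (W (Function.update x k 0) *ᵥ v) a)))
      (Measure.pi μ) :=
    (integrable_coord_mul μ hsqi (((hWb b b).comp hup).mul ((hqb a).comp hup))).const_mul _
  have hz3 : ∫ x, c k * φ (x k) * (W (Function.update x k 0) *ᵥ v) b ∂(Measure.pi μ) = 0 := by
    rw [integral_coord_mul μ (ψ := fun e => (c k : ℂ) * φ e) (by fun_prop)
      ((hqb b).comp hup).meas (indepOfCoord_update k fun x => (W x *ᵥ v) b), integral_const_mul,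
      hφ0, mul_zero, zero_mul]
  have hz4 : ∫ x, ((c k ^ 2 : ℝ) : ℂ) * (((‖x k‖ ^ 2 - 1 : ℝ) : ℂ)
      * (W (Function.update x k 0) b b * (W (Function.update x k 0) *ᵥ v) a))
      ∂(Measure.pi μ) = 0 := by
    rw [integral_const_mul, integral_coord_mul μ (ψ := fun e => ((‖e‖ ^ 2 - 1 : ℝ) : ℂ))
      (by fun_prop) (((hWb b b).comp hup).mul ((hqb a).comp hup)).meas
      (indepOfCoord_update k fun x => W x b b * (W x *ᵥ v) a), integral_complex_ofReal,
      integral_sub (hμ.integrable_pow (j := 2) (by omega)) (integrable_const 1), hμ.variance_one]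
    simp
  set Φ1 : (m × n → ℂ) → ℝ := fun x => ‖W x b a‖ * ‖(W x *ᵥ v) b‖ with hΦ1
  set Φ2 : (m × n → ℂ) → ℝ := fun x => ‖(W x *ᵥ v) a‖ + ‖(W x *ᵥ v) b‖ with hΦ2
  have hΦ1b : BddMeas Φ1 := (hWb b a).norm.mul (hqb b).norm
  have hΦ2b : BddMeas Φ2 := (hqb a).norm.add (hqb b).norm
  have hΦ10 : ∀ x, 0 ≤ Φ1 x := fun x => by positivity
  have hΦ20 : ∀ x, 0 ≤ Φ2 x := fun x => by positivity
  have hj1 : Integrable (fun x => c k ^ 2 * (‖x k‖ ^ 2 * Φ1 (Function.update x k 0)))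
      (Measure.pi μ) :=
    (integrable_coord_mul μ (hμ.integrable_pow (j := 2) (by omega)) (hΦ1b.comp hup)).const_mul _
  have hψi : Integrable (fun e : ℂ => 2 * ‖e‖ ^ 3 + 3 * ‖e‖) (μ k) := by
    have := (hμ.integrable_pow (j := 1) (by omega)).const_mul 3
    simp only [pow_one] at this
    exact ((hμ.integrable_pow (j := 3) (by omega)).const_mul 2).add this
  have hj2 : Integrable (fun x => |c k| ^ 3 * L ^ 2 * ((2 * ‖x k‖ ^ 3 + 3 * ‖x k‖)
      * Φ2 (Function.update x k 0))) (Measure.pi μ) :=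
    (integrable_coord_mul μ hψi (hΦ2b.comp hup)).const_mul _
  have hrem := norm_integral_le_of_norm_le (hj1.add hj2)
    (f := fun x => (c k * φ (x k) * (W x *ᵥ v) b
      - (c k ^ 2 : ℝ) * (W x b b * (W x *ᵥ v) a))
      - c k * φ (x k) * (W (Function.update x k 0) *ᵥ v) b
      - ((c k ^ 2 : ℝ) : ℂ) * (((‖x k‖ ^ 2 - 1 : ℝ) : ℂ)
      * (W (Function.update x k 0) b b * (W (Function.update x k 0) *ᵥ v) a)))
    (Filter.Eventually.of_forall fun x => by
      have := norm_entry_remainder_le hL0.le (hWL x) (hWL (Function.update x k 0))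
        (hright x) (hleft x) v
      rw [hφn] at this
      exact this)
  have hsplit : ∫ x, ((c k * φ (x k) * (W x *ᵥ v) b
      - (c k ^ 2 : ℝ) * (W x b b * (W x *ᵥ v) a))
      - c k * φ (x k) * (W (Function.update x k 0) *ᵥ v) b
      - ((c k ^ 2 : ℝ) : ℂ) * (((‖x k‖ ^ 2 - 1 : ℝ) : ℂ)
      * (W (Function.update x k 0) b b * (W (Function.update x k 0) *ᵥ v) a))) ∂(Measure.pi μ)
      = ∫ x, (c k * φ (x k) * (W x *ᵥ v) b
      - (c k ^ 2 : ℝ) * (W x b b * (W x *ᵥ v) a)) ∂(Measure.pi μ) := by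
    have e1 := integral_sub (hi.sub hi3) hi4
    have e2 := integral_sub hi hi3
    simp only [Pi.sub_apply] at e1 e2
    rw [e1, e2, hz3, hz4, sub_zero, sub_zero]
  rw [hsplit, integral_add' hj1 hj2, integral_const_mul, integral_const_mul] at hrem
  refine hrem.trans ?_
  have hck : 0 ≤ |c k| := abs_nonneg _
  have hζ : ∀ x : m × n → ℂ, ‖x k‖ ^ 2 ≤ 2 → ‖(c k : ℂ) * φ (x k)‖ ≤ 2 * |c k| := by
    intro x hx
    rw [norm_mul, Complex.norm_real, Real.norm_eq_abs, hφn]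
    have : ‖x k‖ ≤ 2 := by nlinarith [norm_nonneg (x k)]
    nlinarith
  have hq0 : ∀ x : m × n → ℂ, ‖x k‖ ^ 2 ≤ 2 → ∀ i,
      ‖(W (Function.update x k 0) *ᵥ v) i‖ ≤ ‖(W x *ᵥ v) i‖ + 2 * L * |c k| * Φ2 x := by
    intro x hx i
    refine (norm_mulVec_le_of_perturb (hWL _) (hright x) v i).trans ?_
    have h2 := hΦ20 x
    calc _ ≤ ‖(W x *ᵥ v) i‖ + L * (2 * |c k|) * Φ2 x := by
          gcongr
          exact hζ x hx
      _ = _ := by ring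
  have d2 := integral_coord_mul_le_of_decoupling μ hμ hp
    (ψ := fun e : ℂ => 2 * ‖e‖ ^ 3 + 3 * ‖e‖) (by fun_prop) (C₁ := 5 * (1 + Mo))
    (C₂ := 1 + 4 * L * |c k|) (by positivity)
    (by
      have i3 := hμ.integral_pow_le (j := 3) (by omega)
      have i1 := hμ.integral_pow_le (j := 1) (by omega)
      have g1 := hμ.integrable_pow (j := 1) (by omega)
      simp only [pow_one] at i1 g1
      rw [integral_add ((hμ.integrable_pow (j := 3) (by omega)).const_mul 2)
        (g1.const_mul 3), integral_const_mul, integral_const_mul]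
      linarith)
    (hΦ2b.comp hup) hΦ2b (fun x => hΦ20 _) hΦ20 (by positivity)
    (indepOfCoord_update k Φ2)
    (fun x hx => by
      have ha := hq0 x hx a
      have hb := hq0 x hx b
      have : Φ2 x = ‖(W x *ᵥ v) a‖ + ‖(W x *ᵥ v) b‖ := rfl
      show ‖(W (Function.update x k 0) *ᵥ v) a‖ + ‖(W (Function.update x k 0) *ᵥ v) b‖ ≤ _
      linarith)
  have d1 := integral_coord_mul_le_of_decoupling μ hμ hp
    (ψ := fun e : ℂ => ‖e‖ ^ 2) (by fun_prop) (C₁ := 1) (C₂ := 1) zero_le_one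
    hμ.variance_one.le (hΦ1b.comp hup)
    (hΦ1b.add ((BddMeas.const (6 * L ^ 2 * |c k|)).mul hΦ2b))
    (fun x => hΦ10 _) (fun x => add_nonneg (hΦ10 x) (mul_nonneg (by positivity) (hΦ20 x)))
    zero_le_one (indepOfCoord_update k Φ1)
    (fun x hx => by
      have hb := hq0 x hx b
      have hba : ‖W (Function.update x k 0) b a‖ ≤ ‖W x b a‖ + 4 * L ^ 2 * |c k| := by
        have h1 := norm_mulVec_le_of_perturb (hWL _) (hright x) (Pi.single a 1) b
        simp only [Matrix.mulVec_single_one, Matrix.col_apply] at h1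
        refine h1.trans ?_
        have h3 : ‖W x a a‖ + ‖W x b a‖ ≤ 2 * L := by linarith [hWL x a a, hWL x b a]
        calc _ ≤ ‖W x b a‖ + L * (2 * |c k|) * (2 * L) := by
              gcongr
              exact hζ x hx
          _ = _ := by ring
      have hLb := hWL (Function.update x k 0) b a
      have hq2 : ‖(W x *ᵥ v) b‖ ≤ Φ2 x := le_add_of_nonneg_left (norm_nonneg _)
      have hΦ2x := hΦ20 x
      rw [one_mul]
      show ‖W (Function.update x k 0) b a‖ * ‖(W (Function.update x k 0) *ᵥ v) b‖
        ≤ ‖W x b a‖ * ‖(W x *ᵥ v) b‖ + 6 * L ^ 2 * |c k| * Φ2 x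
      calc _ ≤ ‖W (Function.update x k 0) b a‖ * (‖(W x *ᵥ v) b‖ + 2 * L * |c k| * Φ2 x) := by
            gcongr
        _ = ‖W (Function.update x k 0) b a‖ * ‖(W x *ᵥ v) b‖
            + ‖W (Function.update x k 0) b a‖ * (2 * L * |c k| * Φ2 x) := by ring
        _ ≤ (‖W x b a‖ + 4 * L ^ 2 * |c k|) * ‖(W x *ᵥ v) b‖ + L * (2 * L * |c k| * Φ2 x) := by
            gcongr
        _ = ‖W x b a‖ * ‖(W x *ᵥ v) b‖ + 4 * L ^ 2 * |c k| * ‖(W x *ᵥ v) b‖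
            + 2 * L ^ 2 * |c k| * Φ2 x := by ring
        _ ≤ ‖W x b a‖ * ‖(W x *ᵥ v) b‖ + 4 * L ^ 2 * |c k| * Φ2 x
            + 2 * L ^ 2 * |c k| * Φ2 x := by gcongr
        _ = _ := by ring)
  rw [integral_add (hΦ1b.integrable _) (((BddMeas.const _).mul hΦ2b).integrable _),
    integral_const_mul] at d1
  have h1 := mul_le_mul_of_nonneg_left d1 (sq_nonneg (c k))
  have h2 := mul_le_mul_of_nonneg_left d2 (by positivity : 0 ≤ |c k| ^ 3 * L ^ 2)
  refine (add_le_add h1 h2).trans (le_of_eq ?_)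
  rw [← sq_abs (c k)]
  ring

end Bias

section SumBounds

variable {α β : Type*} [Fintype α] [Fintype β]

lemma sum_le_sqrt_card_mul (g : β → ℝ) :
    ∑ b, g b ≤ √(Fintype.card β) * √(∑ b, g b ^ 2) := by
  have := Real.sum_mul_le_sqrt_mul_sqrt Finset.univ (fun _ : β => (1 : ℝ)) g
  simpa using this

lemma sum_sum_mul_le {f : α → ℝ} {g : β → ℝ} {w : β → α → ℝ} {F G L ρ : ℝ}
    (hg0 : ∀ b, 0 ≤ g b) (hF : √(∑ a, f a ^ 2) ≤ F) (hG : √(∑ b, g b ^ 2) ≤ G) (hL : 0 ≤ L)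
    (hw : ∀ b, ∑ a, w b a ^ 2 ≤ L ^ 2) (hρ : (Fintype.card β : ℝ) ≤ ρ) :
    ∑ b, ∑ a, f a * (w b a * g b) ≤ L * √ρ * (F * G) := by
  have hF0 : 0 ≤ F := (Real.sqrt_nonneg _).trans hF
  have hG0 : 0 ≤ G := (Real.sqrt_nonneg _).trans hG
  have h1 : ∀ b, ∑ a, f a * (w b a * g b) ≤ F * L * g b := by
    intro b
    have h2 := Real.sum_mul_le_sqrt_mul_sqrt Finset.univ f (w b)
    have h3 : √(∑ a, w b a ^ 2) ≤ L := Real.sqrt_le_iff.2 ⟨hL, hw b⟩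
    have h4 : ∑ a, f a * (w b a * g b) = (∑ a, f a * w b a) * g b := by
      rw [Finset.sum_mul]; exact Finset.sum_congr rfl fun a _ => by ring
    rw [h4]
    refine mul_le_mul_of_nonneg_right (h2.trans ?_) (hg0 b)
    exact mul_le_mul hF h3 (Real.sqrt_nonneg _) hF0
  calc _ ≤ ∑ b, F * L * g b := Finset.sum_le_sum fun b _ => h1 b
    _ = F * L * ∑ b, g b := by rw [Finset.mul_sum]
    _ ≤ F * L * (√ρ * G) := by
        refine mul_le_mul_of_nonneg_left ((sum_le_sqrt_card_mul g).trans ?_) (by positivity)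
        exact mul_le_mul (Real.sqrt_le_sqrt hρ) hG (Real.sqrt_nonneg _) (Real.sqrt_nonneg _)
    _ = _ := by ring

lemma sum_sum_mul_add_le {f g₁ : α → ℝ} {g₂ : β → ℝ} {F G ρ : ℝ} (hg₂0 : ∀ b, 0 ≤ g₂ b)
    (hF : √(∑ a, f a ^ 2) ≤ F) (hG₁ : √(∑ a, g₁ a ^ 2) ≤ G)
    (hG₂ : √(∑ b, g₂ b ^ 2) ≤ G) (hρα : (Fintype.card α : ℝ) ≤ ρ)
    (hρβ : (Fintype.card β : ℝ) ≤ ρ) :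
    ∑ b, ∑ a, f a * (g₁ a + g₂ b) ≤ 2 * ρ * (F * G) := by
  have hF0 : 0 ≤ F := (Real.sqrt_nonneg _).trans hF
  have hG0 : 0 ≤ G := (Real.sqrt_nonneg _).trans hG₁
  have hρ0 : 0 ≤ ρ := le_trans (Nat.cast_nonneg _) hρα
  have h1 : ∑ a, f a * g₁ a ≤ F * G :=
    (Real.sum_mul_le_sqrt_mul_sqrt Finset.univ f g₁).trans
      (mul_le_mul hF hG₁ (Real.sqrt_nonneg _) hF0)
  have h2 : ∑ a, f a ≤ √ρ * F := (sum_le_sqrt_card_mul f).trans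
    (mul_le_mul (Real.sqrt_le_sqrt hρα) hF (Real.sqrt_nonneg _) (Real.sqrt_nonneg _))
  have h3 : ∑ b, g₂ b ≤ √ρ * G := (sum_le_sqrt_card_mul g₂).trans
    (mul_le_mul (Real.sqrt_le_sqrt hρβ) hG₂ (Real.sqrt_nonneg _) (Real.sqrt_nonneg _))
  have h4 : ∑ b, ∑ a, f a * (g₁ a + g₂ b)
      = Fintype.card β * (∑ a, f a * g₁ a) + (∑ a, f a) * ∑ b, g₂ b := by
    simp only [mul_add, Finset.sum_add_distrib, Finset.sum_const, Finset.card_univ,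
      nsmul_eq_mul, ← Finset.sum_mul, ← Finset.mul_sum]
  rw [h4]
  calc _ ≤ ρ * (F * G) + (√ρ * F) * (√ρ * G) := by
        refine add_le_add ((mul_le_mul_of_nonneg_left h1 (Nat.cast_nonneg _)).trans
          (mul_le_mul_of_nonneg_right hρβ (by positivity))) ?_
        exact mul_le_mul h2 h3 (Finset.sum_nonneg fun b _ => hg₂0 b) (by positivity)
    _ = ρ * (F * G) + (√ρ * √ρ) * (F * G) := by ring
    _ = _ := by rw [Real.mul_self_sqrt hρ0]; ring

end SumBounds

section EntrySums

variable {m n : Type*} [Fintype m] [DecidableEq m] [Fintype n] [DecidableEq n] {y q : m ⊕ n → ℂ}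
  (W : Matrix (m ⊕ n) (m ⊕ n) ℂ) {L Y V ρ : ℝ}

lemma sqrt_sum_inl_le (h : √(normSq2 y) ≤ Y) : √(∑ i, ‖y (Sum.inl i)‖ ^ 2) ≤ Y := by
  refine le_trans (Real.sqrt_le_sqrt ?_) h
  rw [normSq2_sum_elim]
  exact le_add_of_nonneg_right (Finset.sum_nonneg fun _ _ => by positivity)

lemma sqrt_sum_inr_le (h : √(normSq2 y) ≤ Y) : √(∑ j, ‖y (Sum.inr j)‖ ^ 2) ≤ Y := by
  refine le_trans (Real.sqrt_le_sqrt ?_) h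
  rw [normSq2_sum_elim]
  exact le_add_of_nonneg_left (Finset.sum_nonneg fun _ _ => by positivity)

lemma weighted_sum_inl_le (hL : 0 ≤ L) (hy : √(normSq2 y) ≤ Y) (hq : √(normSq2 q) ≤ V)
    (hW : ∀ i, ∑ j, ‖W i j‖ ^ 2 ≤ L ^ 2) (hρ : (Fintype.card n : ℝ) ≤ ρ) :
    ∑ k : m × n, ‖y (Sum.inl k.1)‖ * (‖W (Sum.inr k.2) (Sum.inl k.1)‖ * ‖q (Sum.inr k.2)‖)
      ≤ L * √ρ * (Y * V) := by
  have hrow : ∀ j, ∑ i : m, ‖W (Sum.inr j) (Sum.inl i)‖ ^ 2 ≤ L ^ 2 := by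
    intro j
    have := hW (Sum.inr j)
    rw [Fintype.sum_sum_type] at this
    exact le_trans (le_add_of_nonneg_right (Finset.sum_nonneg fun _ _ => by positivity)) this
  rw [Fintype.sum_prod_type_right]
  exact sum_sum_mul_le (f := fun i => ‖y (Sum.inl i)‖) (g := fun j => ‖q (Sum.inr j)‖)
    (w := fun j i => ‖W (Sum.inr j) (Sum.inl i)‖)
    (fun b => norm_nonneg _) (sqrt_sum_inl_le hy) (sqrt_sum_inr_le hq) hL hrow hρ

lemma weighted_sum_inr_le (hL : 0 ≤ L) (hy : √(normSq2 y) ≤ Y) (hq : √(normSq2 q) ≤ V)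
    (hW : ∀ i, ∑ j, ‖W i j‖ ^ 2 ≤ L ^ 2) (hρ : (Fintype.card m : ℝ) ≤ ρ) :
    ∑ k : m × n, ‖y (Sum.inr k.2)‖ * (‖W (Sum.inl k.1) (Sum.inr k.2)‖ * ‖q (Sum.inl k.1)‖)
      ≤ L * √ρ * (Y * V) := by
  have hrow : ∀ i, ∑ j : n, ‖W (Sum.inl i) (Sum.inr j)‖ ^ 2 ≤ L ^ 2 := by
    intro i
    have := hW (Sum.inl i)
    rw [Fintype.sum_sum_type] at this
    exact le_trans (le_add_of_nonneg_left (Finset.sum_nonneg fun _ _ => by positivity)) this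
  rw [Fintype.sum_prod_type]
  exact sum_sum_mul_le (f := fun j => ‖y (Sum.inr j)‖) (g := fun i => ‖q (Sum.inl i)‖)
    (w := fun i j => ‖W (Sum.inl i) (Sum.inr j)‖)
    (fun b => norm_nonneg _) (sqrt_sum_inr_le hy) (sqrt_sum_inl_le hq) hL hrow hρ

lemma weighted_sum_add_inl_le (hy : √(normSq2 y) ≤ Y) (hq : √(normSq2 q) ≤ V)
    (hρm : (Fintype.card m : ℝ) ≤ ρ) (hρn : (Fintype.card n : ℝ) ≤ ρ) :
    ∑ k : m × n, ‖y (Sum.inl k.1)‖ * (‖q (Sum.inl k.1)‖ + ‖q (Sum.inr k.2)‖)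
      ≤ 2 * ρ * (Y * V) := by
  rw [Fintype.sum_prod_type_right]
  exact sum_sum_mul_add_le (f := fun i => ‖y (Sum.inl i)‖) (g₁ := fun i => ‖q (Sum.inl i)‖)
    (g₂ := fun j => ‖q (Sum.inr j)‖) (fun b => norm_nonneg _) (sqrt_sum_inl_le hy)
    (sqrt_sum_inl_le hq) (sqrt_sum_inr_le hq) hρm hρn

lemma weighted_sum_add_inr_le (hy : √(normSq2 y) ≤ Y) (hq : √(normSq2 q) ≤ V)
    (hρm : (Fintype.card m : ℝ) ≤ ρ) (hρn : (Fintype.card n : ℝ) ≤ ρ) :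
    ∑ k : m × n, ‖y (Sum.inr k.2)‖ * (‖q (Sum.inr k.2)‖ + ‖q (Sum.inl k.1)‖)
      ≤ 2 * ρ * (Y * V) := by
  rw [Fintype.sum_prod_type]
  exact sum_sum_mul_add_le (f := fun j => ‖y (Sum.inr j)‖) (g₁ := fun j => ‖q (Sum.inr j)‖)
    (g₂ := fun i => ‖q (Sum.inl i)‖) (fun b => norm_nonneg _) (sqrt_sum_inr_le hy)
    (sqrt_sum_inr_le hq) (sqrt_sum_inl_le hq) hρn hρm

end EntrySums

section BiasForm

open MeasureTheory

variable {m n : Type*} [Fintype m] [DecidableEq m] [Fintype n] [DecidableEq n]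
  {c : m × n → ℝ} (A : Matrix m n ℂ) {s : ℂ}

/-- The self-energy: the diagonal of `-𝔼[𝒳 W 𝒳]` for the noise `𝒳 = skewBlock (weighted c x)`. -/
def selfEnergy (c : m × n → ℝ) (W : Matrix (m ⊕ n) (m ⊕ n) ℂ) : m ⊕ n → ℂ :=
  Sum.elim (fun i => ∑ j, ((c (i, j) ^ 2 : ℝ) : ℂ) * W (Sum.inr j) (Sum.inr j))
    (fun j => ∑ i, ((c (i, j) ^ 2 : ℝ) : ℂ) * W (Sum.inl i) (Sum.inl i))

lemma dotProduct_skewBlock_sub_selfEnergy (c : m × n → ℝ) (x : m × n → ℂ)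
    (W : Matrix (m ⊕ n) (m ⊕ n) ℂ) (y q : m ⊕ n → ℂ) :
    y ⬝ᵥ (skewBlock (weighted c x) *ᵥ q) - y ⬝ᵥ (Matrix.diagonal (selfEnergy c W) *ᵥ q)
      = ∑ k : m × n, (y (Sum.inl k.1) * (c k * x k * q (Sum.inr k.2)
          - (c k ^ 2 : ℝ) * (W (Sum.inr k.2) (Sum.inr k.2) * q (Sum.inl k.1)))
        + y (Sum.inr k.2) * (c k * (-star (x k)) * q (Sum.inl k.1)
          - (c k ^ 2 : ℝ) * (W (Sum.inl k.1) (Sum.inl k.1) * q (Sum.inr k.2)))) := by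
  have h1 : ∀ i, (skewBlock (weighted c x) *ᵥ q) (Sum.inl i)
      = ∑ j, (c (i, j) : ℂ) * x (i, j) * q (Sum.inr j) := by
    intro i
    simp [Matrix.mulVec, dotProduct, skewBlock, weighted]
  have h2 : ∀ j, (skewBlock (weighted c x) *ᵥ q) (Sum.inr j)
      = ∑ i, (c (i, j) : ℂ) * (-star (x (i, j))) * q (Sum.inl i) := by
    intro j
    simp [Matrix.mulVec, dotProduct, skewBlock, weighted]
  have h3 : ∀ i, (Matrix.diagonal (selfEnergy c W) *ᵥ q) (Sum.inl i)
      = ∑ j, (c (i, j) ^ 2 : ℝ) * (W (Sum.inr j) (Sum.inr j) * q (Sum.inl i)) := by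
    intro i
    rw [Matrix.mulVec_diagonal]
    simp only [selfEnergy, Sum.elim_inl, Finset.sum_mul, mul_assoc]
  have h4 : ∀ j, (Matrix.diagonal (selfEnergy c W) *ᵥ q) (Sum.inr j)
      = ∑ i, (c (i, j) ^ 2 : ℝ) * (W (Sum.inl i) (Sum.inl i) * q (Sum.inr j)) := by
    intro j
    rw [Matrix.mulVec_diagonal]
    simp only [selfEnergy, Sum.elim_inr, Finset.sum_mul, mul_assoc]
  rw [← dotProduct_sub, dotProduct, Fintype.sum_sum_type, Finset.sum_add_distrib,
    Fintype.sum_prod_type, Fintype.sum_prod_type_right]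
  simp only [Pi.sub_apply, h1, h2, h3, h4, ← Finset.sum_sub_distrib, Finset.mul_sum]

/-- The constant in `norm_integral_defect_le`. -/
def defectConst (Mo κ R L : ℝ) : ℝ :=
  4 * κ * √R * L ^ 2 + 4 * κ * √κ * R * L * (L ^ 2 * (12 + 10 * (1 + Mo) * (1 + 4 * L * √κ)))

variable (μ : m × n → Measure ℂ) [∀ k, IsProbabilityMeasure (μ k)]

lemma rankTwo_symm {I : Type*} [DecidableEq I] (a b : I) (r : ℝ) (e : ℂ) :
    rankTwo a b (r * e) = rankTwo b a (r * (-star e)) := by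
  simp only [rankTwo, star_mul', star_neg, RCLike.star_def, Complex.conj_ofReal,
    Complex.conj_conj, mul_neg, ← Matrix.single_neg]
  abel

/-- The resolvent approximately satisfies the self-consistent equation, in mean. -/
theorem norm_integral_defect_le {p : ℕ} {Mo κ ν R : ℝ} (hs : 0 < s.re) (hp : 1 ≤ p)
    (hν : 1 ≤ ν) (hκ : 0 ≤ κ) (hc : ∀ k, c k ^ 2 ≤ κ / ν)
    (hR : (Fintype.card m + Fintype.card n : ℝ) ≤ R * ν)
    (hμ : ∀ k, EntryLaw p Mo (μ k)) (hMo : 0 ≤ Mo) (y v : m ⊕ n → ℂ) :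
    Integrable (fun x => y ⬝ᵥ (skewBlock (weighted c x) *ᵥ (linRes c A s x *ᵥ v))
        - y ⬝ᵥ (Matrix.diagonal (selfEnergy c (linRes c A s x)) *ᵥ (linRes c A s x *ᵥ v)))
      (Measure.pi μ) ∧
    ‖∫ x, (y ⬝ᵥ (skewBlock (weighted c x) *ᵥ (linRes c A s x *ᵥ v))
        - y ⬝ᵥ (Matrix.diagonal (selfEnergy c (linRes c A s x)) *ᵥ (linRes c A s x *ᵥ v)))
        ∂(Measure.pi μ)‖
      ≤ defectConst Mo κ R (1 / s.re) / √ν * (√(normSq2 y) * √(normSq2 v)) := by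
  have hν0 : 0 < ν := by linarith
  have hR0 : 0 ≤ R := by
    have h0 : 0 ≤ R * ν := le_trans (by positivity) hR
    exact nonneg_of_mul_nonneg_left h0 hν0
  have hcm : (Fintype.card m : ℝ) ≤ R * ν :=
    le_trans (le_add_of_nonneg_right (Nat.cast_nonneg _)) hR
  have hcn : (Fintype.card n : ℝ) ≤ R * ν :=
    le_trans (le_add_of_nonneg_left (Nat.cast_nonneg _)) hR
  set L := 1 / s.re with hLdef
  have hL0 : 0 < L := by positivity
  set W : (m × n → ℂ) → Matrix (m ⊕ n) (m ⊕ n) ℂ := fun x => linRes c A s x with hW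
  have hacc : ∀ x, Accretive s.re (linMat c A s x) := fun x => linMat_accretive c A x
  have hWb : ∀ i j, BddMeas fun x => W x i j := fun i j => bddMeas_linRes_apply c A hs i j
  have hqb : ∀ i, BddMeas fun x => (W x *ᵥ v) i := fun i => bddMeas_linRes_mulVec c A hs v i
  set τ := √(κ / ν) with hτ
  have hτ0 : 0 ≤ τ := Real.sqrt_nonneg _
  have hcτ : ∀ k, |c k| ≤ τ := fun k => Real.abs_le_sqrt (hc k)
  have hτsq : τ ^ 2 = κ / ν := Real.sq_sqrt (by positivity)
  have hτκ : τ ≤ √κ := Real.sqrt_le_sqrt (div_le_self hκ hν)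
  set H := L ^ 2 * (12 + 10 * (1 + Mo) * (1 + 4 * L * √κ)) with hH
  have hH0 : 0 ≤ H := by positivity
  have entry : ∀ (k : m × n) (φ : ℂ → ℂ) (a b : m ⊕ n), Measurable φ → (∀ e, ‖φ e‖ = ‖e‖) →
      ∫ e, φ e ∂(μ k) = 0 → (∀ e, rankTwo (Sum.inl k.1) (Sum.inr k.2) (c k * e)
        = (rankTwo a b (c k * φ e) : Matrix (m ⊕ n) (m ⊕ n) ℂ)) →
      ‖∫ x, (c k * φ (x k) * (W x *ᵥ v) b
        - (c k ^ 2 : ℝ) * (W x b b * (W x *ᵥ v) a)) ∂(Measure.pi μ)‖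
      ≤ 2 * τ ^ 2 * ∫ x, ‖W x b a‖ * ‖(W x *ᵥ v) b‖ ∂(Measure.pi μ)
        + τ ^ 3 * H * ∫ x, (‖(W x *ᵥ v) a‖ + ‖(W x *ᵥ v) b‖) ∂(Measure.pi μ) := by
    intro k φ a b hφm hφn hφ0 hE
    refine (norm_integral_entry_le A μ hs hp (hμ k) hφm hφn hφ0 hE v).2.trans ?_
    have i1 : 0 ≤ ∫ x, ‖W x b a‖ * ‖(W x *ᵥ v) b‖ ∂(Measure.pi μ) :=
      integral_nonneg fun x => by positivity
    have i2 : 0 ≤ ∫ x, (‖(W x *ᵥ v) a‖ + ‖(W x *ᵥ v) b‖) ∂(Measure.pi μ) :=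
      integral_nonneg fun x => by positivity
    have hck := hcτ k
    have hck0 := abs_nonneg (c k)
    rw [← sq_abs (c k)]
    gcongr
    rw [hH]
    gcongr
    exact hck.trans hτκ
  have hconj0 : ∀ k, ∫ e, -star e ∂(μ k) = 0 := by
    intro k
    rw [integral_neg]
    have : ∫ e : ℂ, star e ∂(μ k) = star (∫ e : ℂ, e ∂(μ k)) := integral_conj
    rw [this, (hμ k).mean_zero]; simp
  have e1 : ∀ k : m × n, _ := fun k => entry k (fun e => e) (Sum.inl k.1) (Sum.inr k.2)
    measurable_id (fun _ => rfl) (hμ k).mean_zero (fun _ => rfl)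
  have e2 : ∀ k : m × n, _ := fun k => entry k (fun e => -star e) (Sum.inr k.2) (Sum.inl k.1)
    (by fun_prop) (fun _ => by simp) (hconj0 k) (fun e => rankTwo_symm _ _ _ _)
  have g1 : ∀ k : m × n, _ := fun k => (norm_integral_entry_le (c := c) A μ hs hp (hμ k)
    (φ := fun e => e) (a := Sum.inl k.1) (b := Sum.inr k.2)
    measurable_id (fun _ => rfl) (hμ k).mean_zero (fun _ => rfl) v).1
  have g2 : ∀ k : m × n, _ := fun k => (norm_integral_entry_le (c := c) A μ hs hp (hμ k)
    (φ := fun e => -star e) (a := Sum.inr k.2) (b := Sum.inl k.1)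
    (by fun_prop) (fun _ => by simp) (hconj0 k) (fun e => rankTwo_symm _ _ _ _) v).1
  simp only [dotProduct_skewBlock_sub_selfEnergy]
  have gsum : ∀ k : m × n, _ := fun k =>
    ((g1 k).const_mul (y (Sum.inl k.1))).add ((g2 k).const_mul (y (Sum.inr k.2)))
  refine ⟨integrable_finsetSum _ fun k _ => gsum k, ?_⟩
  rw [integral_finsetSum]
  swap
  · exact fun k _ => gsum k
  set Y := √(normSq2 y) with hY
  set V := √(normSq2 v) with hV
  have hY0 : 0 ≤ Y := Real.sqrt_nonneg _
  have hV0 : 0 ≤ V := Real.sqrt_nonneg _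
  have hqq : ∀ x, √(normSq2 (W x *ᵥ v)) ≤ L * V := by
    intro x
    have := Real.sqrt_le_sqrt ((hacc x).normSq2_inv_mulVec_le hs v)
    rwa [Real.sqrt_mul (by positivity), Real.sqrt_sq hL0.le] at this
  have hrows : ∀ x i, ∑ j, ‖W x i j‖ ^ 2 ≤ L ^ 2 := fun x i => (hacc x).sum_row_inv_le hs i
  have s1 := fun x => weighted_sum_inl_le (W x) hL0.le (le_refl Y) (hqq x) (hrows x) hcn
  have s2 := fun x => weighted_sum_inr_le (W x) hL0.le (le_refl Y) (hqq x) (hrows x) hcm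
  have s3 := fun x => weighted_sum_add_inl_le (le_refl Y) (hqq x) hcm hcn
  have s4 := fun x => weighted_sum_add_inr_le (le_refl Y) (hqq x) hcm hcn
  have fold : ∀ (w : m × n → ℝ) (Φ : m × n → (m × n → ℂ) → ℝ) (C : ℝ), (∀ k, BddMeas (Φ k)) →
      (∀ x, ∑ k, w k * Φ k x ≤ C) → ∑ k, w k * ∫ x, Φ k x ∂(Measure.pi μ) ≤ C := by
    intro w Φ C hΦ hC
    simp only [← integral_const_mul]
    rw [← integral_finsetSum _ fun k _ => ((hΦ k).integrable _).const_mul _]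
    calc _ ≤ ∫ _, C ∂(Measure.pi μ) :=
          integral_mono (integrable_finsetSum _ fun k _ => ((hΦ k).integrable _).const_mul _)
            (integrable_const _) hC
      _ = C := by simp
  have f1 := fold (fun k => ‖y (Sum.inl k.1)‖) _ _
    (fun k => (hWb (Sum.inr k.2) (Sum.inl k.1)).norm.mul (hqb (Sum.inr k.2)).norm) s1
  have f2 := fold (fun k => ‖y (Sum.inr k.2)‖) _ _
    (fun k => (hWb (Sum.inl k.1) (Sum.inr k.2)).norm.mul (hqb (Sum.inl k.1)).norm) s2
  have f3 := fold (fun k => ‖y (Sum.inl k.1)‖) _ _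
    (fun k => (hqb (Sum.inl k.1)).norm.add (hqb (Sum.inr k.2)).norm) s3
  have f4 := fold (fun k => ‖y (Sum.inr k.2)‖) _ _
    (fun k => (hqb (Sum.inr k.2)).norm.add (hqb (Sum.inl k.1)).norm) s4
  have hterm : ∀ k ∈ (Finset.univ : Finset (m × n)),
      ‖∫ x, (y (Sum.inl k.1) * (c k * x k * (W x *ᵥ v) (Sum.inr k.2)
          - (c k ^ 2 : ℝ) * (W x (Sum.inr k.2) (Sum.inr k.2) * (W x *ᵥ v) (Sum.inl k.1)))
        + y (Sum.inr k.2) * (c k * (-star (x k)) * (W x *ᵥ v) (Sum.inl k.1)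
          - (c k ^ 2 : ℝ) * (W x (Sum.inl k.1) (Sum.inl k.1) * (W x *ᵥ v) (Sum.inr k.2))))
        ∂(Measure.pi μ)‖
      ≤ ‖y (Sum.inl k.1)‖ * (2 * τ ^ 2 * ∫ x, ‖W x (Sum.inr k.2) (Sum.inl k.1)‖
          * ‖(W x *ᵥ v) (Sum.inr k.2)‖ ∂(Measure.pi μ) + τ ^ 3 * H *
          ∫ x, (‖(W x *ᵥ v) (Sum.inl k.1)‖ + ‖(W x *ᵥ v) (Sum.inr k.2)‖) ∂(Measure.pi μ))
        + ‖y (Sum.inr k.2)‖ * (2 * τ ^ 2 * ∫ x, ‖W x (Sum.inl k.1) (Sum.inr k.2)‖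
          * ‖(W x *ᵥ v) (Sum.inl k.1)‖ ∂(Measure.pi μ) + τ ^ 3 * H *
          ∫ x, (‖(W x *ᵥ v) (Sum.inr k.2)‖ + ‖(W x *ᵥ v) (Sum.inl k.1)‖) ∂(Measure.pi μ)) := by
    intro k _
    rw [integral_add ((g1 k).const_mul (y (Sum.inl k.1))) ((g2 k).const_mul (y (Sum.inr k.2))),
      integral_const_mul, integral_const_mul]
    refine (norm_add_le _ _).trans ?_
    rw [norm_mul, norm_mul]
    exact add_le_add (mul_le_mul_of_nonneg_left (e1 k) (norm_nonneg _))
      (mul_le_mul_of_nonneg_left (e2 k) (norm_nonneg _))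
  refine (norm_sum_le _ _).trans ((Finset.sum_le_sum hterm).trans ?_)
  have hlin : ∀ (a b F₁ F₂ F₃ F₄ : m × n → ℝ) (t h : ℝ),
      ∑ k, (a k * (t * F₁ k + h * F₃ k) + b k * (t * F₂ k + h * F₄ k))
        = t * ∑ k, a k * F₁ k + h * ∑ k, a k * F₃ k
          + (t * ∑ k, b k * F₂ k + h * ∑ k, b k * F₄ k) := by
    intro a b F₁ F₂ F₃ F₄ t h
    simp only [Finset.mul_sum, ← Finset.sum_add_distrib]
    exact Finset.sum_congr rfl fun k _ => by ring
  refine (hlin _ _ _ _ _ _ _ _).le.trans ?_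
  have hfin : 2 * τ ^ 2 * (L * √(R * ν) * (Y * (L * V))) + τ ^ 3 * H * (2 * (R * ν) * (Y * (L * V)))
      + (2 * τ ^ 2 * (L * √(R * ν) * (Y * (L * V))) + τ ^ 3 * H * (2 * (R * ν) * (Y * (L * V))))
      = defectConst Mo κ R L / √ν * (Y * V) := by
    have hsν : √ν ≠ 0 := (Real.sqrt_pos.2 hν0).ne'
    have hτe : τ = √κ / √ν := Real.sqrt_div hκ ν
    have h1 : √(R * ν) = √R * √ν := Real.sqrt_mul hR0 ν
    have h2 : √ν ^ 2 = ν := Real.sq_sqrt hν0.le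
    have h3 : √κ ^ 2 = κ := Real.sq_sqrt hκ
    have h4 : τ ^ 3 * ν = κ * √κ / √ν := by
      rw [hτe, ← h2]
      field_simp
      rw [← h3]; simp [pow_succ]; ring
    have h5 : τ ^ 2 * √(R * ν) = κ * √R / √ν := by
      rw [h1, hτsq, ← h2]
      field_simp
      simp; ring
    unfold defectConst
    rw [← hH]
    calc _ = 4 * (τ ^ 2 * √(R * ν)) * L * (Y * (L * V))
          + 4 * (τ ^ 3 * ν) * H * R * (Y * (L * V)) := by ring
      _ = _ := by rw [h4, h5]; ring
  rw [← hfin]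
  have hτ2 : 0 ≤ 2 * τ ^ 2 := by positivity
  have hτ3 : 0 ≤ τ ^ 3 * H := by positivity
  exact add_le_add
    (add_le_add (mul_le_mul_of_nonneg_left f1 hτ2) (mul_le_mul_of_nonneg_left f3 hτ3))
    (add_le_add (mul_le_mul_of_nonneg_left f2 hτ2) (mul_le_mul_of_nonneg_left f4 hτ3))

end BiasForm

section Stability

variable {I κ : Type*} [Fintype I] [DecidableEq I] [Fintype κ]

/-- The normalized weighted trace `ν⁻¹ ∑ g i * W i i`. -/
def wtr (ν : ℝ) (g : I → ℝ) (W : Matrix I I ℂ) : ℂ := (ν : ℂ)⁻¹ * ∑ i, (g i : ℂ) * W i i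

/-- The diagonal `s + ∑ b, x b * f b`. -/
def shiftDiag (f : κ → I → ℝ) (s : ℂ) (x : κ → ℂ) (k : I) : ℂ := s + ∑ b, x b * (f b k : ℂ)

/-- The inverse of `diagonal (shiftDiag f s x) + K`. -/
def shiftRes (f : κ → I → ℝ) (K : Matrix I I ℂ) (s : ℂ) (x : κ → ℂ) : Matrix I I ℂ :=
  (Matrix.diagonal (shiftDiag f s x) + K)⁻¹

variable {f : κ → I → ℝ} {K : Matrix I I ℂ} {s : ℂ} {x y : κ → ℂ} {ν : ℝ} {g : I → ℝ}

lemma shiftDiag_re (k : I) : (shiftDiag f s x k).re = s.re + ∑ b, (x b).re * f b k := by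
  simp [shiftDiag]

lemma norm_wtr_le (hν : 0 < ν) (hg : ∀ i, 0 ≤ g i) {W : Matrix I I ℂ} {L : ℝ}
    (hW : ∀ i, ‖W i i‖ ≤ L) : ‖wtr ν g W‖ ≤ ν⁻¹ * (∑ i, g i) * L := by
  rw [wtr, norm_mul, norm_inv, Complex.norm_real, Real.norm_of_nonneg hν.le, mul_assoc,
    Finset.sum_mul]
  refine mul_le_mul_of_nonneg_left ((norm_sum_le _ _).trans (Finset.sum_le_sum fun i _ => ?_))
    (by positivity)
  rw [norm_mul, Complex.norm_real, Real.norm_of_nonneg (hg i)]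
  exact mul_le_mul_of_nonneg_left (hW i) (hg i)

lemma wtr_re (W : Matrix I I ℂ) : (wtr ν g W).re = ν⁻¹ * ∑ i, g i * (W i i).re := by
  rw [wtr, ← Complex.ofReal_inv, Complex.re_ofReal_mul]
  simp

lemma shift_accretive (hK : Kᴴ = -K) (hf : ∀ b k, 0 ≤ f b k) (hx : ∀ b, 0 ≤ (x b).re) :
    Accretive s.re (Matrix.diagonal (shiftDiag f s x) + K) := by
  refine accretive_diagonal_add hK fun k => ?_
  rw [shiftDiag_re]
  exact le_add_of_nonneg_right (Finset.sum_nonneg fun b _ => mul_nonneg (hx b) (hf b k))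

lemma wtr_re_row (hs : 0 < s.re) (hK : Kᴴ = -K) (hf : ∀ b k, 0 ≤ f b k)
    (hx : ∀ b, 0 ≤ (x b).re) :
    (wtr ν g (shiftRes f K s x)).re
      = s.re * (ν⁻¹ * ∑ i, g i * ∑ k, ‖shiftRes f K s x i k‖ ^ 2)
        + ν⁻¹ * ∑ i, g i * ∑ k, ‖shiftRes f K s x i k‖ ^ 2 * ∑ b, (x b).re * f b k := by
  have hW : shiftRes f K s x * (Matrix.diagonal (shiftDiag f s x) + K) = 1 :=
    (shift_accretive hK hf hx).inv_mul hs
  rw [wtr_re, mul_left_comm, ← mul_add]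
  congr 1
  rw [Finset.mul_sum, ← Finset.sum_add_distrib]
  refine Finset.sum_congr rfl fun i _ => ?_
  rw [re_inv_apply_row hK hW i, mul_left_comm, ← mul_add]
  congr 1
  rw [Finset.mul_sum, ← Finset.sum_add_distrib]
  refine Finset.sum_congr rfl fun k _ => ?_
  rw [shiftDiag_re]; ring

lemma wtr_re_col (hs : 0 < s.re) (hK : Kᴴ = -K) (hf : ∀ b k, 0 ≤ f b k)
    (hx : ∀ b, 0 ≤ (x b).re) :
    (wtr ν g (shiftRes f K s x)).re
      = s.re * (ν⁻¹ * ∑ i, g i * ∑ k, ‖shiftRes f K s x k i‖ ^ 2)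
        + ν⁻¹ * ∑ i, g i * ∑ k, ‖shiftRes f K s x k i‖ ^ 2 * ∑ b, (x b).re * f b k := by
  have hW : (Matrix.diagonal (shiftDiag f s x) + K) * shiftRes f K s x = 1 :=
    (shift_accretive hK hf hx).mul_inv hs
  rw [wtr_re, mul_left_comm, ← mul_add]
  congr 1
  rw [Finset.mul_sum, ← Finset.sum_add_distrib]
  refine Finset.sum_congr rfl fun i _ => ?_
  rw [re_inv_apply_col hK hW i, mul_left_comm, ← mul_add]
  congr 1
  rw [Finset.mul_sum, ← Finset.sum_add_distrib]
  refine Finset.sum_congr rfl fun k _ => ?_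
  rw [shiftDiag_re]; ring

lemma shiftRes_sub (hs : 0 < s.re) (hK : Kᴴ = -K) (hf : ∀ b k, 0 ≤ f b k)
    (hx : ∀ b, 0 ≤ (x b).re) (hy : ∀ b, 0 ≤ (y b).re) :
    shiftRes f K s x - shiftRes f K s y = shiftRes f K s x
      * Matrix.diagonal (fun k => ∑ b, (y b - x b) * (f b k : ℂ)) * shiftRes f K s y := by
  rw [shiftRes, shiftRes, inv_sub_inv_of_isUnit ((shift_accretive hK hf hx).isUnit hs)
    ((shift_accretive hK hf hy).isUnit hs)]
  congr 2
  rw [add_sub_add_right_eq_sub, Matrix.diagonal_sub]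
  congr 1
  funext k
  simp only [shiftDiag, sub_mul, Finset.sum_sub_distrib]
  ring

lemma sum_sqrt_mul_le (p p' φ : κ → ℝ) (hp : ∀ b, 0 ≤ p b) (hp' : ∀ b, 0 ≤ p' b)
    (hφ : ∀ b, 0 ≤ φ b) :
    ∑ b, √(p b * p' b) * φ b ≤ √(∑ b, p b * φ b) * √(∑ b, p' b * φ b) := by
  have h := Real.sum_sqrt_mul_sqrt_le Finset.univ (f := fun b => p b * φ b)
    (g := fun b => p' b * φ b) (fun b => mul_nonneg (hp b) (hφ b))
    (fun b => mul_nonneg (hp' b) (hφ b))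
  refine le_trans (le_of_eq (Finset.sum_congr rfl fun b _ => ?_)) h
  rw [Real.sqrt_mul (hp b), Real.sqrt_mul (hp b), Real.sqrt_mul (hp' b)]
  have := Real.mul_self_sqrt (hφ b)
  calc _ = √(p b) * √(p' b) * (√(φ b) * √(φ b)) := by rw [this]
    _ = _ := by ring

/-- Contraction estimate for the weighted traces. -/
lemma norm_wtr_sub_le (hs : 0 < s.re) (hK : Kᴴ = -K) (hf : ∀ b k, 0 ≤ f b k) (hν : 0 < ν)
    (hg : ∀ i, 0 ≤ g i) (hx : ∀ b, 0 ≤ (x b).re) (hy : ∀ b, 0 ≤ (y b).re) {t : ℝ} (ht : 0 ≤ t)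
    (hxy : ∀ b, ‖x b - y b‖ ≤ t * √((x b).re * (y b).re)) :
    ‖wtr ν g (shiftRes f K s x) - wtr ν g (shiftRes f K s y)‖
      ≤ t * (√(ν⁻¹ * ∑ i, g i * ∑ k, ‖shiftRes f K s x i k‖ ^ 2 * ∑ b, (x b).re * f b k)
        * √(ν⁻¹ * ∑ i, g i * ∑ k, ‖shiftRes f K s y k i‖ ^ 2 * ∑ b, (y b).re * f b k)) := by
  set W := shiftRes f K s x with hW
  set W' := shiftRes f K s y with hW'
  set φ : I → ℝ := fun k => ∑ b, (x b).re * f b k with hφ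
  set ψ : I → ℝ := fun k => ∑ b, (y b).re * f b k with hψ
  have hφ0 : ∀ k, 0 ≤ φ k := fun k => Finset.sum_nonneg fun b _ => mul_nonneg (hx b) (hf b k)
  have hψ0 : ∀ k, 0 ≤ ψ k := fun k => Finset.sum_nonneg fun b _ => mul_nonneg (hy b) (hf b k)
  have hdiff : ∀ i, ‖W i i - W' i i‖ ≤ t * ∑ k, ‖W i k‖ * ‖W' k i‖ * (√(φ k) * √(ψ k)) := by
    intro i
    have h1 := congrFun (congrFun (shiftRes_sub hs hK hf hx hy) i) i
    rw [Matrix.sub_apply, Matrix.mul_apply] at h1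
    rw [h1, Finset.mul_sum]
    refine (norm_sum_le _ _).trans (Finset.sum_le_sum fun k _ => ?_)
    rw [Matrix.mul_diagonal, norm_mul, norm_mul]
    have h2 : ‖∑ b, (y b - x b) * (f b k : ℂ)‖ ≤ t * (√(φ k) * √(ψ k)) := by
      calc _ ≤ ∑ b, t * (√((x b).re * (y b).re) * f b k) := by
            refine (norm_sum_le _ _).trans (Finset.sum_le_sum fun b _ => ?_)
            rw [norm_mul, Complex.norm_real, Real.norm_of_nonneg (hf b k), norm_sub_rev,
              ← mul_assoc]
            exact mul_le_mul_of_nonneg_right (hxy b) (hf b k)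
        _ ≤ _ := by
            rw [← Finset.mul_sum]
            exact mul_le_mul_of_nonneg_left
              (sum_sqrt_mul_le _ _ _ hx hy fun b => hf b k) ht
    calc _ ≤ ‖W i k‖ * (t * (√(φ k) * √(ψ k))) * ‖W' k i‖ := by gcongr
      _ = _ := by ring
  have hcs : ∑ i, g i * ∑ k, ‖W i k‖ * ‖W' k i‖ * (√(φ k) * √(ψ k))
      ≤ √(∑ i, g i * ∑ k, ‖W i k‖ ^ 2 * φ k) * √(∑ i, g i * ∑ k, ‖W' k i‖ ^ 2 * ψ k) := by
    simp only [Finset.mul_sum, ← Fintype.sum_prod_type']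
    have h := Real.sum_sqrt_mul_sqrt_le (Finset.univ : Finset (I × I))
      (f := fun q => g q.1 * (‖W q.1 q.2‖ ^ 2 * φ q.2))
      (g := fun q => g q.1 * (‖W' q.2 q.1‖ ^ 2 * ψ q.2))
      (fun q => mul_nonneg (hg _) (mul_nonneg (by positivity) (hφ0 _)))
      (fun q => mul_nonneg (hg _) (mul_nonneg (by positivity) (hψ0 _)))
    refine le_trans (le_of_eq (Finset.sum_congr rfl fun q _ => ?_)) h
    rw [Real.sqrt_mul (hg _), Real.sqrt_mul (hg _), Real.sqrt_mul (by positivity),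
      Real.sqrt_mul (by positivity), Real.sqrt_sq (norm_nonneg _), Real.sqrt_sq (norm_nonneg _)]
    have := Real.mul_self_sqrt (hg q.1)
    calc _ = (√(g q.1) * √(g q.1)) * (‖W q.1 q.2‖ * ‖W' q.2 q.1‖ * (√(φ q.2) * √(ψ q.2))) := by
          rw [this]
      _ = _ := by ring
  have hν' : (0 : ℝ) ≤ ν⁻¹ := by positivity
  calc ‖wtr ν g W - wtr ν g W'‖ = ν⁻¹ * ‖∑ i, (g i : ℂ) * (W i i - W' i i)‖ := by
        rw [wtr, wtr, ← mul_sub, norm_mul, norm_inv, Complex.norm_real, Real.norm_of_nonneg hν.le,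
          ← Finset.sum_sub_distrib]
        simp only [mul_sub]
    _ ≤ ν⁻¹ * ∑ i, g i * (t * ∑ k, ‖W i k‖ * ‖W' k i‖ * (√(φ k) * √(ψ k))) := by
        refine mul_le_mul_of_nonneg_left ((norm_sum_le _ _).trans
          (Finset.sum_le_sum fun i _ => ?_)) hν'
        rw [norm_mul, Complex.norm_real, Real.norm_of_nonneg (hg i)]
        exact mul_le_mul_of_nonneg_left (hdiff i) (hg i)
    _ = t * (ν⁻¹ * ∑ i, g i * ∑ k, ‖W i k‖ * ‖W' k i‖ * (√(φ k) * √(ψ k))) := by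
        rw [mul_left_comm t, Finset.mul_sum]
        rw [Finset.mul_sum, Finset.mul_sum]
        exact Finset.sum_congr rfl fun i _ => by ring
    _ ≤ t * (ν⁻¹ * (√(∑ i, g i * ∑ k, ‖W i k‖ ^ 2 * φ k)
        * √(∑ i, g i * ∑ k, ‖W' k i‖ ^ 2 * ψ k))) := by gcongr
    _ = _ := by
        rw [Real.sqrt_mul hν', Real.sqrt_mul hν']
        have := Real.mul_self_sqrt hν'
        calc _ = t * ((√ν⁻¹ * √ν⁻¹) * (√(∑ i, g i * ∑ k, ‖W i k‖ ^ 2 * φ k)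
              * √(∑ i, g i * ∑ k, ‖W' k i‖ ^ 2 * ψ k))) := by rw [this]
          _ = _ := by ring

/-- Two approximate fixed points of the map `x ↦ (wtr ν (g a) (shiftRes f K s x))ₐ` are close. -/
theorem norm_sub_le_of_approx_fixedPoint [Nonempty κ] {g : κ → I → ℝ} (hs : 0 < s.re)
    (hK : Kᴴ = -K)
    (hf : ∀ b k, 0 ≤ f b k) (hν : 0 < ν) (hg : ∀ a i, 0 ≤ g a i) {ω B ε : ℝ} (hω : 0 < ω)
    (hωB : ω ≤ B) (hε : 0 ≤ ε)
    (hx : ∀ b, 0 ≤ (x b).re) (hy : ∀ b, 0 ≤ (y b).re) (hxB : ∀ b, ‖x b‖ ≤ B)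
    (hyB : ∀ b, ‖y b‖ ≤ B)
    (hxω : ∀ a, ω ≤ s.re * (ν⁻¹ * ∑ i, g a i * ∑ k, ‖shiftRes f K s x i k‖ ^ 2))
    (hyω : ∀ a, ω ≤ s.re * (ν⁻¹ * ∑ i, g a i * ∑ k, ‖shiftRes f K s y k i‖ ^ 2))
    (hxε : ∀ a, ‖x a - wtr ν (g a) (shiftRes f K s x)‖ ≤ ε)
    (hyε : ∀ a, ‖y a - wtr ν (g a) (shiftRes f K s y)‖ ≤ ε) (a : κ) :
    ‖x a - y a‖ ≤ 8 * B ^ 2 / ω ^ 2 * ε := by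
  have hB : 0 < B := hω.trans_le hωB
  rcases lt_or_ge (ω / 2) ε with hbig | hsmall
  · have h1 : ‖x a - y a‖ ≤ 2 * B := (norm_sub_le _ _).trans (by linarith [hxB a, hyB a])
    refine h1.trans ?_
    have h2 : 2 * B ≤ 8 * B ^ 2 / ω ^ 2 * (ω / 2) := by
      rw [div_mul_eq_mul_div, le_div_iff₀ (by positivity)]
      have : ω * ω ≤ B * ω := mul_le_mul_of_nonneg_right hωB hω.le
      nlinarith [mul_pos hB hω, mul_nonneg hB.le (sub_nonneg.2 hωB)]
    exact h2.trans (mul_le_mul_of_nonneg_left hbig.le (by positivity))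
  set p : κ → ℝ := fun b => (x b).re with hp
  set p' : κ → ℝ := fun b => (y b).re with hp'
  set u : κ → ℝ := fun a => ν⁻¹ * ∑ i, g a i * ∑ k, ‖shiftRes f K s x i k‖ ^ 2 *
    ∑ b, (x b).re * f b k with hu
  set u' : κ → ℝ := fun a => ν⁻¹ * ∑ i, g a i * ∑ k, ‖shiftRes f K s y k i‖ ^ 2 *
    ∑ b, (y b).re * f b k with hu'
  have hpB : ∀ b, p b ≤ B := fun b => (Complex.re_le_norm _).trans (hxB b)
  have hpB' : ∀ b, p' b ≤ B := fun b => (Complex.re_le_norm _).trans (hyB b)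
  have hu0 : ∀ a, 0 ≤ u a := fun a => mul_nonneg (by positivity) (Finset.sum_nonneg fun i _ =>
    mul_nonneg (hg a i) (Finset.sum_nonneg fun k _ => mul_nonneg (by positivity)
      (Finset.sum_nonneg fun b _ => mul_nonneg (hx b) (hf b k))))
  have hu0' : ∀ a, 0 ≤ u' a := fun a => mul_nonneg (by positivity) (Finset.sum_nonneg fun i _ =>
    mul_nonneg (hg a i) (Finset.sum_nonneg fun k _ => mul_nonneg (by positivity)
      (Finset.sum_nonneg fun b _ => mul_nonneg (hy b) (hf b k))))
  have hux : ∀ a, u a ≤ p a - ω / 2 := by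
    intro a
    have h1 := wtr_re_row (ν := ν) (g := g a) hs hK hf hx
    have h2 := (Complex.abs_re_le_norm _).trans (hxε a)
    rw [Complex.sub_re] at h2
    have h3 := (abs_le.1 h2).1
    linarith [hxω a]
  have huy : ∀ a, u' a ≤ p' a - ω / 2 := by
    intro a
    have h1 := wtr_re_col (ν := ν) (g := g a) hs hK hf hy
    have h2 := (Complex.abs_re_le_norm _).trans (hyε a)
    rw [Complex.sub_re] at h2
    have h3 := (abs_le.1 h2).1
    linarith [hyω a]
  have hpω : ∀ a, ω / 2 ≤ p a := fun a => by linarith [hux a, hu0 a]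
  have hpω' : ∀ a, ω / 2 ≤ p' a := fun a => by linarith [huy a, hu0' a]
  have hr0 : ∀ b, ω / 2 ≤ √(p b * p' b) := by
    intro b
    refine Real.le_sqrt_of_sq_le ?_
    rw [sq]
    exact mul_le_mul (hpω b) (hpω' b) (by positivity) ((by positivity : 0 ≤ ω / 2).trans (hpω b))
  have hrB : ∀ b, √(p b * p' b) ≤ B := by
    intro b
    refine Real.sqrt_le_iff.2 ⟨hB.le, ?_⟩
    rw [sq]
    exact mul_le_mul (hpB b) (hpB' b) (hy b) hB.le
  obtain ⟨a₀, -, ha₀⟩ := Finset.exists_max_image Finset.univ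
    (fun b => ‖x b - y b‖ / √(p b * p' b)) Finset.univ_nonempty
  set t := ‖x a₀ - y a₀‖ / √(p a₀ * p' a₀) with ht
  have ht0 : 0 ≤ t := by positivity
  have hxy : ∀ b, ‖x b - y b‖ ≤ t * √(p b * p' b) := by
    intro b
    have := ha₀ b (Finset.mem_univ b)
    rwa [div_le_iff₀ (lt_of_lt_of_le (by positivity) (hr0 b))] at this
  set η := ω / (2 * B) with hη
  have hη0 : 0 < η := by positivity
  have hη1 : η ≤ 1 := by rw [hη, div_le_one (by positivity)]; linarith
  have hηp : ∀ {q : ℝ}, q ≤ B → η * q ≤ ω / 2 := by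
    intro q hq
    calc η * q ≤ η * B := mul_le_mul_of_nonneg_left hq hη0.le
      _ = ω / 2 := by rw [hη]; field_simp
  have hsq : ∀ a, √(u a) * √(u' a) ≤ (1 - η) * √(p a * p' a) := by
    intro a
    have h1 : u a ≤ (1 - η) * p a := by linarith [hux a, hηp (hpB a)]
    have h2 : u' a ≤ (1 - η) * p' a := by linarith [huy a, hηp (hpB' a)]
    rw [← Real.sqrt_mul (hu0 a)]
    refine Real.sqrt_le_iff.2 ⟨mul_nonneg (by linarith) (Real.sqrt_nonneg _), ?_⟩
    rw [mul_pow, Real.sq_sqrt (mul_nonneg (hx a) (hy a))]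
    calc u a * u' a ≤ ((1 - η) * p a) * ((1 - η) * p' a) :=
          mul_le_mul h1 h2 (hu0' a) (mul_nonneg (by linarith) (hx a))
      _ = _ := by ring
  have hmain : ‖x a₀ - y a₀‖ ≤ 2 * ε + t * ((1 - η) * √(p a₀ * p' a₀)) := by
    have h1 := norm_wtr_sub_le hs hK hf hν (hg a₀) hx hy ht0 hxy
    have h2 : x a₀ - y a₀ = (x a₀ - wtr ν (g a₀) (shiftRes f K s x))
        + (wtr ν (g a₀) (shiftRes f K s x) - wtr ν (g a₀) (shiftRes f K s y))
        - (y a₀ - wtr ν (g a₀) (shiftRes f K s y)) := by ring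
    rw [h2]
    refine (norm_sub_le _ _).trans ?_
    have h3 := norm_add_le (x a₀ - wtr ν (g a₀) (shiftRes f K s x))
      (wtr ν (g a₀) (shiftRes f K s x) - wtr ν (g a₀) (shiftRes f K s y))
    have h4 := h1.trans (mul_le_mul_of_nonneg_left (hsq a₀) ht0)
    linarith [hxε a₀, hyε a₀]
  have hra : 0 < √(p a₀ * p' a₀) := lt_of_lt_of_le (by positivity) (hr0 a₀)
  have hte : ‖x a₀ - y a₀‖ = t * √(p a₀ * p' a₀) := by rw [ht]; field_simp
  rw [hte] at hmain
  have ht1 : t * (η * (ω / 2)) ≤ 2 * ε := by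
    have : t * (η * (ω / 2)) ≤ t * (η * √(p a₀ * p' a₀)) := by
      gcongr
      exact hr0 a₀
    linarith
  have ht2 : t ≤ 8 * B / ω ^ 2 * ε := by
    have h1 : t * (η * (ω / 2)) = t * (ω ^ 2 / (4 * B)) := by rw [hη]; ring
    rw [h1] at ht1
    calc t = t * (ω ^ 2 / (4 * B)) * (4 * B / ω ^ 2) := by field_simp
      _ ≤ 2 * ε * (4 * B / ω ^ 2) := by gcongr
      _ = _ := by ring
  calc ‖x a - y a‖ ≤ t * √(p a * p' a) := hxy a
    _ ≤ (8 * B / ω ^ 2 * ε) * B := by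
        exact mul_le_mul ht2 (hrB a) (Real.sqrt_nonneg _) (by positivity)
    _ = _ := by ring

/-- Lower bound for the rows of an inverse. -/
lemma one_le_sum_row_mul {M W : Matrix I I ℂ} (h : W * M = 1) {Λ : ℝ} (i : I)
    (hM : ∑ k, ‖M k i‖ ^ 2 ≤ Λ ^ 2) : 1 ≤ (∑ k, ‖W i k‖ ^ 2) * Λ ^ 2 := by
  have h1 := congrFun (congrFun h i) i
  rw [Matrix.mul_apply, Matrix.one_apply_eq] at h1
  have h2 := norm_dotProduct_sq_le (W i) (fun k => M k i)
  rw [dotProduct, h1] at h2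
  simp only [norm_one, one_pow, normSq2] at h2
  exact h2.trans (mul_le_mul_of_nonneg_left hM (Finset.sum_nonneg fun _ _ => by positivity))

lemma one_le_sum_col_mul {M W : Matrix I I ℂ} (h : M * W = 1) {Λ : ℝ} (i : I)
    (hM : ∑ k, ‖M i k‖ ^ 2 ≤ Λ ^ 2) : 1 ≤ (∑ k, ‖W k i‖ ^ 2) * Λ ^ 2 := by
  have h1 : Wᵀ * Mᵀ = 1 := by rw [← Matrix.transpose_mul, h, Matrix.transpose_one]
  exact one_le_sum_row_mul h1 i hM

lemma sum_diagonal_add_row_le {θ : I → ℂ} {Θ α : ℝ} (hΘ : ∀ i, ‖θ i‖ ≤ Θ) (hα : 0 ≤ α) (i : I)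
    (hKα : ∑ k, ‖K i k‖ ^ 2 ≤ α ^ 2) :
    ∑ k, ‖(Matrix.diagonal θ + K) i k‖ ^ 2 ≤ (2 * (Θ + α)) ^ 2 := by
  have hΘ0 : 0 ≤ Θ := (norm_nonneg _).trans (hΘ i)
  have h1 : ∀ k, ‖(Matrix.diagonal θ + K) i k‖ ^ 2
      ≤ 2 * ‖Matrix.diagonal θ i k‖ ^ 2 + 2 * ‖K i k‖ ^ 2 := by
    intro k
    have := norm_add_le (Matrix.diagonal θ i k) (K i k)
    rw [Matrix.add_apply]
    nlinarith [sq_nonneg (‖Matrix.diagonal θ i k‖ - ‖K i k‖),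
      norm_nonneg (Matrix.diagonal θ i k + K i k),
      norm_nonneg (Matrix.diagonal θ i k), norm_nonneg (K i k)]
  have h2 : ∑ k, ‖Matrix.diagonal θ i k‖ ^ 2 = ‖θ i‖ ^ 2 := by
    rw [Finset.sum_eq_single i]
    · simp
    · intro k _ hk; simp [Matrix.diagonal_apply_ne _ hk.symm]
    · simp
  calc _ ≤ ∑ k, (2 * ‖Matrix.diagonal θ i k‖ ^ 2 + 2 * ‖K i k‖ ^ 2) :=
        Finset.sum_le_sum fun k _ => h1 k
    _ = 2 * ‖θ i‖ ^ 2 + 2 * ∑ k, ‖K i k‖ ^ 2 := by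
        rw [Finset.sum_add_distrib, ← Finset.mul_sum, ← Finset.mul_sum, h2]
    _ ≤ 2 * Θ ^ 2 + 2 * α ^ 2 := by
        have := pow_le_pow_left₀ (norm_nonneg _) (hΘ i) 2
        linarith
    _ ≤ _ := by nlinarith [mul_nonneg hΘ0 hα]

/-- Lower bound for the imaginary-part defect in the row Ward identity. -/
lemma le_mul_wtr_rows (hν : 0 < ν) {σ τ Λ : ℝ} (hσ : 0 ≤ σ) (hg : ∀ i, 0 ≤ g i)
    (hτ : τ ≤ ν⁻¹ * ∑ i, g i) (hΛ : 0 < Λ) {r : I → ℝ} (hr : ∀ i, 1 ≤ r i * Λ ^ 2) :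
    σ * τ / Λ ^ 2 ≤ σ * (ν⁻¹ * ∑ i, g i * r i) := by
  have h1 : ∀ i, g i / Λ ^ 2 ≤ g i * r i := by
    intro i
    rw [div_le_iff₀ (by positivity), mul_assoc]
    exact le_mul_of_one_le_right (hg i) (hr i)
  calc σ * τ / Λ ^ 2 = σ * (τ / Λ ^ 2) := by ring
    _ ≤ σ * (ν⁻¹ * ∑ i, g i / Λ ^ 2) := by
        refine mul_le_mul_of_nonneg_left ?_ hσ
        rw [← Finset.sum_div, ← mul_div_assoc]
        gcongr
    _ ≤ _ := by
        refine mul_le_mul_of_nonneg_left (mul_le_mul_of_nonneg_left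
          (Finset.sum_le_sum fun i _ => h1 i) (by positivity)) hσ

/-- Stability of the fixed-point system, with explicit constants. -/
theorem fixedPoint_stability [Nonempty κ] {g : κ → I → ℝ} (hs : 0 < s.re) (hK : Kᴴ = -K)
    (hf : ∀ b k, 0 ≤ f b k) (hν : 0 < ν) (hg : ∀ a i, 0 ≤ g a i) {τ Φ α B ε : ℝ} (hτ0 : 0 < τ)
    (hτ : ∀ a, τ ≤ ν⁻¹ * ∑ i, g a i) (hΦ : ∀ k, ∑ b, f b k ≤ Φ) (hα : 0 ≤ α)
    (hKα : ∀ i, ∑ k, ‖K i k‖ ^ 2 ≤ α ^ 2) (hΦ0 : 0 ≤ Φ) (hε : 0 ≤ ε)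
    (hx : ∀ b, 0 ≤ (x b).re) (hy : ∀ b, 0 ≤ (y b).re) (hxB : ∀ b, ‖x b‖ ≤ B)
    (hyB : ∀ b, ‖y b‖ ≤ B)
    (hωB : s.re * τ / (2 * (‖s‖ + B * Φ + α)) ^ 2 ≤ B)
    (hxε : ∀ a, ‖x a - wtr ν (g a) (shiftRes f K s x)‖ ≤ ε)
    (hyε : ∀ a, ‖y a - wtr ν (g a) (shiftRes f K s y)‖ ≤ ε) (a : κ) :
    ‖x a - y a‖ ≤ 8 * B ^ 2 / (s.re * τ / (2 * (‖s‖ + B * Φ + α)) ^ 2) ^ 2 * ε := by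
  have hB0 : 0 ≤ B := (norm_nonneg _).trans (hxB a)
  have hs0 : 0 < ‖s‖ := hs.trans_le (Complex.re_le_norm s)
  have hΛ : 0 < 2 * (‖s‖ + B * Φ + α) := by positivity
  have hθ : ∀ {z : κ → ℂ}, (∀ b, ‖z b‖ ≤ B) → ∀ i, ‖shiftDiag f s z i‖ ≤ ‖s‖ + B * Φ := by
    intro z hz i
    refine (norm_add_le _ _).trans (add_le_add le_rfl ?_)
    calc _ ≤ ∑ b, B * f b i := by
          refine (norm_sum_le _ _).trans (Finset.sum_le_sum fun b _ => ?_)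
          rw [norm_mul, Complex.norm_real, Real.norm_of_nonneg (hf b i)]
          exact mul_le_mul_of_nonneg_right (hz b) (hf b i)
      _ ≤ _ := by
          rw [← Finset.mul_sum]
          exact mul_le_mul_of_nonneg_left (hΦ i) hB0
  have hKsymm : ∀ i k, ‖Kᵀ i k‖ = ‖K i k‖ := by
    intro i k
    have := congrFun (congrFun hK i) k
    rw [Matrix.conjTranspose_apply, Matrix.neg_apply] at this
    rw [Matrix.transpose_apply, ← norm_star, this, norm_neg]
  refine norm_sub_le_of_approx_fixedPoint hs hK hf hν hg (by positivity) hωB hε hx hy hxB hyB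
    (fun a => ?_) (fun a => ?_) hxε hyε a
  · refine le_mul_wtr_rows hν hs.le (hg a) (hτ a) hΛ fun i => ?_
    refine one_le_sum_row_mul ((shift_accretive hK hf hx).inv_mul hs) i ?_
    have h := sum_diagonal_add_row_le (K := Kᵀ) (hθ hxB) hα i (by simpa only [hKsymm] using hKα i)
    refine le_trans (le_of_eq (Finset.sum_congr rfl fun k _ => ?_)) h
    rw [← Matrix.transpose_apply (Matrix.diagonal _ + K), Matrix.transpose_add,
      Matrix.diagonal_transpose]
  · refine le_mul_wtr_rows hν hs.le (hg a) (hτ a) hΛ fun i => ?_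
    exact one_le_sum_col_mul ((shift_accretive hK hf hy).mul_inv hs) i
      (sum_diagonal_add_row_le (hθ hyB) hα i (hKα i))

end Stability

section

open MeasureTheory

lemma integral_norm_le_sqrt {α : Type*} [MeasurableSpace α] {P : Measure α}
    [IsProbabilityMeasure P] {f : α → ℂ} (hf : BddMeas f) :
    ∫ x, ‖f x‖ ∂P ≤ √(∫ x, ‖f x‖ ^ 2 ∂P) := by
  refine Real.le_sqrt_of_sq_le ?_
  set a := ∫ x, ‖f x‖ ∂P with ha
  have h0 : 0 ≤ ∫ x, (‖f x‖ - a) ^ 2 ∂P := integral_nonneg fun x => sq_nonneg _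
  have i1 : Integrable (fun x => ‖f x‖ ^ 2) P := (hf.norm.pow 2).integrable P
  have i2 : Integrable (fun x => 2 * a * ‖f x‖) P := (hf.norm.integrable P).const_mul _
  have h1 : ∫ x, (‖f x‖ - a) ^ 2 ∂P = ∫ x, ‖f x‖ ^ 2 ∂P - 2 * a * a + a ^ 2 := by
    have : ∀ x, (‖f x‖ - a) ^ 2 = (‖f x‖ ^ 2 - 2 * a * ‖f x‖) + a ^ 2 := fun x => by ring
    simp only [this]
    have i3 : Integrable (fun x => ‖f x‖ ^ 2 - 2 * a * ‖f x‖) P := i1.sub i2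
    rw [integral_add i3 (integrable_const _), integral_sub i1 i2, integral_const_mul, ← ha]
    simp
  nlinarith

lemma EntryLaw.of_le {p q : ℕ} {Mo : ℝ} {μ : Measure ℂ} [IsProbabilityMeasure μ]
    (h : EntryLaw p Mo μ) (hq : q ≤ p) : EntryLaw q (1 + Mo) μ where
  mean_zero := h.mean_zero
  variance_one := h.variance_one
  integrable_moment := h.integrable_pow (by omega)
  moment_le := h.integral_pow_le (by omega)

section MeanEquation

variable {m n : Type*} [Fintype m] [DecidableEq m] [Fintype n] [DecidableEq n]
  {d : m → ℝ} {d' : n → ℝ} {ν β R : ℝ}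

/-- The weights of the two traces: `d` on the first block, `d'` on the second one. -/
def traceWeight (d : m → ℝ) (d' : n → ℝ) (b : Bool) : m ⊕ n → ℝ :=
  cond b (Sum.elim d 0) (Sum.elim 0 d')

/-- The weights of the two shifts: the trace over one block acts on the other one. -/
def shiftWeight (d : m → ℝ) (d' : n → ℝ) (b : Bool) : m ⊕ n → ℝ := traceWeight d d' (!b)

/-- The standard deviations of the entries of the noise. -/
def noiseWeight (d : m → ℝ) (d' : n → ℝ) (ν : ℝ) (k : m × n) : ℝ := √(d k.1) * √(d' k.2) / √ν

/-- Size bounds on a pair of nonnegative weights. -/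
structure WeightBounds (d : m → ℝ) (d' : n → ℝ) (ν β R : ℝ) : Prop where
  one_le : 1 ≤ ν
  nonneg : ∀ i, 0 ≤ d i
  nonneg' : ∀ j, 0 ≤ d' j
  le : ∀ i, d i ≤ β
  le' : ∀ j, d' j ≤ β
  bound_nonneg : 0 ≤ β
  card_le : (Fintype.card m + Fintype.card n : ℝ) ≤ R * ν

namespace WeightBounds

lemma pos (h : WeightBounds d d' ν β R) : 0 < ν := lt_of_lt_of_le one_pos h.one_le

lemma ratio_nonneg (h : WeightBounds d d' ν β R) : 0 ≤ R :=
  nonneg_of_mul_nonneg_left (le_trans (by positivity) h.card_le) h.pos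

lemma traceWeight_nonneg (h : WeightBounds d d' ν β R) (b : Bool) (k : m ⊕ n) :
    0 ≤ traceWeight d d' b k := by
  cases b <;> rcases k with k | k <;> simp [traceWeight, h.nonneg, h.nonneg']

lemma traceWeight_le (h : WeightBounds d d' ν β R) (b : Bool) (k : m ⊕ n) :
    traceWeight d d' b k ≤ β := by
  cases b <;> rcases k with k | k <;> simp [traceWeight, h.le, h.le', h.bound_nonneg]

lemma shiftWeight_nonneg (h : WeightBounds d d' ν β R) (b : Bool) (k : m ⊕ n) :
    0 ≤ shiftWeight d d' b k :=
  h.traceWeight_nonneg _ _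

lemma shiftWeight_le (h : WeightBounds d d' ν β R) (b : Bool) (k : m ⊕ n) :
    shiftWeight d d' b k ≤ β :=
  h.traceWeight_le _ _

lemma noiseWeight_sq (h : WeightBounds d d' ν β R) (k : m × n) :
    noiseWeight d d' ν k ^ 2 = d k.1 * d' k.2 / ν := by
  rw [noiseWeight, div_pow, mul_pow, Real.sq_sqrt (h.nonneg _), Real.sq_sqrt (h.nonneg' _),
    Real.sq_sqrt h.pos.le]

lemma noiseWeight_sq_le (h : WeightBounds d d' ν β R) (k : m × n) :
    noiseWeight d d' ν k ^ 2 ≤ β ^ 2 / ν := by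
  rw [h.noiseWeight_sq, sq]
  exact div_le_div_of_nonneg_right
    (mul_le_mul (h.le _) (h.le' _) (h.nonneg' _) h.bound_nonneg) h.pos.le

lemma sum_traceWeight_le (h : WeightBounds d d' ν β R) (b : Bool) :
    ν⁻¹ * ∑ k, traceWeight d d' b k ≤ R * β := by
  have h1 : ∑ k, traceWeight d d' b k ≤ (R * ν) * β := by
    calc _ ≤ ∑ _k : m ⊕ n, β := Finset.sum_le_sum fun k _ => h.traceWeight_le b k
      _ = (Fintype.card m + Fintype.card n : ℝ) * β := by simp
      _ ≤ _ := mul_le_mul_of_nonneg_right h.card_le h.bound_nonneg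
  have hν := h.pos
  rw [inv_mul_le_iff₀ hν]
  linarith

lemma selfEnergy_eq (h : WeightBounds d d' ν β R) (W : Matrix (m ⊕ n) (m ⊕ n) ℂ) (k : m ⊕ n) :
    selfEnergy (noiseWeight d d' ν) W k
      = ∑ b, wtr ν (traceWeight d d' b) W * (shiftWeight d d' b k : ℂ) := by
  have hc := h.noiseWeight_sq
  rcases k with k | k
  · simp only [selfEnergy, Sum.elim_inl, hc, Fintype.sum_bool, shiftWeight, traceWeight, wtr,
      Fintype.sum_sum_type, Bool.not_true, Bool.not_false, cond_true, cond_false, Sum.elim_inr,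
      Pi.zero_apply, Complex.ofReal_zero, mul_zero, zero_mul, Finset.sum_const_zero, zero_add,
      Finset.mul_sum, Finset.sum_mul]
    refine Finset.sum_congr rfl fun j _ => ?_
    push_cast; ring
  · simp only [selfEnergy, Sum.elim_inr, hc, Fintype.sum_bool, shiftWeight, traceWeight, wtr,
      Fintype.sum_sum_type, Bool.not_true, Bool.not_false, cond_true, cond_false, Sum.elim_inl,
      Pi.zero_apply, Complex.ofReal_zero, mul_zero, zero_mul, Finset.sum_const_zero, add_zero,
      Finset.mul_sum, Finset.sum_mul]
    refine Finset.sum_congr rfl fun j _ => ?_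
    push_cast; ring

end WeightBounds

variable (A : Matrix m n ℂ) {s : ℂ} (μ : m × n → Measure ℂ) [∀ k, IsProbabilityMeasure (μ k)]

/-- The constant in `integral_norm_wtr_sub_le`. -/
def flucConst (Mo β R L : ℝ) : ℝ := R * β * √(momentConst 0 * concConst Mo (β ^ 2) R L)

/-- The constant in `norm_integral_form_sub_le`. -/
def biasConst (Mo β R L : ℝ) : ℝ :=
  L * defectConst Mo (β ^ 2) R L + 2 * β * L ^ 2 * flucConst Mo β R L

lemma bddMeas_wtr_linRes (c : m × n → ℝ) (hs : 0 < s.re) (g : m ⊕ n → ℝ) :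
    BddMeas fun x => wtr ν g (linRes c A s x) := by
  simp only [wtr]
  exact (BddMeas.const _).mul (BddMeas.sum _ fun i =>
    (BddMeas.const _).mul (bddMeas_linRes_apply c A hs i i))

/-- The expected weighted trace of the resolvent. -/
def meanTrace (d : m → ℝ) (d' : n → ℝ) (ν : ℝ) (s : ℂ) (b : Bool) : ℂ :=
  ∫ x, wtr ν (traceWeight d d' b) (linRes (noiseWeight d d' ν) A s x) ∂(Measure.pi μ)

lemma integral_norm_wtr_sub_le (h : WeightBounds d d' ν β R) {Mo : ℝ} (hs : 0 < s.re)
    (hMo : 0 ≤ Mo) (hμ : ∀ k, EntryLaw 1 Mo (μ k)) (b : Bool) :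
    ∫ x, ‖wtr ν (traceWeight d d' b) (linRes (noiseWeight d d' ν) A s x)
        - meanTrace A μ d d' ν s b‖ ∂(Measure.pi μ) ≤ flucConst Mo β R (1 / s.re) / √ν := by
  set W := linRes (noiseWeight d d' ν) A s with hW
  set P := Measure.pi μ with hP
  have hν := h.pos
  have hWb : ∀ i, BddMeas fun x => W x i i := fun i => bddMeas_linRes_apply _ A hs i i
  have hWc : ∀ i, BddMeas fun x => W x i i - ∫ y, W y i i ∂P := fun i =>
    (hWb i).sub (BddMeas.const _)
  set C := √(momentConst 0 * concConst Mo (β ^ 2) R (1 / s.re)) / √ν with hC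
  have hentry : ∀ i, ∫ x, ‖W x i i - ∫ y, W y i i ∂P‖ ∂P ≤ C := by
    intro i
    refine (integral_norm_le_sqrt (hWc i)).trans ?_
    have h1 := concentration A μ 0 hs h.one_le (sq_nonneg β) hMo h.noiseWeight_sq_le
      h.card_le hμ (Pi.single i 1) (Pi.single i 1)
    simp only [Matrix.mulVec_single_one, single_one_dotProduct, normSq2_single, mul_one,
      Matrix.col_apply, zero_add, pow_one] at h1
    rw [hC, ← Real.sqrt_div' _ hν.le, mul_div_assoc]
    exact Real.sqrt_le_sqrt h1
  have hmean : meanTrace A μ d d' ν s b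
      = (ν : ℂ)⁻¹ * ∑ i, (traceWeight d d' b i : ℂ) * ∫ y, W y i i ∂P := by
    simp only [meanTrace, wtr]
    rw [integral_const_mul, integral_finsetSum _ fun i _ => ((hWb i).integrable P).const_mul _]
    simp only [integral_const_mul]
  have hpt : ∀ x, ‖wtr ν (traceWeight d d' b) (W x) - meanTrace A μ d d' ν s b‖
      ≤ ν⁻¹ * ∑ i, traceWeight d d' b i * ‖W x i i - ∫ y, W y i i ∂P‖ := by
    intro x
    rw [hmean, wtr, ← mul_sub, ← Finset.sum_sub_distrib, norm_mul, norm_inv, Complex.norm_real,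
      Real.norm_of_nonneg hν.le]
    refine mul_le_mul_of_nonneg_left ((norm_sum_le _ _).trans
      (Finset.sum_le_sum fun i _ => ?_)) (by positivity)
    rw [← mul_sub, norm_mul, Complex.norm_real, Real.norm_of_nonneg (h.traceWeight_nonneg b i)]
  have hi : ∀ i, Integrable (fun x => traceWeight d d' b i * ‖W x i i - ∫ y, W y i i ∂P‖) P :=
    fun i => ((hWc i).norm.integrable P).const_mul _
  calc _ ≤ ∫ x, ν⁻¹ * ∑ i, traceWeight d d' b i * ‖W x i i - ∫ y, W y i i ∂P‖ ∂P := by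
        refine integral_mono ?_ ((integrable_finsetSum _ fun i _ => hi i).const_mul _) hpt
        exact ((bddMeas_wtr_linRes A _ hs _).sub (BddMeas.const _)).norm.integrable P
    _ = ν⁻¹ * ∑ i, traceWeight d d' b i * ∫ x, ‖W x i i - ∫ y, W y i i ∂P‖ ∂P := by
        rw [integral_const_mul, integral_finsetSum _ fun i _ => hi i]
        simp only [integral_const_mul]
    _ ≤ ν⁻¹ * ∑ i, traceWeight d d' b i * C := by
        refine mul_le_mul_of_nonneg_left (Finset.sum_le_sum fun i _ =>
          mul_le_mul_of_nonneg_left (hentry i) (h.traceWeight_nonneg b i)) (by positivity)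
    _ = (ν⁻¹ * ∑ i, traceWeight d d' b i) * C := by rw [← Finset.sum_mul]; ring
    _ ≤ R * β * C := mul_le_mul_of_nonneg_right (h.sum_traceWeight_le b) (by positivity)
    _ = _ := by rw [hC, flucConst]; ring

lemma wtr_linRes_re_nonneg (h : WeightBounds d d' ν β R) (hs : 0 < s.re) (x : m × n → ℂ)
    (c : m × n → ℝ) (b : Bool) : 0 ≤ (wtr ν (traceWeight d d' b) (linRes c A s x)).re := by
  have hν := h.pos
  rw [wtr_re]
  refine mul_nonneg (by positivity) (Finset.sum_nonneg fun i _ =>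
    mul_nonneg (h.traceWeight_nonneg b i) ?_)
  have hW : linRes c A s x
      * (Matrix.diagonal (fun _ => s) + skewBlock (A + weighted c x)) = 1 :=
    (linMat_accretive c A x).inv_mul hs
  rw [re_inv_apply_row (skewBlock_conjTranspose _) hW]
  exact Finset.sum_nonneg fun k _ => mul_nonneg (by positivity) hs.le

lemma meanTrace_re_nonneg (h : WeightBounds d d' ν β R) (hs : 0 < s.re) (b : Bool) :
    0 ≤ (meanTrace A μ d d' ν s b).re := by
  have h1 : (meanTrace A μ d d' ν s b).re = ∫ x, (wtr ν (traceWeight d d' b)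
      (linRes (noiseWeight d d' ν) A s x)).re ∂(Measure.pi μ) :=
    (integral_re ((bddMeas_wtr_linRes A _ hs _).integrable _)).symm
  rw [h1]
  exact integral_nonneg fun x => wtr_linRes_re_nonneg A h hs x _ b

lemma norm_meanTrace_le (h : WeightBounds d d' ν β R) (hs : 0 < s.re) (b : Bool) :
    ‖meanTrace A μ d d' ν s b‖ ≤ R * β * (1 / s.re) := by
  have h1 := norm_integral_le_of_norm_le_const (μ := Measure.pi μ)
    (f := fun x => wtr ν (traceWeight d d' b) (linRes (noiseWeight d d' ν) A s x))
    (C := R * β * (1 / s.re)) (Filter.Eventually.of_forall fun x => ?_)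
  · rw [probReal_univ, mul_one] at h1
    exact h1
  refine (norm_wtr_le h.pos (h.traceWeight_nonneg b)
    fun i => norm_linRes_apply_le _ A hs x i i).trans ?_
  exact mul_le_mul_of_nonneg_right (h.sum_traceWeight_le b) (by positivity)

lemma norm_dotProduct_diagonal_mulVec_le {I : Type*} [Fintype I] [DecidableEq I] {η : I → ℂ}
    {E : ℝ} (hE : 0 ≤ E) (hη : ∀ k, ‖η k‖ ≤ E) (y q : I → ℂ) :
    ‖y ⬝ᵥ (Matrix.diagonal η *ᵥ q)‖ ≤ E * (√(normSq2 y) * √(normSq2 q)) := by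
  have h1 : normSq2 (Matrix.diagonal η *ᵥ q) ≤ E ^ 2 * normSq2 q := by
    rw [normSq2, normSq2, Finset.mul_sum]
    refine Finset.sum_le_sum fun k _ => ?_
    rw [Matrix.mulVec_diagonal, norm_mul, mul_pow]
    exact mul_le_mul_of_nonneg_right (pow_le_pow_left₀ (norm_nonneg _) (hη k) 2) (by positivity)
  have h2 := Real.sqrt_le_sqrt h1
  rw [Real.sqrt_mul (by positivity), Real.sqrt_sq hE] at h2
  calc _ ≤ √(normSq2 y) * (E * √(normSq2 q)) :=
        (norm_dotProduct_le _ _).trans (mul_le_mul_of_nonneg_left h2 (Real.sqrt_nonneg _))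
    _ = _ := by ring

/-- The mean resolvent is close to the resolvent shifted by the mean traces. -/
theorem norm_integral_form_sub_le (h : WeightBounds d d' ν β R) {Mo : ℝ} (hs : 0 < s.re)
    (hMo : 0 ≤ Mo) (hμ : ∀ k, EntryLaw 1 Mo (μ k)) (u v : m ⊕ n → ℂ) :
    ‖(∫ x, u ⬝ᵥ (linRes (noiseWeight d d' ν) A s x *ᵥ v) ∂(Measure.pi μ))
        - u ⬝ᵥ (shiftRes (shiftWeight d d') (skewBlock A) s (meanTrace A μ d d' ν s) *ᵥ v)‖
      ≤ biasConst Mo β R (1 / s.re) / √ν * (√(normSq2 u) * √(normSq2 v)) := by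
  set c := noiseWeight d d' ν with hc
  set a := meanTrace A μ d d' ν s with ha
  set T := shiftRes (shiftWeight d d') (skewBlock A) s a with hT
  set L := 1 / s.re with hL
  have hL0 : 0 < L := by positivity
  have hν := h.pos
  have hβ := h.bound_nonneg
  have hare : ∀ b, 0 ≤ (a b).re := meanTrace_re_nonneg A μ h hs
  have hacc := shift_accretive (s := s) (x := a) (skewBlock_conjTranspose A)
    h.shiftWeight_nonneg hare
  set y := u ᵥ* T with hy
  have hyn : √(normSq2 y) ≤ L * √(normSq2 u) := by
    have := Real.sqrt_le_sqrt (hacc.normSq2_vecMul_inv_le hs u)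
    rwa [Real.sqrt_mul (by positivity), Real.sqrt_sq hL0.le] at this
  have hqn : ∀ x, √(normSq2 (linRes c A s x *ᵥ v)) ≤ L * √(normSq2 v) := by
    intro x
    have := Real.sqrt_le_sqrt ((linMat_accretive c A x).normSq2_inv_mulVec_le hs v)
    rwa [Real.sqrt_mul (by positivity), Real.sqrt_sq hL0.le] at this
  set D : (m × n → ℂ) → ℂ := fun x =>
    y ⬝ᵥ (skewBlock (weighted c x) *ᵥ (linRes c A s x *ᵥ v))
        - y ⬝ᵥ (Matrix.diagonal (selfEnergy c (linRes c A s x)) *ᵥ (linRes c A s x *ᵥ v)) with hD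
  set η : (m × n → ℂ) → m ⊕ n → ℂ := fun x k =>
    ∑ b, (wtr ν (traceWeight d d' b) (linRes c A s x) - a b) * (shiftWeight d d' b k : ℂ) with hη
  set F : (m × n → ℂ) → ℂ := fun x => y ⬝ᵥ (Matrix.diagonal (η x) *ᵥ (linRes c A s x *ᵥ v)) with hF
  have hpt : ∀ x, u ⬝ᵥ (T *ᵥ v) - u ⬝ᵥ (linRes c A s x *ᵥ v) = D x + F x := by
    intro x
    have h1 : T - linRes c A s x = T * (skewBlock (weighted c x)
        - Matrix.diagonal (fun k => ∑ b, a b * (shiftWeight d d' b k : ℂ))) * linRes c A s x := by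
      rw [hT, shiftRes, linRes, inv_sub_inv_of_isUnit (hacc.isUnit hs)
        ((linMat_accretive c A x).isUnit hs)]
      congr 2
      have h2 : Matrix.diagonal (shiftDiag (shiftWeight d d') s a)
          = Matrix.diagonal (fun _ : m ⊕ n => s)
            + Matrix.diagonal (fun k => ∑ b, a b * (shiftWeight d d' b k : ℂ)) := by
        rw [Matrix.diagonal_add]; rfl
      rw [linMat, skewBlock_add, h2]
      abel
    have h3 : η x = selfEnergy c (linRes c A s x)
        - fun k => ∑ b, a b * (shiftWeight d d' b k : ℂ) := by
      funext k
      rw [Pi.sub_apply, h.selfEnergy_eq]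
      simp only [hη, sub_mul, Finset.sum_sub_distrib]
    have h4 : Matrix.diagonal (η x) = Matrix.diagonal (selfEnergy c (linRes c A s x))
        - Matrix.diagonal (fun k => ∑ b, a b * (shiftWeight d d' b k : ℂ)) := by
      rw [h3, Matrix.diagonal_sub]; rfl
    rw [← dotProduct_sub, ← Matrix.sub_mulVec, h1, ← Matrix.mulVec_mulVec, ← Matrix.mulVec_mulVec,
      Matrix.dotProduct_mulVec, ← hy]
    simp only [hD, hF, h4, Matrix.sub_mulVec, dotProduct_sub]
    ring
  have hbW : BddMeas fun x => u ⬝ᵥ (linRes c A s x *ᵥ v) := bddMeas_linRes_form c A hs u v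
  obtain ⟨hDi, hDn⟩ := norm_integral_defect_le A μ hs le_rfl h.one_le (sq_nonneg β)
    h.noiseWeight_sq_le h.card_le hμ hMo y v
  have hFeq : F = fun x => (u ⬝ᵥ (T *ᵥ v) - u ⬝ᵥ (linRes c A s x *ᵥ v)) - D x := by
    funext x; rw [hpt x]; ring
  have hTW : Integrable (fun x => u ⬝ᵥ (T *ᵥ v) - u ⬝ᵥ (linRes c A s x *ᵥ v)) (Measure.pi μ) :=
    ((BddMeas.const _).sub hbW).integrable _
  have hFi : Integrable F (Measure.pi μ) := by rw [hFeq]; exact hTW.sub hDi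
  have hint : (∫ x, u ⬝ᵥ (linRes c A s x *ᵥ v) ∂(Measure.pi μ)) - u ⬝ᵥ (T *ᵥ v)
      = -(∫ x, D x ∂(Measure.pi μ) + ∫ x, F x ∂(Measure.pi μ)) := by
    rw [← integral_add hDi hFi, ← integral_congr_ae (Filter.Eventually.of_forall hpt),
      integral_sub (integrable_const _) (hbW.integrable _)]
    simp
  set fluc : (m × n → ℂ) → Bool → ℝ := fun x b =>
    ‖wtr ν (traceWeight d d' b) (linRes c A s x) - a b‖ with hfluc
  have hflucb : ∀ b, BddMeas fun x => fluc x b := fun b =>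
    ((bddMeas_wtr_linRes A c hs _).sub (BddMeas.const _)).norm
  have hFn : ∀ x, ‖F x‖
      ≤ β * L ^ 2 * (√(normSq2 u) * √(normSq2 v)) * (fluc x true + fluc x false) := by
    intro x
    have hη' : ∀ k, ‖η x k‖ ≤ β * (fluc x true + fluc x false) := by
      intro k
      simp only [hη, Fintype.sum_bool]
      refine (norm_add_le _ _).trans ?_
      rw [norm_mul, norm_mul, Complex.norm_real, Complex.norm_real,
        Real.norm_of_nonneg (h.shiftWeight_nonneg _ _),
        Real.norm_of_nonneg (h.shiftWeight_nonneg _ _),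
        mul_comm β, add_mul]
      exact add_le_add (mul_le_mul_of_nonneg_left (h.shiftWeight_le _ _) (norm_nonneg _))
        (mul_le_mul_of_nonneg_left (h.shiftWeight_le _ _) (norm_nonneg _))
    have hfl0 : 0 ≤ fluc x true + fluc x false := add_nonneg (norm_nonneg _) (norm_nonneg _)
    refine (norm_dotProduct_diagonal_mulVec_le (mul_nonneg hβ hfl0) hη' y _).trans ?_
    calc _ ≤ β * (fluc x true + fluc x false) * ((L * √(normSq2 u)) * (L * √(normSq2 v))) := by
          refine mul_le_mul_of_nonneg_left ?_ (mul_nonneg hβ hfl0)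
          exact mul_le_mul hyn (hqn x) (Real.sqrt_nonneg _) (by positivity)
      _ = _ := by ring
  have hFint : ‖∫ x, F x ∂(Measure.pi μ)‖
      ≤ β * L ^ 2 * (√(normSq2 u) * √(normSq2 v)) * (2 * (flucConst Mo β R L / √ν)) := by
    refine (norm_integral_le_integral_norm _).trans ?_
    calc _ ≤ ∫ x, β * L ^ 2 * (√(normSq2 u) * √(normSq2 v))
          * (fluc x true + fluc x false) ∂(Measure.pi μ) :=
          integral_mono hFi.norm
            ((((hflucb true).add (hflucb false)).integrable _).const_mul _) hFn
      _ = β * L ^ 2 * (√(normSq2 u) * √(normSq2 v))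
          * (∫ x, fluc x true ∂(Measure.pi μ) + ∫ x, fluc x false ∂(Measure.pi μ)) := by
          rw [integral_const_mul, integral_add ((hflucb true).integrable _)
            ((hflucb false).integrable _)]
      _ ≤ _ := by
          refine mul_le_mul_of_nonneg_left ?_ (by positivity)
          have t1 := integral_norm_wtr_sub_le A μ h hs hMo hμ true
          have t2 := integral_norm_wtr_sub_le A μ h hs hMo hμ false
          linarith
  rw [hint, norm_neg]
  refine (norm_add_le _ _).trans ((add_le_add hDn hFint).trans ?_)
  have hdc : 0 ≤ defectConst Mo (β ^ 2) R L := by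
    have := h.ratio_nonneg
    rw [defectConst]; positivity
  calc _ ≤ defectConst Mo (β ^ 2) R L / √ν * ((L * √(normSq2 u)) * √(normSq2 v))
        + β * L ^ 2 * (√(normSq2 u) * √(normSq2 v)) * (2 * (flucConst Mo β R L / √ν)) := by
        gcongr
    _ = _ := by rw [biasConst]; ring

/-- The mean traces solve the fixed-point system up to a small error. -/
theorem norm_meanTrace_sub_wtr_le (h : WeightBounds d d' ν β R) {Mo : ℝ} (hs : 0 < s.re)
    (hMo : 0 ≤ Mo) (hμ : ∀ k, EntryLaw 1 Mo (μ k)) (b : Bool) :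
    ‖meanTrace A μ d d' ν s b - wtr ν (traceWeight d d' b)
        (shiftRes (shiftWeight d d') (skewBlock A) s (meanTrace A μ d d' ν s))‖
      ≤ R * β * (biasConst Mo β R (1 / s.re) / √ν) := by
  set T := shiftRes (shiftWeight d d') (skewBlock A) s (meanTrace A μ d d' ν s) with hT
  set c := noiseWeight d d' ν with hc
  have hν := h.pos
  have hWb : ∀ i, BddMeas fun x => linRes c A s x i i := fun i => bddMeas_linRes_apply _ A hs i i
  have hmean : meanTrace A μ d d' ν s b = wtr ν (traceWeight d d' b)
      (Matrix.of fun i j => ∫ x, linRes c A s x i j ∂(Measure.pi μ)) := by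
    simp only [meanTrace, wtr, Matrix.of_apply]
    rw [integral_const_mul, integral_finsetSum _ fun i _ => ((hWb i).integrable _).const_mul _]
    simp only [integral_const_mul]
  have hsub : ∀ W W' : Matrix (m ⊕ n) (m ⊕ n) ℂ, wtr ν (traceWeight d d' b) W
      - wtr ν (traceWeight d d' b) W' = wtr ν (traceWeight d d' b) (W - W') := by
    intro W W'
    simp only [wtr, ← mul_sub, ← Finset.sum_sub_distrib, Matrix.sub_apply]
  have hb0 : 0 ≤ biasConst Mo β R (1 / s.re) / √ν := by
    have := h.ratio_nonneg
    have := h.bound_nonneg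
    rw [biasConst, defectConst, flucConst]; positivity
  rw [hmean, hsub]
  refine (norm_wtr_le hν (h.traceWeight_nonneg b)
    (L := biasConst Mo β R (1 / s.re) / √ν) fun i => ?_).trans
    (mul_le_mul_of_nonneg_right (h.sum_traceWeight_le b) hb0)
  have h1 := norm_integral_form_sub_le A μ h hs hMo hμ (Pi.single i 1) (Pi.single i 1)
  simp only [Matrix.mulVec_single_one, single_one_dotProduct, normSq2_single, mul_one,
      Matrix.col_apply, Real.sqrt_one] at h1
  exact h1

end MeanEquation

end

section

open MeasureTheory

section Comparison

variable {m n : Type*} [Fintype m] [DecidableEq m] [Fintype n] [DecidableEq n]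
  {d : m → ℝ} {d' : n → ℝ} {ν β R : ℝ} (A : Matrix m n ℂ) {s : ℂ}

/-- `y` has nonnegative real parts and solves the fixed-point system. -/
structure IsFixedPoint (d : m → ℝ) (d' : n → ℝ) (ν : ℝ) (s : ℂ) (y : Bool → ℂ) : Prop where
  re_nonneg : ∀ b, 0 ≤ (y b).re
  eq : ∀ b, y b = wtr ν (traceWeight d d' b)
    (shiftRes (shiftWeight d d') (skewBlock A) s y)

lemma norm_wtr_shiftRes_le (h : WeightBounds d d' ν β R) (hs : 0 < s.re) {y : Bool → ℂ}
    (hy : ∀ b, 0 ≤ (y b).re) (b : Bool) :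
    ‖wtr ν (traceWeight d d' b) (shiftRes (shiftWeight d d') (skewBlock A) s y)‖
      ≤ R * β * (1 / s.re) := by
  refine (norm_wtr_le h.pos (h.traceWeight_nonneg b) fun i =>
    (shift_accretive (skewBlock_conjTranspose A) h.shiftWeight_nonneg hy).norm_inv_apply_le
      hs i i).trans ?_
  exact mul_le_mul_of_nonneg_right (h.sum_traceWeight_le b) (by positivity)

lemma IsFixedPoint.norm_le {A : Matrix m n ℂ} (h : WeightBounds d d' ν β R) (hs : 0 < s.re) {y : Bool → ℂ}
    (hy : IsFixedPoint A d d' ν s y) (b : Bool) : ‖y b‖ ≤ R * β * (1 / s.re) := by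
  rw [hy.eq b]
  exact norm_wtr_shiftRes_le A h hs hy.re_nonneg b

/-- The constant in the stability estimate for the fixed-point system. -/
def stabConst (β R τ α S L : ℝ) : ℝ :=
  8 * (R * β * L) ^ 2 / (1 / L * τ / (2 * (S + R * β * L * (2 * β) + α)) ^ 2) ^ 2

/-- Lower bounds on the traces and an upper bound on the rows of the deterministic part. -/
structure ShapeBounds (d : m → ℝ) (d' : n → ℝ) (ν τ α : ℝ) : Prop where
  pos : 0 < τ
  le_trace : ∀ b, τ ≤ ν⁻¹ * ∑ k, traceWeight d d' b k
  nonneg : 0 ≤ α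
  row_le : ∀ i, ∑ k, ‖skewBlock A i k‖ ^ 2 ≤ α ^ 2

theorem norm_sub_le_stabConst (h : WeightBounds d d' ν β R) {τ α : ℝ}
    (h' : ShapeBounds A d d' ν τ α) (hs : 0 < s.re) {x y : Bool → ℂ} {ε : ℝ} (hε : 0 ≤ ε)
    (hx : ∀ b, 0 ≤ (x b).re) (hy : ∀ b, 0 ≤ (y b).re)
    (hxB : ∀ b, ‖x b‖ ≤ R * β * (1 / s.re)) (hyB : ∀ b, ‖y b‖ ≤ R * β * (1 / s.re))
    (hxε : ∀ b, ‖x b - wtr ν (traceWeight d d' b)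
      (shiftRes (shiftWeight d d') (skewBlock A) s x)‖ ≤ ε)
    (hyε : ∀ b, ‖y b - wtr ν (traceWeight d d' b)
      (shiftRes (shiftWeight d d') (skewBlock A) s y)‖ ≤ ε) (b : Bool) :
    ‖x b - y b‖ ≤ stabConst β R τ α ‖s‖ (1 / s.re) * ε := by
  have hβ := h.bound_nonneg
  have hR := h.ratio_nonneg
  have hα := h'.nonneg
  have hs0 : s.re ≤ ‖s‖ := Complex.re_le_norm s
  have hτR : τ ≤ R * β := (h'.le_trace true).trans (h.sum_traceWeight_le true)
  have hωB : s.re * τ / (2 * (‖s‖ + R * β * (1 / s.re) * (2 * β) + α)) ^ 2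
      ≤ R * β * (1 / s.re) := by
    have h1 : s.re ≤ 2 * (‖s‖ + R * β * (1 / s.re) * (2 * β) + α) := by
      have : 0 ≤ R * β * (1 / s.re) * (2 * β) := by positivity
      linarith
    have h2 : s.re ^ 2 ≤ (2 * (‖s‖ + R * β * (1 / s.re) * (2 * β) + α)) ^ 2 :=
      pow_le_pow_left₀ hs.le h1 2
    have h3 : 0 ≤ R * β := by positivity
    calc _ ≤ s.re * (R * β) / s.re ^ 2 := by gcongr
      _ = _ := by field_simp
  have := fixedPoint_stability hs (skewBlock_conjTranspose A) h.shiftWeight_nonneg h.pos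
    h.traceWeight_nonneg h'.pos h'.le_trace
    (fun k => by
      rw [Fintype.sum_bool]
      linarith [h.shiftWeight_le true k, h.shiftWeight_le false k])
    h'.nonneg h'.row_le (by positivity : 0 ≤ 2 * β) hε hx hy hxB hyB hωB hxε hyε b
  rwa [stabConst, one_div_one_div]

/-- Uniqueness of the fixed point. -/
theorem IsFixedPoint.unique {A : Matrix m n ℂ} (h : WeightBounds d d' ν β R) {τ α : ℝ}
    (h' : ShapeBounds A d d' ν τ α) (hs : 0 < s.re) {x y : Bool → ℂ}
    (hx : IsFixedPoint A d d' ν s x) (hy : IsFixedPoint A d d' ν s y) : x = y := by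
  funext b
  have := norm_sub_le_stabConst A h h' hs le_rfl hx.re_nonneg hy.re_nonneg (hx.norm_le h hs)
    (hy.norm_le h hs) (fun b => by rw [← hx.eq b]; simp) (fun b => by rw [← hy.eq b]; simp) b
  rw [mul_zero] at this
  exact sub_eq_zero.1 (norm_le_zero_iff.1 this)

lemma norm_form_shiftRes_sub_le (h : WeightBounds d d' ν β R) (hs : 0 < s.re) {x y : Bool → ℂ}
    (hx : ∀ b, 0 ≤ (x b).re) (hy : ∀ b, 0 ≤ (y b).re) {δ : ℝ} (hδ : ∀ b, ‖x b - y b‖ ≤ δ)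
    (u v : m ⊕ n → ℂ) :
    ‖u ⬝ᵥ (shiftRes (shiftWeight d d') (skewBlock A) s x *ᵥ v)
        - u ⬝ᵥ (shiftRes (shiftWeight d d') (skewBlock A) s y *ᵥ v)‖
      ≤ 2 * δ * β * (1 / s.re) ^ 2 * (√(normSq2 u) * √(normSq2 v)) := by
  have hδ0 : 0 ≤ δ := (norm_nonneg _).trans (hδ true)
  have hβ := h.bound_nonneg
  set L := 1 / s.re with hL
  have hL0 : 0 < L := by positivity
  have hax := shift_accretive (s := s) (skewBlock_conjTranspose A) h.shiftWeight_nonneg hx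
  have hay := shift_accretive (s := s) (skewBlock_conjTranspose A) h.shiftWeight_nonneg hy
  have h1 : √(normSq2 (u ᵥ* shiftRes (shiftWeight d d') (skewBlock A) s x))
      ≤ L * √(normSq2 u) := by
    have := Real.sqrt_le_sqrt (hax.normSq2_vecMul_inv_le hs u)
    rwa [Real.sqrt_mul (by positivity), Real.sqrt_sq hL0.le] at this
  have h2 : √(normSq2 (shiftRes (shiftWeight d d') (skewBlock A) s y *ᵥ v))
      ≤ L * √(normSq2 v) := by
    have := Real.sqrt_le_sqrt (hay.normSq2_inv_mulVec_le hs v)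
    rwa [Real.sqrt_mul (by positivity), Real.sqrt_sq hL0.le] at this
  have h3 : ∀ k, ‖∑ b, (y b - x b) * (shiftWeight d d' b k : ℂ)‖ ≤ 2 * δ * β := by
    intro k
    rw [Fintype.sum_bool]
    refine (norm_add_le _ _).trans ?_
    have : ∀ b, ‖(y b - x b) * (shiftWeight d d' b k : ℂ)‖ ≤ δ * β := by
      intro b
      rw [norm_mul, Complex.norm_real, Real.norm_of_nonneg (h.shiftWeight_nonneg _ _),
        norm_sub_rev]
      exact mul_le_mul (hδ b) (h.shiftWeight_le b k) (h.shiftWeight_nonneg _ _) hδ0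
    linarith [this true, this false]
  rw [← dotProduct_sub, ← Matrix.sub_mulVec, shiftRes_sub hs (skewBlock_conjTranspose A)
    h.shiftWeight_nonneg hx hy, ← Matrix.mulVec_mulVec, ← Matrix.mulVec_mulVec,
    Matrix.dotProduct_mulVec]
  refine (norm_dotProduct_diagonal_mulVec_le (by positivity) h3 _ _).trans ?_
  calc _ ≤ 2 * δ * β * ((L * √(normSq2 u)) * (L * √(normSq2 v))) := by gcongr
    _ = _ := by ring

variable (μ : m × n → Measure ℂ) [∀ k, IsProbabilityMeasure (μ k)]

/-- The constant in `norm_integral_form_sub_fixedPoint_le`. -/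
def shiftConst (Mo β R τ α S L : ℝ) : ℝ :=
  biasConst Mo β R L * (1 + 2 * L ^ 2 * β ^ 2 * R * stabConst β R τ α S L)

theorem norm_meanTrace_sub_fixedPoint_le (h : WeightBounds d d' ν β R) {τ α Mo : ℝ}
    (h' : ShapeBounds A d d' ν τ α) (hs : 0 < s.re) (hMo : 0 ≤ Mo)
    (hμ : ∀ k, EntryLaw 1 Mo (μ k)) {y : Bool → ℂ} (hy : IsFixedPoint A d d' ν s y) (b : Bool) :
    ‖meanTrace A μ d d' ν s b - y b‖ ≤ stabConst β R τ α ‖s‖ (1 / s.re)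
      * (R * β * (biasConst Mo β R (1 / s.re) / √ν)) := by
  have hε : 0 ≤ R * β * (biasConst Mo β R (1 / s.re) / √ν) :=
    (norm_nonneg _).trans (norm_meanTrace_sub_wtr_le A μ h hs hMo hμ true)
  exact norm_sub_le_stabConst A h h' hs hε (meanTrace_re_nonneg A μ h hs) hy.re_nonneg
    (norm_meanTrace_le A μ h hs) (hy.norm_le h hs) (norm_meanTrace_sub_wtr_le A μ h hs hMo hμ)
    (fun b => by rw [← hy.eq b]; simpa using hε) b

/-- The mean resolvent is close to the deterministic equivalent. -/
theorem norm_integral_form_sub_fixedPoint_le (h : WeightBounds d d' ν β R) {τ α Mo : ℝ}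
    (h' : ShapeBounds A d d' ν τ α) (hs : 0 < s.re) (hMo : 0 ≤ Mo)
    (hμ : ∀ k, EntryLaw 1 Mo (μ k)) {y : Bool → ℂ} (hy : IsFixedPoint A d d' ν s y)
    (u v : m ⊕ n → ℂ) :
    ‖(∫ x, u ⬝ᵥ (linRes (noiseWeight d d' ν) A s x *ᵥ v) ∂(Measure.pi μ))
        - u ⬝ᵥ (shiftRes (shiftWeight d d') (skewBlock A) s y *ᵥ v)‖
      ≤ shiftConst Mo β R τ α ‖s‖ (1 / s.re) / √ν * (√(normSq2 u) * √(normSq2 v)) := by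
  have h1 := norm_integral_form_sub_le A μ h hs hMo hμ u v
  have h2 := norm_form_shiftRes_sub_le A h hs (meanTrace_re_nonneg A μ h hs) hy.re_nonneg
    (norm_meanTrace_sub_fixedPoint_le A μ h h' hs hMo hμ hy) u v
  refine (norm_sub_le_norm_sub_add_norm_sub _ _ _).trans ((add_le_add h1 h2).trans_eq ?_)
  rw [shiftConst]; ring

/-- The constant in `integral_form_sub_fixedPoint_pow_le`. -/
def totalConst (q : ℕ) (Mo β R τ α S L : ℝ) : ℝ :=
  4 ^ (q + 1) * (momentConst q * concConst Mo (β ^ 2) R L ^ (q + 1)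
    + (shiftConst Mo β R τ α S L ^ 2) ^ (q + 1))

/-- Moment bound for the distance of a resolvent form to its deterministic equivalent. -/
theorem integral_form_sub_fixedPoint_pow_le (q : ℕ) (h : WeightBounds d d' ν β R) {τ α Mo : ℝ}
    (h' : ShapeBounds A d d' ν τ α) (hs : 0 < s.re) (hMo : 0 ≤ Mo)
    (hμ : ∀ k, EntryLaw 1 Mo (μ k)) (hμq : ∀ k, EntryLaw (q + 1) Mo (μ k)) {y : Bool → ℂ}
    (hy : IsFixedPoint A d d' ν s y) (u v : m ⊕ n → ℂ) :
    ∫ x, (‖u ⬝ᵥ (linRes (noiseWeight d d' ν) A s x *ᵥ v)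
        - u ⬝ᵥ (shiftRes (shiftWeight d d') (skewBlock A) s y *ᵥ v)‖ ^ 2) ^ (q + 1)
        ∂(Measure.pi μ)
      ≤ totalConst q Mo β R τ α ‖s‖ (1 / s.re) * (normSq2 u * normSq2 v / ν) ^ (q + 1) := by
  set P := Measure.pi μ with hP
  set F : (m × n → ℂ) → ℂ := fun x => u ⬝ᵥ (linRes (noiseWeight d d' ν) A s x *ᵥ v) with hF
  set t := u ⬝ᵥ (shiftRes (shiftWeight d d') (skewBlock A) s y *ᵥ v) with ht
  set e := (∫ x, F x ∂P) - t with he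
  have hν := h.pos
  have hFb : BddMeas F := bddMeas_linRes_form _ A hs u v
  have hpt : ∀ x, (‖F x - t‖ ^ 2) ^ (q + 1)
      ≤ 4 ^ (q + 1) * (‖F x - ∫ y, F y ∂P‖ ^ 2) ^ (q + 1) + 4 ^ (q + 1) * (‖e‖ ^ 2) ^ (q + 1) := by
    intro x
    set a := ‖F x - ∫ y, F y ∂P‖ with ha
    have h1 : ‖F x - t‖ ≤ a + ‖e‖ := norm_sub_le_norm_sub_add_norm_sub _ _ _
    have h2 : ‖F x - t‖ ^ 2 ≤ 2 * a ^ 2 + 2 * ‖e‖ ^ 2 := by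
      calc _ ≤ (a + ‖e‖) ^ 2 := pow_le_pow_left₀ (norm_nonneg _) h1 2
        _ ≤ _ := by nlinarith [sq_nonneg (a - ‖e‖)]
    calc _ ≤ (2 * a ^ 2 + 2 * ‖e‖ ^ 2) ^ (q + 1) := pow_le_pow_left₀ (by positivity) h2 _
      _ ≤ 2 ^ (q + 1 - 1) * ((2 * a ^ 2) ^ (q + 1) + (2 * ‖e‖ ^ 2) ^ (q + 1)) :=
          add_pow_le (by positivity) (by positivity) _
      _ ≤ 2 ^ (q + 1) * ((2 * a ^ 2) ^ (q + 1) + (2 * ‖e‖ ^ 2) ^ (q + 1)) := by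
          gcongr
          · norm_num
          · omega
      _ = _ := by
          rw [mul_pow, mul_pow, ← mul_add, ← mul_assoc, ← mul_pow, mul_add]; norm_num
  have hconc := concentration A μ q hs h.one_le (sq_nonneg β) hMo h.noiseWeight_sq_le
      h.card_le hμq u v
  have hbias : (‖e‖ ^ 2) ^ (q + 1) ≤ (shiftConst Mo β R τ α ‖s‖ (1 / s.re) ^ 2) ^ (q + 1)
      * (normSq2 u * normSq2 v / ν) ^ (q + 1) := by
    rw [← mul_pow]
    refine pow_le_pow_left₀ (by positivity) ?_ _
    calc ‖e‖ ^ 2 ≤ (shiftConst Mo β R τ α ‖s‖ (1 / s.re) / √ν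
          * (√(normSq2 u) * √(normSq2 v))) ^ 2 :=
          pow_le_pow_left₀ (norm_nonneg _)
            (norm_integral_form_sub_fixedPoint_le A μ h h' hs hMo hμ hy u v) 2
      _ = _ := by
          rw [mul_pow, div_pow, mul_pow, Real.sq_sqrt hν.le, Real.sq_sqrt (normSq2_nonneg _),
            Real.sq_sqrt (normSq2_nonneg _)]
          ring
  have hi : Integrable (fun x => (‖F x - ∫ y, F y ∂P‖ ^ 2) ^ (q + 1)) P :=
    (((hFb.sub (BddMeas.const _)).norm.pow 2).pow (q + 1)).integrable P
  calc _ ≤ ∫ x, (4 ^ (q + 1) * (‖F x - ∫ y, F y ∂P‖ ^ 2) ^ (q + 1)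
        + 4 ^ (q + 1) * (‖e‖ ^ 2) ^ (q + 1)) ∂P :=
        integral_mono ((((hFb.sub (BddMeas.const _)).norm.pow 2).pow (q + 1)).integrable P)
          ((hi.const_mul _).add (integrable_const _)) hpt
    _ = 4 ^ (q + 1) * ∫ x, (‖F x - ∫ y, F y ∂P‖ ^ 2) ^ (q + 1) ∂P
        + 4 ^ (q + 1) * (‖e‖ ^ 2) ^ (q + 1) := by
        rw [integral_add (hi.const_mul _) (integrable_const _), integral_const_mul]
        simp
    _ ≤ 4 ^ (q + 1) * (momentConst q
          * (concConst Mo (β ^ 2) R (1 / s.re) * (normSq2 u * normSq2 v) / ν) ^ (q + 1))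
        + 4 ^ (q + 1) * ((shiftConst Mo β R τ α ‖s‖ (1 / s.re) ^ 2) ^ (q + 1)
          * (normSq2 u * normSq2 v / ν) ^ (q + 1)) := by gcongr
    _ = _ := by rw [totalConst, mul_div_assoc, mul_pow (concConst _ _ _ _)]; ring

end Comparison

end

section Schur

variable {m n : Type*} [Fintype m] [DecidableEq m] [Fintype n] [DecidableEq n]
  {θ : m ⊕ n → ℂ} {S : Matrix m n ℂ} {W : Matrix (m ⊕ n) (m ⊕ n) ℂ}

lemma diagonal_add_skewBlock (θ : m ⊕ n → ℂ) (S : Matrix m n ℂ) :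
    Matrix.diagonal θ + skewBlock S
      = Matrix.fromBlocks (Matrix.diagonal fun i => θ (Sum.inl i)) S (-Sᴴ)
        (Matrix.diagonal fun j => θ (Sum.inr j)) := by
  have : Matrix.diagonal θ = Matrix.fromBlocks (Matrix.diagonal fun i => θ (Sum.inl i)) 0 0
      (Matrix.diagonal fun j => θ (Sum.inr j)) := by
    rw [Matrix.fromBlocks_diagonal]
    congr 1
    funext k
    rcases k with k | k <;> rfl
  rw [this, skewBlock, Matrix.fromBlocks_add]
  simp

lemma block_equations (hW : (Matrix.diagonal θ + skewBlock S) * W = 1) :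
    (Matrix.diagonal (fun i => θ (Sum.inl i)) * W.toBlocks₁₁ + S * W.toBlocks₂₁ = 1 ∧
      Matrix.diagonal (fun i => θ (Sum.inl i)) * W.toBlocks₁₂ + S * W.toBlocks₂₂ = 0) ∧
    (-Sᴴ * W.toBlocks₁₁ + Matrix.diagonal (fun j => θ (Sum.inr j)) * W.toBlocks₂₁ = 0 ∧
      -Sᴴ * W.toBlocks₁₂ + Matrix.diagonal (fun j => θ (Sum.inr j)) * W.toBlocks₂₂ = 1) := by
  rw [diagonal_add_skewBlock, ← Matrix.fromBlocks_toBlocks W, Matrix.fromBlocks_multiply,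
    ← Matrix.fromBlocks_one, Matrix.fromBlocks_inj] at hW
  exact ⟨⟨hW.1, hW.2.1⟩, hW.2.2⟩

lemma diagonal_inv_mul_diagonal {I : Type*} [Fintype I] [DecidableEq I] {θ : I → ℂ}
    (hθ : ∀ i, θ i ≠ 0) :
    Matrix.diagonal (fun i => (θ i)⁻¹) * Matrix.diagonal θ = 1 := by
  rw [Matrix.diagonal_mul_diagonal, ← Matrix.diagonal_one]
  congr 1
  funext i
  exact inv_mul_cancel₀ (hθ i)

/-- Schur complement for the first diagonal block. -/
lemma schur_toBlocks₁₁ (hθ : ∀ j, θ (Sum.inr j) ≠ 0)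
    (hW : (Matrix.diagonal θ + skewBlock S) * W = 1) :
    (Matrix.diagonal (fun i => θ (Sum.inl i))
      + S * Matrix.diagonal (fun j => (θ (Sum.inr j))⁻¹) * Sᴴ) * W.toBlocks₁₁ = 1 := by
  obtain ⟨⟨h1, -⟩, h2, -⟩ := block_equations hW
  have h3 : W.toBlocks₂₁ = Matrix.diagonal (fun j => (θ (Sum.inr j))⁻¹) * (Sᴴ * W.toBlocks₁₁) := by
    rw [Matrix.neg_mul, neg_add_eq_zero] at h2
    rw [h2, ← Matrix.mul_assoc, diagonal_inv_mul_diagonal hθ, Matrix.one_mul]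
  rw [← h1, h3, Matrix.add_mul]
  simp only [Matrix.mul_assoc]

/-- Schur complement for the second diagonal block. -/
lemma schur_toBlocks₂₂ (hθ : ∀ i, θ (Sum.inl i) ≠ 0)
    (hW : (Matrix.diagonal θ + skewBlock S) * W = 1) :
    (Matrix.diagonal (fun j => θ (Sum.inr j))
      + Sᴴ * Matrix.diagonal (fun i => (θ (Sum.inl i))⁻¹) * S) * W.toBlocks₂₂ = 1 := by
  obtain ⟨⟨-, h1⟩, -, h2⟩ := block_equations hW
  have h3 : W.toBlocks₁₂
      = -(Matrix.diagonal (fun i => (θ (Sum.inl i))⁻¹) * (S * W.toBlocks₂₂)) := by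
    have h4 : S * W.toBlocks₂₂ = -(Matrix.diagonal (fun i => θ (Sum.inl i)) * W.toBlocks₁₂) :=
      eq_neg_of_add_eq_zero_right h1
    rw [h4, Matrix.mul_neg, neg_neg, ← Matrix.mul_assoc, diagonal_inv_mul_diagonal hθ,
      Matrix.one_mul]
  rw [← h2, h3, Matrix.add_mul, Matrix.neg_mul, Matrix.mul_neg, neg_neg, add_comm]
  simp only [Matrix.mul_assoc]

end Schur

section Spectral

open MeasureTheory

open scoped ComplexOrder unitInterval

variable {J : Type*} [Fintype J] [DecidableEq J]

lemma ofReal_add_sq_ne_zero {s : ℂ} (hs : 0 < s.re) {t : ℝ} (ht : 0 ≤ t) :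
    (t : ℂ) + s ^ 2 ≠ 0 := by
  intro h
  have h1 := congrArg Complex.re h
  have h2 := congrArg Complex.im h
  simp [sq] at h1 h2
  have h3 : s.im = 0 := by
    rcases mul_eq_zero.1 (by linarith : s.re * s.im = 0) with h3 | h3
    · exact absurd h3 hs.ne'
    · exact h3
  rw [h3] at h1
  nlinarith [mul_pos hs hs]

/-- Diagonal entries of a resolvent of a positive semidefinite matrix are averages of poles. -/
lemma exists_spectral_weights {H : Matrix J J ℂ} (hH : H.PosSemidef) (i : J) :
    ∃ (w t : J → ℝ), (∀ l, 0 ≤ w l) ∧ (∀ l, 0 ≤ t l) ∧ ∑ l, w l = 1 ∧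
      ∀ (s : ℂ) (X : Matrix J J ℂ), 0 < s.re → (s ^ 2 • 1 + H) * X = s • 1 →
        X i i = ∑ l, (w l : ℂ) * (s / (t l + s ^ 2)) := by
  set U : Matrix J J ℂ := (hH.isHermitian.eigenvectorUnitary : Matrix J J ℂ) with hU
  set t := hH.isHermitian.eigenvalues with ht
  have ht0 : ∀ l, 0 ≤ t l := hH.eigenvalues_nonneg
  have hUU : U * Uᴴ = 1 := Unitary.mul_star_self_of_mem (hH.isHermitian.eigenvectorUnitary).2
  have hUU' : Uᴴ * U = 1 := Unitary.star_mul_self_of_mem (hH.isHermitian.eigenvectorUnitary).2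
  have hspec : H = U * Matrix.diagonal (fun l => (t l : ℂ)) * Uᴴ := by
    have := hH.isHermitian.spectral_theorem
    rw [Unitary.conjStarAlgAut_apply] at this
    exact this
  refine ⟨fun l => ‖U i l‖ ^ 2, t, fun l => by positivity, ht0, ?_, fun s X hs hX => ?_⟩
  · have h1 := congrFun (congrFun hUU i) i
    rw [Matrix.mul_apply, Matrix.one_apply_eq] at h1
    have h2 : ∀ l, U i l * Uᴴ l i = ((‖U i l‖ ^ 2 : ℝ) : ℂ) := by
      intro l
      rw [Matrix.conjTranspose_apply, RCLike.star_def, Complex.mul_conj']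
      push_cast; rfl
    simp only [h2] at h1
    exact_mod_cast h1
  · set Y := U * Matrix.diagonal (fun l => ((t l : ℂ) + s ^ 2)⁻¹) * Uᴴ with hY
    have h1 : s ^ 2 • (1 : Matrix J J ℂ) + H
        = U * Matrix.diagonal (fun l => (t l : ℂ) + s ^ 2) * Uᴴ := by
      have : Matrix.diagonal (fun l => (t l : ℂ) + s ^ 2)
          = Matrix.diagonal (fun l => (t l : ℂ)) + s ^ 2 • (1 : Matrix J J ℂ) := by
        rw [← Matrix.diagonal_one, ← Matrix.diagonal_smul, Matrix.diagonal_add]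
        congr 1
        funext l
        simp
      rw [this, Matrix.mul_add, Matrix.add_mul, ← hspec, Matrix.mul_smul, Matrix.mul_one,
        Matrix.smul_mul, hUU, add_comm]
    have h2 : Y * (s ^ 2 • (1 : Matrix J J ℂ) + H) = 1 := by
      rw [h1, hY]
      calc _ = U * Matrix.diagonal (fun l => ((t l : ℂ) + s ^ 2)⁻¹) * (Uᴴ * U)
            * Matrix.diagonal (fun l => (t l : ℂ) + s ^ 2) * Uᴴ := by simp only [Matrix.mul_assoc]
        _ = U * (Matrix.diagonal (fun l => ((t l : ℂ) + s ^ 2)⁻¹)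
            * Matrix.diagonal (fun l => (t l : ℂ) + s ^ 2)) * Uᴴ := by
            rw [hUU', Matrix.mul_one]; simp only [Matrix.mul_assoc]
        _ = 1 := by
            rw [diagonal_inv_mul_diagonal fun l => ofReal_add_sq_ne_zero hs (ht0 l),
              Matrix.mul_one, hUU]
    have h3 : X = s • Y := by
      calc X = Y * (s ^ 2 • (1 : Matrix J J ℂ) + H) * X := by rw [h2, Matrix.one_mul]
        _ = s • Y := by rw [Matrix.mul_assoc, hX, Matrix.mul_smul, Matrix.mul_one]
    rw [h3, Matrix.smul_apply, hY, Matrix.mul_apply, smul_eq_mul, Finset.mul_sum]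
    refine Finset.sum_congr rfl fun l _ => ?_
    rw [Matrix.mul_diagonal, Matrix.conjTranspose_apply, RCLike.star_def]
    have h4 := Complex.mul_conj' (U i l)
    push_cast
    rw [← h4]; ring

/-- The Cauchy kernel `s / (t + s ^ 2)` in the coordinate `r = 1 / (1 + t)`. -/
def poleKernel (s : ℂ) (r : I) : ℂ :=
  s * ((r : ℝ) : ℂ) / (1 - ((r : ℝ) : ℂ) + s ^ 2 * ((r : ℝ) : ℂ))

lemma poleKernel_den_ne_zero {s : ℂ} (hs : 0 < s.re) (r : I) :
    1 - ((r : ℝ) : ℂ) + s ^ 2 * ((r : ℝ) : ℂ) ≠ 0 := by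
  rcases eq_or_lt_of_le r.2.1 with h | h
  · simp [← h]
  · have h1 := ofReal_add_sq_ne_zero hs (t := (1 - r) / r)
      (div_nonneg (sub_nonneg.2 r.2.2) r.2.1)
    have h2 : ((r : ℝ) : ℂ) ≠ 0 := by exact_mod_cast h.ne'
    have h3 : 1 - ((r : ℝ) : ℂ) + s ^ 2 * ((r : ℝ) : ℂ)
        = ((r : ℝ) : ℂ) * ((((1 - r) / r : ℝ) : ℂ) + s ^ 2) := by
      push_cast; field_simp
    rw [h3]
    exact mul_ne_zero h2 h1

lemma continuous_poleKernel {s : ℂ} (hs : 0 < s.re) : Continuous (poleKernel s) := by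
  unfold poleKernel
  refine Continuous.div (by fun_prop) (by fun_prop) (poleKernel_den_ne_zero hs)

lemma integrable_poleKernel {s : ℂ} (hs : 0 < s.re) (ρ : Measure I) [IsFiniteMeasure ρ] :
    Integrable (poleKernel s) ρ :=
  (continuous_poleKernel hs).integrable_of_hasCompactSupport
    (HasCompactSupport.of_compactSpace _)

/-- On the right half-plane `F` is the transform of a measure of mass at most `C`. -/
def IsPoleAverage (C : ℝ) (F : ℂ → ℂ) : Prop :=
  ∃ ρ : Measure I, IsFiniteMeasure ρ ∧ ρ.real Set.univ ≤ C ∧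
    ∀ s : ℂ, 0 < s.re → F s = ∫ r, poleKernel s r ∂ρ

lemma IsPoleAverage.congr {C : ℝ} {F G : ℂ → ℂ} (h : IsPoleAverage C F)
    (hFG : ∀ s : ℂ, 0 < s.re → G s = F s) : IsPoleAverage C G := by
  obtain ⟨ρ, h1, h2, h3⟩ := h
  exact ⟨ρ, h1, h2, fun s hs => (hFG s hs).trans (h3 s hs)⟩

lemma IsPoleAverage.mono {C C' : ℝ} {F : ℂ → ℂ} (h : IsPoleAverage C F) (hC : C ≤ C') :
    IsPoleAverage C' F := by
  obtain ⟨ρ, h1, h2, h3⟩ := h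
  exact ⟨ρ, h1, h2.trans hC, h3⟩

lemma isPoleAverage_pole {t : ℝ} (ht : 0 ≤ t) : IsPoleAverage 1 fun s => s / (t + s ^ 2) := by
  have h1 : 0 < 1 + t := by linarith
  refine ⟨Measure.dirac ⟨1 / (1 + t), by positivity, by rw [div_le_one h1]; linarith⟩,
    inferInstance, by simp, fun s hs => ?_⟩
  rw [integral_dirac, poleKernel]
  have h2 : (1 + (t : ℂ)) ≠ 0 := by exact_mod_cast h1.ne'
  have h3 := ofReal_add_sq_ne_zero hs ht
  push_cast
  have h4 : 1 - 1 / (1 + (t : ℂ)) + s ^ 2 * (1 / (1 + t)) = (t + s ^ 2) / (1 + t) := by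
    field_simp; ring
  rw [h4]
  field_simp

lemma IsPoleAverage.add {C C' : ℝ} {F G : ℂ → ℂ} (hF : IsPoleAverage C F)
    (hG : IsPoleAverage C' G) : IsPoleAverage (C + C') fun s => F s + G s := by
  obtain ⟨ρ, h1, h2, h3⟩ := hF
  obtain ⟨ρ', h1', h2', h3'⟩ := hG
  refine ⟨ρ + ρ', inferInstance, ?_, fun s hs => ?_⟩
  · rw [measureReal_add_apply]; exact add_le_add h2 h2'
  · beta_reduce
    rw [h3 s hs, h3' s hs, integral_add_measure (integrable_poleKernel hs ρ)
      (integrable_poleKernel hs ρ')]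

lemma IsPoleAverage.const_mul {C : ℝ} {F : ℂ → ℂ} (hF : IsPoleAverage C F) {w : ℝ}
    (hw : 0 ≤ w) : IsPoleAverage (w * C) fun s => w * F s := by
  obtain ⟨ρ, h1, h2, h3⟩ := hF
  lift w to NNReal using hw
  refine ⟨w • ρ, inferInstance, ?_, fun s hs => ?_⟩
  · rw [measureReal_nnreal_smul_apply]
    exact mul_le_mul_of_nonneg_left h2 w.2
  · beta_reduce
    rw [h3 s hs, integral_smul_nnreal_measure]
    simp [NNReal.smul_def]

lemma IsPoleAverage.sum {J : Type*} (T : Finset J) {C : ℝ} {F : J → ℂ → ℂ}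
    (hF : ∀ l, IsPoleAverage C (F l)) {w : J → ℝ} (hw : ∀ l, 0 ≤ w l) :
    IsPoleAverage ((∑ l ∈ T, w l) * C) fun s => ∑ l ∈ T, (w l : ℂ) * F l s := by
  classical
  induction T using Finset.induction_on with
  | empty => exact ⟨0, inferInstance, by simp, fun s _ => by simp⟩
  | insert a T ha ih =>
    simp only [Finset.sum_insert ha, add_mul]
    exact ((hF a).const_mul (hw a)).add ih

/-- A uniformly bounded sequence of pole averages has a limit along an ultrafilter. -/
lemma IsPoleAverage.exists_limit {C : ℝ} {F : ℕ → ℂ → ℂ} (hF : ∀ k, IsPoleAverage C (F k))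
    (𝒰 : Ultrafilter ℕ) : ∃ G, IsPoleAverage C G ∧
      ∀ s : ℂ, 0 < s.re → Filter.Tendsto (fun k => F k s) 𝒰 (nhds (G s)) := by
  choose ρ h1 h2 h3 using hF
  have hC : 0 ≤ C := (measureReal_nonneg).trans (h2 0)
  set ρ' : ℕ → FiniteMeasure I := fun k => ⟨ρ k, h1 k⟩ with hρ'
  have hmem : ∀ k, ρ' k ∈ {μ : FiniteMeasure I | μ.mass ≤ C.toNNReal} := by
    intro k
    rw [Set.mem_ofPred_eq, ← NNReal.coe_le_coe, Real.coe_toNNReal C hC]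
    exact h2 k
  obtain ⟨π₀, hπ₀, hlim⟩ := (isCompact_setOfPred_finiteMeasure_le_of_compactSpace
    (E := I) C.toNNReal).ultrafilter_le_nhds' (𝒰.map ρ')
    (Ultrafilter.mem_map.2 (Filter.univ_mem' hmem))
  refine ⟨fun s => ∫ r, poleKernel s r ∂(π₀ : Measure I), ⟨π₀, inferInstance, ?_, fun s _ => rfl⟩,
    fun s hs => ?_⟩
  · rw [Set.mem_ofPred_eq, ← NNReal.coe_le_coe, Real.coe_toNNReal C hC] at hπ₀
    exact hπ₀
  · have hl : Filter.Tendsto ρ' 𝒰 (nhds π₀) := hlim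
    have := (FiniteMeasure.tendsto_iff_forall_integral_rclike_tendsto ℂ).1 hl
      (BoundedContinuousFunction.mkOfCompact ⟨poleKernel s, continuous_poleKernel hs⟩)
    simp only [h3 _ s hs]
    exact this

variable {m n : Type*} [Fintype m] [DecidableEq m] [Fintype n] [DecidableEq n]

lemma scaled_equation {s : ℂ} (hs : 0 < s.re) {H X : Matrix m m ℂ}
    (h : (Matrix.diagonal (fun _ => s) + s⁻¹ • H) * X = 1) : (s ^ 2 • 1 + H) * X = s • 1 := by
  have hs0 : s ≠ 0 := fun h => by simp [h] at hs
  have h1 : s ^ 2 • (1 : Matrix m m ℂ) + H = s • (Matrix.diagonal (fun _ => s) + s⁻¹ • H) := by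
    rw [smul_add, smul_smul, mul_inv_cancel₀ hs0, one_smul, ← Matrix.diagonal_one,
      ← Matrix.diagonal_smul, ← Matrix.diagonal_smul]
    congr 2
    funext i
    simp [sq]
  rw [h1, Matrix.smul_mul, h]

lemma mul_diagonal_const_mul (s : ℂ) (B : Matrix m n ℂ) (B' : Matrix n m ℂ) :
    B * (Matrix.diagonal (fun _ => s) : Matrix n n ℂ) * B' = s • (B * B') := by
  rw [← Matrix.smul_one_eq_diagonal, Matrix.mul_smul, Matrix.mul_one, Matrix.smul_mul]

lemma isPoleAverage_of_posSemidef {H : Matrix m m ℂ} (hH : H.PosSemidef) (i : m)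
    {X : ℂ → Matrix m m ℂ} (hX : ∀ s : ℂ, 0 < s.re → (s ^ 2 • 1 + H) * X s = s • 1) :
    IsPoleAverage 1 fun s => X s i i := by
  obtain ⟨w, t, hw, ht, h1, h2⟩ := exists_spectral_weights hH i
  have := IsPoleAverage.sum Finset.univ (fun l => isPoleAverage_pole (ht l)) hw
  rw [h1, one_mul] at this
  exact this.congr fun s hs => h2 s _ hs (hX s hs)

/-- Diagonal entries of the inverse of a linearized matrix are averages of poles. -/
lemma isPoleAverage_linearized (S : Matrix m n ℂ) (k : m ⊕ n) :
    IsPoleAverage 1 fun s =>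
      ((Matrix.diagonal (fun _ => s) + skewBlock S)⁻¹ : Matrix (m ⊕ n) (m ⊕ n) ℂ) k k := by
  have hW : ∀ s : ℂ, 0 < s.re → (Matrix.diagonal (fun _ => s) + skewBlock S)
      * (Matrix.diagonal (fun _ => s) + skewBlock S)⁻¹ = 1 := fun s hs =>
    (accretive_diagonal_add (skewBlock_conjTranspose S) (fun _ => le_rfl)).mul_inv hs
  have hs0 : ∀ {s : ℂ}, 0 < s.re → s ≠ 0 := fun hs h => by simp [h] at hs
  rcases k with i | j
  · refine isPoleAverage_of_posSemidef (Matrix.posSemidef_self_mul_conjTranspose S) i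
      (X := fun s => (Matrix.diagonal (fun _ => s) + skewBlock S)⁻¹.toBlocks₁₁) fun s hs => ?_
    have h2 := schur_toBlocks₁₁ (fun _ => hs0 hs) (hW s hs)
    rw [mul_diagonal_const_mul] at h2
    exact scaled_equation hs h2
  · refine isPoleAverage_of_posSemidef (Matrix.posSemidef_conjTranspose_mul_self S) j
      (X := fun s => (Matrix.diagonal (fun _ => s) + skewBlock S)⁻¹.toBlocks₂₂) fun s hs => ?_
    have h2 := schur_toBlocks₂₂ (fun _ => hs0 hs) (hW s hs)
    rw [mul_diagonal_const_mul] at h2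
    exact scaled_equation hs h2

end Spectral

section Signs

open MeasureTheory

/-- The fair coin. -/
def coin : Measure Bool := (2⁻¹ : ENNReal) • Measure.count

instance : IsProbabilityMeasure coin := ⟨by
  rw [coin, Measure.smul_apply, Measure.count_univ]
  simp [ENNReal.inv_mul_cancel]⟩

/-- The symmetric law on `{1, -1}`. -/
def signLaw : Measure ℂ := coin.map fun b => cond b 1 (-1)

instance : IsProbabilityMeasure signLaw :=
  Measure.isProbabilityMeasure_map (measurable_of_finite _).aemeasurable

lemma integral_signLaw {F : Type*} [NormedAddCommGroup F] [NormedSpace ℝ F] [CompleteSpace F]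
    {f : ℂ → F} (hf : AEStronglyMeasurable f signLaw) :
    ∫ e, f e ∂signLaw = (2⁻¹ : ℝ) • (f 1 + f (-1)) := by
  rw [signLaw, integral_map (measurable_of_finite _).aemeasurable
    hf, integral_fintype Integrable.of_finite]
  simp [coin, Measure.real]

lemma entryLaw_signLaw : EntryLaw 1 1 signLaw where
  mean_zero := by rw [integral_signLaw (f := fun e => e) (by fun_prop)]; simp
  variance_one := by rw [integral_signLaw (by fun_prop)]; norm_num
  integrable_moment := by
    rw [signLaw, integrable_map_measure (by fun_prop) (measurable_of_finite _).aemeasurable]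
    exact Integrable.of_finite
  moment_le := by rw [integral_signLaw (by fun_prop)]; norm_num

lemma integral_pi_signLaw {ι : Type*} [Fintype ι] [DecidableEq ι] {f : (ι → ℂ) → ℂ}
    (hf : Measurable f) :
    ∫ x, f x ∂(Measure.pi fun _ : ι => signLaw)
      = ∑ σ : ι → Bool, ((Measure.pi fun _ : ι => coin).real {σ} : ℂ)
        * f fun k => cond (σ k) 1 (-1) := by
  have h1 : (Measure.pi fun _ : ι => signLaw)
      = (Measure.pi fun _ : ι => coin).map fun σ k => cond (σ k) (1 : ℂ) (-1) :=
    (Measure.pi_map_pi (μ := fun _ : ι => coin) (f := fun _ b => cond b (1 : ℂ) (-1))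
      fun _ => (measurable_of_finite _).aemeasurable).symm
  rw [h1, integral_map (measurable_of_finite _).aemeasurable hf.aestronglyMeasurable,
    integral_fintype Integrable.of_finite]
  simp

end Signs

section BlowUp

open MeasureTheory
open scoped Kronecker

variable {m n K : Type*} [Fintype m] [DecidableEq m] [Fintype n] [DecidableEq n]
  [Fintype K] [DecidableEq K] {d : m → ℝ} {d' : n → ℝ} {ν β R : ℝ} {A : Matrix m n ℂ} {s : ℂ}

/-- `K` copies of a block index. -/
def blowEquiv (m n K : Type*) : (m × K) ⊕ (n × K) ≃ (m ⊕ n) × K :=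
  (Equiv.sumProdDistrib m n K).symm

lemma traceWeight_blow (b : Bool) (k : (m × K) ⊕ (n × K)) :
    traceWeight (fun i : m × K => d i.1) (fun j : n × K => d' j.1) b k
      = traceWeight d d' b (blowEquiv m n K k).1 := by
  cases b <;> rcases k with k | k <;> rfl

lemma shiftWeight_blow (b : Bool) (k : (m × K) ⊕ (n × K)) :
    shiftWeight (fun i : m × K => d i.1) (fun j : n × K => d' j.1) b k
      = shiftWeight d d' b (blowEquiv m n K k).1 :=
  traceWeight_blow _ _

lemma WeightBounds.blow [Nonempty K] (h : WeightBounds d d' ν β R) :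
    WeightBounds (fun i : m × K => d i.1) (fun j : n × K => d' j.1) (ν * Fintype.card K) β R where
  one_le := by
    have h1 : (1 : ℝ) ≤ Fintype.card K := by exact_mod_cast Fintype.card_pos
    nlinarith [h.one_le]
  nonneg _ := h.nonneg _
  nonneg' _ := h.nonneg' _
  le _ := h.le _
  le' _ := h.le' _
  bound_nonneg := h.bound_nonneg
  card_le := by
    rw [Fintype.card_prod, Fintype.card_prod]
    push_cast
    have := mul_le_mul_of_nonneg_right h.card_le (Nat.cast_nonneg (α := ℝ) (Fintype.card K))
    linarith

lemma shiftRes_blow (s : ℂ) (x : Bool → ℂ) :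
    shiftRes (shiftWeight (fun i : m × K => d i.1) (fun j : n × K => d' j.1))
        (skewBlock (A ⊗ₖ (1 : Matrix K K ℂ))) s x
      = (shiftRes (shiftWeight d d') (skewBlock A) s x ⊗ₖ (1 : Matrix K K ℂ)).submatrix
          (blowEquiv m n K) (blowEquiv m n K) := by
  have h1 : Matrix.diagonal (shiftDiag
        (shiftWeight (fun i : m × K => d i.1) (fun j : n × K => d' j.1)) s x)
        + skewBlock (A ⊗ₖ (1 : Matrix K K ℂ))
      = ((Matrix.diagonal (shiftDiag (shiftWeight d d') s x) + skewBlock A)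
          ⊗ₖ (1 : Matrix K K ℂ)).submatrix (blowEquiv m n K) (blowEquiv m n K) := by
    rw [Matrix.add_kronecker, Matrix.submatrix_add, Pi.add_apply, Pi.add_apply]
    congr 1
    · rw [← Matrix.diagonal_one, Matrix.diagonal_kronecker_diagonal,
        Matrix.submatrix_diagonal_equiv]
      congr 1
      funext k
      simp only [shiftDiag, shiftWeight_blow, Function.comp, mul_one]
    · ext i j
      rcases i with ⟨i, a⟩ | ⟨i, a⟩ <;> rcases j with ⟨j, b⟩ | ⟨j, b⟩ <;>
        rcases eq_or_ne a b with rfl | hab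
      all_goals simp [skewBlock, blowEquiv, Matrix.kroneckerMap_apply]
      all_goals simp [hab, hab.symm]
  rw [shiftRes, h1, Matrix.inv_submatrix_equiv, Matrix.inv_kronecker, inv_one, shiftRes]

lemma wtr_blow [Nonempty K] (g : m ⊕ n → ℝ) (W : Matrix (m ⊕ n) (m ⊕ n) ℂ) :
    wtr (ν * Fintype.card K) (fun k => g (blowEquiv m n K k).1)
        ((W ⊗ₖ (1 : Matrix K K ℂ)).submatrix (blowEquiv m n K) (blowEquiv m n K))
      = wtr ν g W := by
  have hK : ((Fintype.card K : ℝ) : ℂ) ≠ 0 := by exact_mod_cast Fintype.card_ne_zero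
  have h1 : ∑ k, (g (blowEquiv m n K k).1 : ℂ)
        * (W ⊗ₖ (1 : Matrix K K ℂ)).submatrix (blowEquiv m n K) (blowEquiv m n K) k k
      = (Fintype.card K : ℝ) * ∑ k, (g k : ℂ) * W k k := by
    simp only [Matrix.submatrix_apply]
    rw [(blowEquiv m n K).sum_comp (fun k => (g k.1 : ℂ) * (W ⊗ₖ (1 : Matrix K K ℂ)) k k),
      Fintype.sum_prod_type, Finset.mul_sum]
    refine Finset.sum_congr rfl fun k _ => ?_
    simp [Matrix.kroneckerMap_apply]
  rw [wtr, wtr, h1]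
  push_cast at hK ⊢
  rw [mul_inv, mul_assoc, inv_mul_cancel_left₀ hK]

lemma wtr_shiftRes_blow [Nonempty K] (s : ℂ) (x : Bool → ℂ) (b : Bool) :
    wtr (ν * Fintype.card K) (traceWeight (fun i : m × K => d i.1) (fun j : n × K => d' j.1) b)
      (shiftRes (shiftWeight (fun i : m × K => d i.1) (fun j : n × K => d' j.1))
        (skewBlock (A ⊗ₖ (1 : Matrix K K ℂ))) s x)
      = wtr ν (traceWeight d d' b) (shiftRes (shiftWeight d d') (skewBlock A) s x) := by
  rw [shiftRes_blow, ← wtr_blow (K := K) (traceWeight d d' b)]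
  congr 1
  funext k
  exact traceWeight_blow b k

end BlowUp

section Existence

open MeasureTheory
open scoped Kronecker

variable {m n : Type*} [Fintype m] [DecidableEq m] [Fintype n] [DecidableEq n]
  {d : m → ℝ} {d' : n → ℝ} {ν β R : ℝ}

/-- Mean traces for random signs are averages of poles. -/
lemma isPoleAverage_meanTrace (h : WeightBounds d d' ν β R) (A : Matrix m n ℂ) (b : Bool) :
    IsPoleAverage (R * β) fun s => meanTrace A (fun _ => signLaw) d d' ν s b := by
  have hν := h.pos
  have h1 : ∀ σ : m × n → Bool, IsPoleAverage (R * β) fun s => wtr ν (traceWeight d d' b)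
      (linRes (noiseWeight d d' ν) A s fun k => cond (σ k) 1 (-1)) := by
    intro σ
    have h2 := (IsPoleAverage.sum Finset.univ (fun k => isPoleAverage_linearized
      (A + weighted (noiseWeight d d' ν) fun k => cond (σ k) 1 (-1)) k)
      (h.traceWeight_nonneg b)).const_mul (inv_nonneg.2 hν.le)
    rw [mul_one] at h2
    refine (h2.mono (h.sum_traceWeight_le b)).congr fun s _ => ?_
    simp only [wtr, linRes, linMat, Complex.ofReal_inv]
  have h3 := IsPoleAverage.sum Finset.univ h1
    (w := fun σ => (Measure.pi fun _ : m × n => coin).real {σ}) fun σ => measureReal_nonneg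
  have h4 : ∑ σ : m × n → Bool, (Measure.pi fun _ : m × n => coin).real {σ} = 1 := by
    rw [sum_measureReal_singleton]
    simp
  rw [h4, one_mul] at h3
  refine h3.congr fun s hs => ?_
  rw [meanTrace, integral_pi_signLaw (bddMeas_wtr_linRes A _ hs _).meas]

lemma norm_wtr_shiftRes_sub_le (h : WeightBounds d d' ν β R) (A : Matrix m n ℂ) {s : ℂ}
    (hs : 0 < s.re) {x y : Bool → ℂ} (hx : ∀ b, 0 ≤ (x b).re) (hy : ∀ b, 0 ≤ (y b).re) (b : Bool) :
    ‖wtr ν (traceWeight d d' b) (shiftRes (shiftWeight d d') (skewBlock A) s x)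
        - wtr ν (traceWeight d d' b) (shiftRes (shiftWeight d d') (skewBlock A) s y)‖
      ≤ R * β * (2 * (‖x true - y true‖ + ‖x false - y false‖) * β * (1 / s.re) ^ 2) := by
  have hβ := h.bound_nonneg
  have hsub : ∀ W W' : Matrix (m ⊕ n) (m ⊕ n) ℂ, wtr ν (traceWeight d d' b) W
      - wtr ν (traceWeight d d' b) W' = wtr ν (traceWeight d d' b) (W - W') := by
    intro W W'
    simp only [wtr, ← mul_sub, ← Finset.sum_sub_distrib, Matrix.sub_apply]
  rw [hsub]
  refine (norm_wtr_le h.pos (h.traceWeight_nonneg b) fun i => ?_).trans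
    (mul_le_mul_of_nonneg_right (h.sum_traceWeight_le b) (by positivity))
  have h1 := norm_form_shiftRes_sub_le A h hs hx hy
    (δ := ‖x true - y true‖ + ‖x false - y false‖)
    (fun b => by cases b <;> simp) (Pi.single i 1) (Pi.single i 1)
  simp only [Matrix.mulVec_single_one, single_one_dotProduct, normSq2_single, mul_one,
    Matrix.col_apply, Real.sqrt_one] at h1
  exact h1

/-- The fixed-point system has a solution made of averages of poles. -/
theorem exists_fixedPoint (h : WeightBounds d d' ν β R) (A : Matrix m n ℂ) :
    ∃ F : Bool → ℂ → ℂ, (∀ b, IsPoleAverage (R * β) (F b)) ∧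
      ∀ s : ℂ, 0 < s.re → IsFixedPoint A d d' ν s fun b => F b s := by
  have hν := h.pos
  set α : ℕ → Bool → ℂ → ℂ := fun k b s => meanTrace
    (A ⊗ₖ (1 : Matrix (Fin (k + 1)) (Fin (k + 1)) ℂ))
    (fun _ => signLaw) (fun i => d i.1) (fun j => d' j.1) (ν * Fintype.card (Fin (k + 1))) s b
    with hα
  set 𝒰 := Filter.hyperfilter ℕ with h𝒰
  have h𝒰 : (𝒰 : Filter ℕ) ≤ Filter.atTop := Nat.hyperfilter_le_atTop
  choose F hF hlim using fun b => IsPoleAverage.exists_limit (C := R * β) (F := fun k => α k b)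
    (fun k => isPoleAverage_meanTrace (h.blow (K := Fin (k + 1))) _ b) 𝒰
  refine ⟨F, hF, fun s hs => ?_⟩
  have hαre : ∀ k b, 0 ≤ (α k b s).re := fun k b =>
    meanTrace_re_nonneg _ _ (h.blow (K := Fin (k + 1))) hs b
  have hre : ∀ b, 0 ≤ (F b s).re := fun b =>
    ge_of_tendsto ((Complex.continuous_re.tendsto _).comp (hlim b s hs))
      (Filter.Eventually.of_forall fun k => hαre k b)
  refine ⟨hre, fun b => ?_⟩
  set H : (Bool → ℂ) → ℂ := fun x => wtr ν (traceWeight d d' b)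
    (shiftRes (shiftWeight d d') (skewBlock A) s x) with hH
  set E := biasConst 1 β R (1 / s.re) with hE
  have happrox : ∀ k, ‖α k b s - H fun b => α k b s‖
      ≤ R * β * (E / √(ν * ((k : ℝ) + 1))) := by
    intro k
    have h1 := norm_meanTrace_sub_wtr_le (A ⊗ₖ (1 : Matrix (Fin (k + 1)) (Fin (k + 1)) ℂ))
      (fun _ => signLaw) (h.blow (K := Fin (k + 1))) hs zero_le_one (fun _ => entryLaw_signLaw) b
    rw [wtr_shiftRes_blow] at h1
    rw [Fintype.card_fin, Nat.cast_add, Nat.cast_one] at h1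
    simp only [hα, hH, hE, Fintype.card_fin, Nat.cast_add, Nat.cast_one]
    exact h1
  have hdist : ∀ b, Filter.Tendsto (fun k => ‖α k b s - F b s‖) 𝒰 (nhds 0) := fun b =>
    tendsto_iff_norm_sub_tendsto_zero.1 (hlim b s hs)
  have hsmall : Filter.Tendsto (fun k : ℕ => R * β * (E / √(ν * ((k : ℝ) + 1)))) 𝒰 (nhds 0) := by
    have h1 : Filter.Tendsto (fun k : ℕ => √(ν * ((k : ℝ) + 1))) Filter.atTop Filter.atTop :=
      Real.tendsto_sqrt_atTop.comp (Filter.Tendsto.const_mul_atTop hν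
        (Filter.tendsto_atTop_add_const_right _ _ tendsto_natCast_atTop_atTop))
    have h2 := (h1.const_div_atTop E).const_mul (R * β)
    rw [mul_zero] at h2
    exact h2.mono_left h𝒰
  have hbound : ∀ k, ‖F b s - H fun b => F b s‖ ≤ ‖α k b s - F b s‖
      + R * β * (E / √(ν * ((k : ℝ) + 1)))
      + R * β * (2 * (‖α k true s - F true s‖ + ‖α k false s - F false s‖) * β
        * (1 / s.re) ^ 2) := by
    intro k
    have h1 := norm_wtr_shiftRes_sub_le h A hs (hαre k) hre b
    have h2 : F b s - H (fun b => F b s) = -(α k b s - F b s)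
        + (α k b s - H fun b => α k b s) + ((H fun b => α k b s) - H fun b => F b s) := by ring
    rw [h2]
    refine (norm_add_le _ _).trans (add_le_add ((norm_add_le _ _).trans ?_) h1)
    rw [norm_neg]
    exact add_le_add le_rfl (happrox k)
  have hzero : Filter.Tendsto (fun k => ‖α k b s - F b s‖
      + R * β * (E / √(ν * ((k : ℝ) + 1)))
      + R * β * (2 * (‖α k true s - F true s‖ + ‖α k false s - F false s‖) * β
        * (1 / s.re) ^ 2)) 𝒰 (nhds 0) := by
    have h1 := (((((hdist true).add (hdist false)).const_mul 2).mul_const β).mul_const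
      ((1 / s.re) ^ 2)).const_mul (R * β)
    have h2 := ((hdist b).add hsmall).add h1
    simpa using h2
  have := ge_of_tendsto hzero (Filter.Eventually.of_forall hbound)
  exact sub_eq_zero.1 (norm_le_zero_iff.1 this)

end Existence

section SquareRoot

lemma exists_sqrt_neg {z : ℂ} (hz : z ∉ nonnegReals) : ∃ s : ℂ, 0 < s.re ∧ s ^ 2 = -z := by
  have hz0 : -z ≠ 0 := fun h => hz ⟨0, by simp, by simpa [eq_comm] using h⟩
  have hslit : -z ∈ Complex.slitPlane := by
    by_contra h
    rw [Complex.mem_slitPlane_iff, not_or, not_lt, not_not] at h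
    refine hz ⟨z.re, by simpa using h.1, ?_⟩
    apply Complex.ext
    · simp
    · simpa [eq_comm] using h.2
  refine ⟨Complex.exp (Complex.log (-z) / 2), ?_, ?_⟩
  · rw [Complex.exp_re]
    refine mul_pos (Real.exp_pos _) (Real.cos_pos_of_mem_Ioo ?_)
    have h1 : (Complex.log (-z) / 2).im = (-z).arg / 2 := by
      rw [← Complex.log_im]
      exact Complex.div_ofNat_im _ _
    have h2 := Complex.neg_pi_lt_arg (-z)
    have h3 := lt_of_le_of_ne (Complex.arg_le_pi (-z)) (Complex.mem_slitPlane_iff_arg.1 hslit).1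
    rw [h1]
    constructor <;> linarith
  · rw [← Complex.exp_nat_mul]
    push_cast
    rw [mul_div_cancel₀ _ (two_ne_zero), Complex.exp_log hz0]

lemma nonnegReals_nonempty : nonnegReals.Nonempty := ⟨0, 0, by simp⟩

lemma isClosed_nonnegReals : IsClosed nonnegReals :=
  (Complex.isometry_ofReal.isClosedEmbedding.isClosedMap) _ isClosed_Ici

lemma infDist_pos {z : ℂ} (hz : z ∉ nonnegReals) : 0 < Metric.infDist z nonnegReals :=
  (isClosed_nonnegReals.notMem_iff_infDist_pos nonnegReals_nonempty).1 hz

lemma infDist_le {s z : ℂ} (hs : 0 < s.re) (hsz : s ^ 2 = -z) :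
    Metric.infDist z nonnegReals ≤ 2 * s.re * ‖s‖ := by
  have h1 : ((s.im ^ 2 : ℝ) : ℂ) ∈ nonnegReals := ⟨s.im ^ 2, Set.mem_Ici.2 (sq_nonneg _), rfl⟩
  refine (Metric.infDist_le_dist_of_mem h1).trans ?_
  have h2 : z - ((s.im ^ 2 : ℝ) : ℂ) = -((s.re : ℂ) * (s + s.im * Complex.I)) := by
    have h3 : z = -s ^ 2 := by rw [hsz, neg_neg]
    rw [h3]
    apply Complex.ext
    all_goals simp [sq]
    ring
  rw [dist_eq_norm, h2, norm_neg, norm_mul, Complex.norm_real, Real.norm_of_nonneg hs.le]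
  have h3 : ‖s + s.im * Complex.I‖ ≤ 2 * ‖s‖ := by
    refine (norm_add_le _ _).trans ?_
    rw [norm_mul, Complex.norm_I, mul_one, Complex.norm_real, Real.norm_eq_abs]
    linarith [Complex.abs_im_le_norm s]
  calc _ ≤ s.re * (2 * ‖s‖) := mul_le_mul_of_nonneg_left h3 hs.le
    _ = _ := by ring

end SquareRoot

section Bounds

variable {N n : ℕ} {ratioMin ratioMax dMin dMax dMin' dMax' aMax : ℝ}
  {d : Fin N → ℝ} {d' : Fin n → ℝ} {A : Matrix (Fin N) (Fin n) ℂ}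

lemma abs_le_norm_diagC {k : ℕ} (d : Fin k → ℝ) (i : Fin k) : |d i| ≤ ‖diagC d‖ := by
  rw [diagC, Matrix.l2_opNorm_diagonal]
  have := norm_le_pi_norm (fun i => (d i : ℂ)) i
  simpa using this

lemma ModelBounds.weightBounds
    (h : ModelBounds ratioMin ratioMax dMin dMax dMin' dMax' aMax d d' A) :
    WeightBounds d d' (n : ℝ) (|dMax| + |dMax'|) (|ratioMax| + 1) where
  one_le := by exact_mod_cast h.n_pos
  nonneg := h.d_nonneg
  nonneg' := h.d_nonneg'
  le i := (le_abs_self _).trans ((abs_le_norm_diagC d i).trans (h.d_norm_le.trans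
    ((le_abs_self _).trans (le_add_of_nonneg_right (abs_nonneg _)))))
  le' j := (le_abs_self _).trans ((abs_le_norm_diagC d' j).trans (h.d_norm_le'.trans
    ((le_abs_self _).trans (le_add_of_nonneg_left (abs_nonneg _)))))
  bound_nonneg := by positivity
  card_le := by
    have hn : (0 : ℝ) < n := by exact_mod_cast h.n_pos
    have h1 := (div_le_iff₀ hn).1 (h.ratio_le.trans (le_abs_self _))
    rw [Fintype.card_fin, Fintype.card_fin]
    linarith

lemma sum_norm_sq_col_le {m n : ℕ} (A : Matrix (Fin m) (Fin n) ℂ) (j : Fin n) :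
    ∑ i, ‖A i j‖ ^ 2 ≤ ‖A‖ ^ 2 := by
  have h := Matrix.l2_opNorm_mulVec A (EuclideanSpace.single j (1 : ℂ))
  rw [PiLp.norm_single, norm_one, mul_one] at h
  have h2 := pow_le_pow_left₀ (norm_nonneg _) h 2
  rw [EuclideanSpace.norm_sq_eq] at h2
  simpa using h2

lemma ModelBounds.shapeBounds
    (h : ModelBounds ratioMin ratioMax dMin dMax dMin' dMax' aMax d d' A)
    (hr : 0 < ratioMin) (hd : 0 < dMin) (hd' : 0 < dMin') :
    ShapeBounds A d d' (n : ℝ) (min (ratioMin * dMin) dMin') |aMax| where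
  pos := lt_min (mul_pos hr hd) hd'
  nonneg := abs_nonneg _
  le_trace b := by
    have hn : (0 : ℝ) < n := by exact_mod_cast h.n_pos
    cases b
    · refine (min_le_right _ _).trans (h.d_trace_ge'.trans_eq ?_)
      simp [traceWeight, Matrix.trace]
    · refine (min_le_left _ _).trans ?_
      have hN : (0 : ℝ) < N := by
        have := (le_div_iff₀ hn).1 h.ratio_ge
        exact lt_of_lt_of_le (mul_pos hr hn) this
      have h1 : 0 ≤ (1 / (N : ℝ)) * (Matrix.diagonal d).trace := hd.le.trans h.d_trace_ge
      calc ratioMin * dMin ≤ (N : ℝ) / n * ((1 / (N : ℝ)) * (Matrix.diagonal d).trace) :=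
            mul_le_mul h.ratio_ge h.d_trace_ge hd.le (by positivity)
        _ = _ := by
            simp only [traceWeight, cond_true, Matrix.trace, Matrix.diag_diagonal,
              Fintype.sum_sum_type, Sum.elim_inl, Sum.elim_inr, Pi.zero_apply,
              Finset.sum_const_zero, add_zero]
            field_simp
  row_le k := by
    have h1 : ‖A‖ ^ 2 ≤ |aMax| ^ 2 :=
      pow_le_pow_left₀ (norm_nonneg _) (h.A_norm_le.trans (le_abs_self _)) 2
    refine le_trans ?_ h1
    rw [Fintype.sum_sum_type]
    rcases k with i | j
    · have h2 := sum_norm_sq_col_le Aᴴ i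
      rw [Matrix.l2_opNorm_conjTranspose] at h2
      simpa [skewBlock] using h2
    · simpa [skewBlock] using sum_norm_sq_col_le A j

end Bounds

section Translation

variable {N n : ℕ} {d : Fin N → ℝ} {d' : Fin n → ℝ} {A : Matrix (Fin N) (Fin n) ℂ} {s z a a' : ℂ}

/-- The pair `(s a, s a')`, indexed by `Bool`. -/
def scaledPair (s a a' : ℂ) (b : Bool) : ℂ := s * cond b a a'

lemma one_add_smul_diagC (a : ℂ) {k : ℕ} (d : Fin k → ℝ) :
    1 + a • diagC d = Matrix.diagonal fun i => 1 + a * (d i : ℂ) := by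
  rw [diagC, ← Matrix.diagonal_one, ← Matrix.diagonal_smul, Matrix.diagonal_add]
  rfl

lemma inv_diagonal_of_ne_zero {I : Type*} [Fintype I] [DecidableEq I] {θ : I → ℂ}
    (hθ : ∀ i, θ i ≠ 0) : (Matrix.diagonal θ)⁻¹ = Matrix.diagonal fun i => (θ i)⁻¹ :=
  Matrix.inv_eq_left_inv (diagonal_inv_mul_diagonal hθ)

lemma shiftDiag_inl (i : Fin N) : shiftDiag (shiftWeight d d') s (scaledPair s a a') (Sum.inl i)
    = s * (1 + a' * d i) := by
  simp [shiftDiag, shiftWeight, traceWeight, scaledPair]; ring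

lemma shiftDiag_inr (j : Fin n) : shiftDiag (shiftWeight d d') s (scaledPair s a a') (Sum.inr j)
    = s * (1 + a * d' j) := by
  simp [shiftDiag, shiftWeight, traceWeight, scaledPair]; ring

lemma ne_zero_of_re_pos (hs : 0 < s.re) : s ≠ 0 := fun h => by simp [h] at hs

/-- The deterministic equivalents are the diagonal blocks of the shifted resolvent. -/
lemma detEquiv_eq {ν β R : ℝ} (h : WeightBounds d d' ν β R) (hs : 0 < s.re) (hsz : s ^ 2 = -z)
    (hre : ∀ b, 0 ≤ (scaledPair s a a' b).re) :
    detEquiv d d' A a a' z = s⁻¹ • (shiftRes (shiftWeight d d') (skewBlock A) s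
        (scaledPair s a a')).toBlocks₁₁ ∧
    detEquivTilde d d' A a a' z = s⁻¹ • (shiftRes (shiftWeight d d') (skewBlock A) s
        (scaledPair s a a')).toBlocks₂₂ := by
  have hs0 := ne_zero_of_re_pos hs
  set W := shiftRes (shiftWeight d d') (skewBlock A) s (scaledPair s a a') with hW
  have hmul : (Matrix.diagonal (shiftDiag (shiftWeight d d') s (scaledPair s a a'))
      + skewBlock A) * W = 1 :=
    (shift_accretive (skewBlock_conjTranspose A) h.shiftWeight_nonneg hre).mul_inv hs
  have hθ : ∀ k, shiftDiag (shiftWeight d d') s (scaledPair s a a') k ≠ 0 := by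
    intro k
    refine ne_zero_of_re_pos (lt_of_lt_of_le hs ?_)
    rw [shiftDiag_re]
    exact le_add_of_nonneg_right (Finset.sum_nonneg fun b _ =>
      mul_nonneg (hre b) (h.shiftWeight_nonneg b k))
  have hl : ∀ i, 1 + a' * (d i : ℂ) ≠ 0 := fun i h0 => hθ (Sum.inl i) (by
    rw [shiftDiag_inl, h0, mul_zero])
  have hr : ∀ j, 1 + a * (d' j : ℂ) ≠ 0 := fun j h0 => hθ (Sum.inr j) (by
    rw [shiftDiag_inr, h0, mul_zero])
  have hscale : ∀ {I : Type} [Fintype I] [DecidableEq I] (θ : I → ℂ),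
      Matrix.diagonal (fun i => s * θ i) = s • Matrix.diagonal θ := by
    intro I _ _ θ
    rw [← Matrix.diagonal_smul]; rfl
  have hscale' : ∀ {I : Type} [Fintype I] [DecidableEq I] (θ : I → ℂ),
      Matrix.diagonal (fun i => (s * θ i)⁻¹) = s⁻¹ • Matrix.diagonal fun i => (θ i)⁻¹ := by
    intro I _ _ θ
    rw [← Matrix.diagonal_smul]
    congr 1
    funext i
    simp [mul_comm]
  have h1 := schur_toBlocks₁₁ (fun j => hθ (Sum.inr j)) hmul
  have h2 := schur_toBlocks₂₂ (fun i => hθ (Sum.inl i)) hmul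
  simp only [shiftDiag_inl, shiftDiag_inr, hscale, hscale', Matrix.mul_smul] at h1 h2
  constructor
  · refine Matrix.inv_eq_right_inv ?_
    rw [one_add_smul_diagC, one_add_smul_diagC, inv_diagonal_of_ne_zero hr, ← hsz,
      Matrix.mul_smul, ← Matrix.smul_mul, ← h1, smul_add, smul_smul]
    congr 3
    field_simp
    rw [Matrix.smul_mul]
  · refine Matrix.inv_eq_right_inv ?_
    rw [one_add_smul_diagC, one_add_smul_diagC, inv_diagonal_of_ne_zero hl, ← hsz,
      Matrix.mul_smul, ← Matrix.smul_mul, ← h2, smul_add, smul_smul]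
    congr 3
    field_simp
    rw [Matrix.smul_mul]

lemma trace_diagC_mul_toBlocks₁₁ (W : Matrix (Fin N ⊕ Fin n) (Fin N ⊕ Fin n) ℂ) :
    (1 / (n : ℂ)) * (diagC d * s⁻¹ • W.toBlocks₁₁).trace
      = s⁻¹ * wtr (n : ℝ) (traceWeight d d' true) W := by
  rw [Matrix.mul_smul, Matrix.trace_smul, smul_eq_mul, mul_left_comm]
  simp [wtr, traceWeight, diagC, Matrix.trace, Matrix.diagonal_mul, Matrix.toBlocks₁₁]

lemma trace_diagC_mul_toBlocks₂₂ (W : Matrix (Fin N ⊕ Fin n) (Fin N ⊕ Fin n) ℂ) :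
    (1 / (n : ℂ)) * (diagC d' * s⁻¹ • W.toBlocks₂₂).trace
      = s⁻¹ * wtr (n : ℝ) (traceWeight d d' false) W := by
  rw [Matrix.mul_smul, Matrix.trace_smul, smul_eq_mul, mul_left_comm]
  simp [wtr, traceWeight, diagC, Matrix.trace, Matrix.diagonal_mul, Matrix.toBlocks₂₂]

/-- The canonical system at `z` is the fixed-point system at `s`, where `s ^ 2 = -z`. -/
lemma isFixedPoint_scaledPair_iff {ν β R : ℝ} (h : WeightBounds d d' ν β R) (hs : 0 < s.re)
    (hsz : s ^ 2 = -z) (hre : ∀ b, 0 ≤ (scaledPair s a a' b).re) :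
    IsFixedPoint A d d' (n : ℝ) s (scaledPair s a a') ↔
      a = (1 / (n : ℂ)) * (diagC d * detEquiv d d' A a a' z).trace ∧
      a' = (1 / (n : ℂ)) * (diagC d' * detEquivTilde d d' A a a' z).trace := by
  have hs0 := ne_zero_of_re_pos hs
  obtain ⟨h1, h2⟩ := detEquiv_eq (A := A) h hs hsz hre
  rw [h1, h2, trace_diagC_mul_toBlocks₁₁ (d' := d'), trace_diagC_mul_toBlocks₂₂ (d := d),
    eq_inv_mul_iff_mul_eq₀ hs0, eq_inv_mul_iff_mul_eq₀ hs0]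
  exact ⟨fun hf => ⟨hf.eq true, hf.eq false⟩, fun hf => ⟨hre, fun b => by
    cases b
    · exact hf.2
    · exact hf.1⟩⟩

lemma sigmaMat_eq (X : Matrix (Fin N) (Fin n) ℂ) : sigmaMat d d' A X
    = A + weighted (noiseWeight d d' (n : ℝ)) fun k => X k.1 k.2 := by
  ext i j
  simp only [sigmaMat, diagC, weighted, noiseWeight, Matrix.add_apply, Matrix.smul_apply,
    Matrix.mul_diagonal, Matrix.diagonal_mul, Matrix.of_apply, smul_eq_mul]
  push_cast
  ring

lemma resolventMat_eq (hs : 0 < s.re) (hsz : s ^ 2 = -z) (X : Matrix (Fin N) (Fin n) ℂ) :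
    resolventMat (sigmaMat d d' A X) z = s⁻¹ • (linRes (noiseWeight d d' (n : ℝ)) A s
      fun k => X k.1 k.2).toBlocks₁₁ := by
  have hs0 := ne_zero_of_re_pos hs
  rw [sigmaMat_eq]
  set S := A + weighted (noiseWeight d d' (n : ℝ)) fun k => X k.1 k.2 with hS
  refine Matrix.inv_eq_right_inv ?_
  have hmul : (Matrix.diagonal (fun _ => s) + skewBlock S)
      * linRes (noiseWeight d d' (n : ℝ)) A s (fun k => X k.1 k.2) = 1 :=
    (linMat_accretive _ A _).mul_inv hs
  have h1 := schur_toBlocks₁₁ (fun _ => hs0) hmul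
  rw [mul_diagonal_const_mul] at h1
  have h2 := scaled_equation hs h1
  rw [Matrix.mul_smul, sub_eq_add_neg, ← neg_smul, ← hsz, add_comm, h2, smul_smul,
    inv_mul_cancel₀ hs0, one_smul]

end Translation

section Stieltjes

open MeasureTheory
open scoped unitInterval

lemma isStieltjesTransform_of_isPoleAverage {C : ℝ} {F : ℂ → ℂ} (hF : IsPoleAverage C F)
    {rt : ℂ → ℂ} (hrt : ∀ z, z ∉ nonnegReals → 0 < (rt z).re ∧ rt z ^ 2 = -z) :
    IsStieltjesTransform fun z => (rt z)⁻¹ * F (rt z) := by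
  obtain ⟨ρ, hρ, -, hF⟩ := hF
  set U : Set I := {r | 0 < (r : ℝ)} with hU
  have hUm : MeasurableSet U := measurableSet_lt measurable_const (by fun_prop)
  set φ : I → ℝ := fun r => 1 / (r : ℝ) - 1 with hφ
  have hφm : Measurable φ := by fun_prop
  refine ⟨(ρ.restrict U).map φ, inferInstance, ?_, fun z hz => ?_⟩
  · rw [Measure.map_apply hφm measurableSet_Iio, Measure.restrict_apply
      (hφm measurableSet_Iio)]
    convert measure_empty (μ := ρ)
    ext r
    simp only [Set.mem_inter_iff, Set.mem_preimage, Set.mem_Iio, Set.mem_empty_iff_false,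
      iff_false, not_and]
    intro h1 h2
    have h3 : 1 ≤ 1 / (r : ℝ) := by
      rw [le_div_iff₀ h2]; linarith [r.2.2]
    simp only [hφ] at h1
    linarith
  · obtain ⟨hs, hsz⟩ := hrt z hz
    set s := rt z with hsdef
    have hs0 := ne_zero_of_re_pos hs
    beta_reduce
    have hm : Measurable fun t : ℝ => ((t : ℂ) - z)⁻¹ := by fun_prop
    have h1 : resolventTransform ((ρ.restrict U).map φ) z
        = ∫ r in U, (((φ r : ℝ) : ℂ) - z)⁻¹ ∂ρ := by
      rw [resolventTransform]
      simp only [resolvent, Ring.inverse_eq_inv']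
      exact integral_map hφm.aemeasurable hm.aestronglyMeasurable
    have h2 : ∀ r ∈ U, (((φ r : ℝ) : ℂ) - z)⁻¹ = s⁻¹ * poleKernel s r := by
      intro r hr
      have hr0 : ((r : ℝ) : ℂ) ≠ 0 := by exact_mod_cast (ne_of_gt hr)
      have hz' : z = -s ^ 2 := by rw [hsz, neg_neg]
      have hden := poleKernel_den_ne_zero hs r
      rw [poleKernel, hφ, hz']
      push_cast
      have h3 : (1 / ((r : ℝ) : ℂ) - 1 - -s ^ 2)
          = (1 - ((r : ℝ) : ℂ) + s ^ 2 * ((r : ℝ) : ℂ)) / ((r : ℝ) : ℂ) := by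
        field_simp; ring
      rw [h3, inv_div]
      field_simp
    rw [h1, setIntegral_congr_fun hUm h2, integral_const_mul, hF s hs,
      setIntegral_eq_integral_of_forall_compl_eq_zero]
    intro r hr
    have : (r : ℝ) = 0 := le_antisymm (not_lt.1 hr) r.2.1
    simp [poleKernel, this]

lemma re_mul_nonneg_of_isStieltjesTransform {f : ℂ → ℂ} (hf : IsStieltjesTransform f) {s z : ℂ}
    (hz : z ∉ nonnegReals) (hs : 0 < s.re) (hsz : s ^ 2 = -z) : 0 ≤ (s * f z).re := by
  obtain ⟨μ, hμ, hμ0, hf⟩ := hf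
  rw [hf z hz, resolventTransform, ← integral_const_mul]
  by_cases hi : Integrable (fun t : ℝ => s * resolvent z t) μ
  swap
  · rw [integral_undef hi]; simp
  have h1 : (∫ t, s * resolvent z t ∂μ).re = ∫ t, (s * resolvent z t).re ∂μ :=
    (integral_re hi).symm
  rw [h1]
  refine integral_nonneg_of_ae ?_
  have hae : ∀ᵐ t ∂μ, 0 ≤ t := by
    rw [ae_iff]
    convert hμ0 using 2
    ext t; simp
  filter_upwards [hae] with t ht
  have h2 : s * resolvent z t = ((t : ℂ) / s + s)⁻¹ := by
    have hs0 := ne_zero_of_re_pos hs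
    have h3 := ofReal_add_sq_ne_zero hs ht
    have h4 : (t : ℂ) / s + s = (t + s ^ 2) / s := by field_simp
    rw [h4, inv_div]
    simp only [resolvent, Ring.inverse_eq_inv', hsz]
    rw [div_eq_mul_inv]
    congr 2
  rw [Pi.zero_apply, h2, Complex.inv_re]
  refine div_nonneg ?_ (Complex.normSq_nonneg _)
  rw [Complex.add_re, Complex.div_re]
  simp only [Complex.ofReal_re, Complex.ofReal_im, zero_mul, zero_div, add_zero]
  have := Complex.normSq_nonneg s
  positivity

end Stieltjes

section Growth

/-- Polynomial growth on the positive quadrant. -/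
def PolyGrowth (g : ℝ → ℝ → ℝ) : Prop :=
  ∃ (C : ℝ) (D : ℕ), 0 ≤ C ∧ ∀ K L S : ℝ, 1 ≤ K → 0 ≤ L → L ≤ K → 0 ≤ S → S ≤ K →
    |g L S| ≤ C * K ^ D

lemma PolyGrowth.const (c : ℝ) : PolyGrowth fun _ _ => c :=
  ⟨|c|, 0, abs_nonneg c, fun _ _ _ _ _ _ _ _ => by simp⟩

lemma PolyGrowth.fst : PolyGrowth fun L _ => L :=
  ⟨1, 1, zero_le_one, fun K L S _ h1 h2 _ _ => by simpa [abs_of_nonneg h1] using h2⟩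

lemma PolyGrowth.snd : PolyGrowth fun _ S => S :=
  ⟨1, 1, zero_le_one, fun K L S _ _ _ h1 h2 => by simpa [abs_of_nonneg h1] using h2⟩

lemma PolyGrowth.add {f g : ℝ → ℝ → ℝ} (hf : PolyGrowth f) (hg : PolyGrowth g) :
    PolyGrowth fun L S => f L S + g L S := by
  obtain ⟨C, D, hC, hf⟩ := hf
  obtain ⟨C', D', hC', hg⟩ := hg
  refine ⟨C + C', D + D', add_nonneg hC hC', fun K L S hK h1 h2 h3 h4 => ?_⟩
  have e1 : K ^ D ≤ K ^ (D + D') := pow_le_pow_right₀ hK (by omega)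
  have e2 : K ^ D' ≤ K ^ (D + D') := pow_le_pow_right₀ hK (by omega)
  calc |f L S + g L S| ≤ |f L S| + |g L S| := abs_add_le _ _
    _ ≤ C * K ^ D + C' * K ^ D' := add_le_add (hf K L S hK h1 h2 h3 h4) (hg K L S hK h1 h2 h3 h4)
    _ ≤ C * K ^ (D + D') + C' * K ^ (D + D') := by gcongr
    _ = _ := by ring

lemma PolyGrowth.mul {f g : ℝ → ℝ → ℝ} (hf : PolyGrowth f) (hg : PolyGrowth g) :
    PolyGrowth fun L S => f L S * g L S := by
  obtain ⟨C, D, hC, hf⟩ := hf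
  obtain ⟨C', D', hC', hg⟩ := hg
  refine ⟨C * C', D + D', mul_nonneg hC hC', fun K L S hK h1 h2 h3 h4 => ?_⟩
  have hK0 : 0 ≤ K := by linarith
  calc |f L S * g L S| = |f L S| * |g L S| := abs_mul _ _
    _ ≤ (C * K ^ D) * (C' * K ^ D') := mul_le_mul (hf K L S hK h1 h2 h3 h4)
        (hg K L S hK h1 h2 h3 h4) (abs_nonneg _) (by positivity)
    _ = _ := by ring

lemma PolyGrowth.pow {f : ℝ → ℝ → ℝ} (hf : PolyGrowth f) (k : ℕ) :
    PolyGrowth fun L S => f L S ^ k := by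
  induction k with
  | zero => simpa using PolyGrowth.const 1
  | succ k ih => simpa only [pow_succ] using ih.mul hf

lemma PolyGrowth.sqrt {f : ℝ → ℝ → ℝ} (hf : PolyGrowth f) : PolyGrowth fun L S => √(f L S) := by
  obtain ⟨C, D, hC, hf⟩ := hf
  refine ⟨1 + C, D, by linarith, fun K L S hK h1 h2 h3 h4 => ?_⟩
  have e := hf K L S hK h1 h2 h3 h4
  have e1 : 1 ≤ K ^ D := one_le_pow₀ hK
  rw [abs_of_nonneg (Real.sqrt_nonneg _)]
  have e2 : √(f L S) ≤ 1 + |f L S| := by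
    refine Real.sqrt_le_iff.2 ⟨by positivity, ?_⟩
    nlinarith [le_abs_self (f L S), abs_nonneg (f L S)]
  linarith

variable (Mo β R τ α : ℝ) (q : ℕ)

lemma polyGrowth_concConst (κ : ℝ) : PolyGrowth fun L _ => concConst Mo κ R L := by
  have hL := PolyGrowth.fst
  exact ((((PolyGrowth.const (8192 * (1 + Mo))).mul (((PolyGrowth.const 1).add
    ((hL.pow 2).mul (PolyGrowth.const κ))).pow 3)).mul (PolyGrowth.const κ)).mul
    (PolyGrowth.const (1 + R))).mul (hL.pow 4)

lemma polyGrowth_defectConst (κ : ℝ) : PolyGrowth fun L _ => defectConst Mo κ R L := by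
  have hL := PolyGrowth.fst
  exact ((PolyGrowth.const (4 * κ * √R)).mul (hL.pow 2)).add
    (((PolyGrowth.const (4 * κ * √κ * R)).mul hL).mul ((hL.pow 2).mul ((PolyGrowth.const 12).add
      ((PolyGrowth.const (10 * (1 + Mo))).mul ((PolyGrowth.const 1).add
        (((PolyGrowth.const 4).mul hL).mul (PolyGrowth.const √κ)))))))

lemma polyGrowth_biasConst : PolyGrowth fun L _ => biasConst Mo β R L := by
  have hL := PolyGrowth.fst
  exact (hL.mul (polyGrowth_defectConst Mo R (β ^ 2))).add
    (((PolyGrowth.const (2 * β)).mul (hL.pow 2)).mul ((PolyGrowth.const (R * β)).mul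
      ((PolyGrowth.const (momentConst 0)).mul (polyGrowth_concConst Mo R (β ^ 2))).sqrt))

lemma stabConst_eq (S L : ℝ) : stabConst β R τ α S L
    = 8 * (R * β) ^ 2 * (τ⁻¹) ^ 2 * (L ^ 4 * (2 * (S + R * β * (2 * β) * L + α)) ^ 4) := by
  rw [stabConst, div_eq_mul_inv, ← inv_pow, inv_div, div_eq_mul_inv _ (1 / L * τ),
    mul_inv, one_div, inv_inv]
  ring

lemma polyGrowth_stabConst : PolyGrowth fun L S => stabConst β R τ α S L := by
  have hL := PolyGrowth.fst
  simp only [stabConst_eq]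
  exact (PolyGrowth.const _).mul ((hL.pow 4).mul (((PolyGrowth.const 2).mul
    ((PolyGrowth.snd.add ((PolyGrowth.const _).mul hL)).add (PolyGrowth.const α))).pow 4))

lemma polyGrowth_totalConst :
    PolyGrowth fun L S => L ^ (2 * (q + 1)) * totalConst q Mo β R τ α S L := by
  have hL := PolyGrowth.fst
  have hshift : PolyGrowth fun L S => shiftConst Mo β R τ α S L :=
    (polyGrowth_biasConst Mo β R).mul ((PolyGrowth.const 1).add
      (((((PolyGrowth.const 2).mul (hL.pow 2)).mul (PolyGrowth.const (β ^ 2))).mul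
        (PolyGrowth.const R)).mul (polyGrowth_stabConst β R τ α)))
  exact (hL.pow _).mul ((PolyGrowth.const (4 ^ (q + 1))).mul
    (((PolyGrowth.const (momentConst q)).mul ((polyGrowth_concConst Mo R (β ^ 2)).pow _)).add
      ((hshift.pow 2).pow _)))

end Growth

section Transfer

open MeasureTheory

variable {N n : ℕ} {d : Fin N → ℝ} {d' : Fin n → ℝ} {A : Matrix (Fin N) (Fin n) ℂ} {s z a a' : ℂ}

lemma IsIIDArray.entryLaw {Ω : Type*} [MeasurableSpace Ω] {P : Measure Ω}
    {p : ℕ} {M : ℝ} {X : Fin N → Fin n → Ω → ℂ} (h : IsIIDArray P p M X)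
    (hp : p ≠ 0) (k : Fin N × Fin n) : EntryLaw p |M| (P.map (X k.1 k.2)) where
  mean_zero := by
    rw [integral_map (h.measurable _ _).aemeasurable (by fun_prop)]
    exact h.mean_zero _ _
  variance_one := by
    rw [integral_map (h.measurable _ _).aemeasurable (by fun_prop)]
    exact h.variance_one _ _
  integrable_moment := by
    rw [integrable_map_measure (by fun_prop) (h.measurable _ _).aemeasurable]
    exact (h.memLp _ _).integrable_norm_pow (by omega)
  moment_le := by
    rw [integral_map (h.measurable _ _).aemeasurable (by fun_prop)]
    exact (h.moment_le _ _).trans (le_abs_self _)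

/-- Zero extension of a vector to the second block. -/
def extendZero (v : Fin N → ℂ) : Fin N ⊕ Fin n → ℂ := Sum.elim v 0

lemma dotProduct_toBlocks₁₁ (B : Matrix (Fin N ⊕ Fin n) (Fin N ⊕ Fin n) ℂ) (u v : Fin N → ℂ) :
    u ⬝ᵥ (B.toBlocks₁₁ *ᵥ v) = (extendZero u : Fin N ⊕ Fin n → ℂ) ⬝ᵥ (B *ᵥ extendZero v) := by
  simp [dotProduct, Matrix.mulVec, extendZero, Matrix.toBlocks₁₁]

lemma normSq2_extendZero (v : Fin N → ℂ) :
    normSq2 (extendZero v : Fin N ⊕ Fin n → ℂ) = normSq2 v := by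
  simp [normSq2, extendZero]

lemma normSq2_ofLp (v : EuclideanSpace ℂ (Fin N)) : normSq2 (WithLp.ofLp v) = ‖v‖ ^ 2 := by
  rw [EuclideanSpace.norm_sq_eq]; rfl

/-- Moment bound for the bilinear forms of the resolvent. -/
theorem integral_bilin_le {β R τ α M : ℝ} {q : ℕ} (hW : WeightBounds d d' (n : ℝ) β R)
    (hSh : ShapeBounds A d d' (n : ℝ) τ α) (hs : 0 < s.re) (hsz : s ^ 2 = -z)
    (hfix : IsFixedPoint A d d' (n : ℝ) s (scaledPair s a a'))
    {Ω : Type*} [MeasurableSpace Ω] {P : Measure Ω} [IsProbabilityMeasure P]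
    {X : Fin N → Fin n → Ω → ℂ} (hX : IsIIDArray P (q + 1) M X)
    (u v : EuclideanSpace ℂ (Fin N)) :
    Integrable (fun ω => ‖bilin u (resolventMat (sigmaMat d d' A (Matrix.of fun i j => X i j ω)) z
      - detEquiv d d' A a a' z) v‖ ^ (2 * (q + 1))) P ∧
    ∫ ω, ‖bilin u (resolventMat (sigmaMat d d' A (Matrix.of fun i j => X i j ω)) z
      - detEquiv d d' A a a' z) v‖ ^ (2 * (q + 1)) ∂P
      ≤ (1 / s.re) ^ (2 * (q + 1)) * totalConst q (1 + |M|) β R τ α ‖s‖ (1 / s.re)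
        * (‖u‖ ^ 2 * ‖v‖ ^ 2 / n) ^ (q + 1) := by
  have hn := hW.pos
  have hs0 := ne_zero_of_re_pos hs
  set μ : Fin N × Fin n → Measure ℂ := fun k => P.map (X k.1 k.2) with hμ
  have hμp : ∀ k, IsProbabilityMeasure (μ k) := fun k =>
    Measure.isProbabilityMeasure_map (hX.measurable _ _).aemeasurable
  have hlaw : ∀ k, EntryLaw (q + 1) |M| (μ k) := hX.entryLaw q.succ_ne_zero
  set U : Fin N ⊕ Fin n → ℂ := extendZero (star (WithLp.ofLp u)) with hU
  set V : Fin N ⊕ Fin n → ℂ := extendZero (WithLp.ofLp v) with hV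
  set T := shiftRes (shiftWeight d d') (skewBlock A) s (scaledPair s a a') with hT
  set G : (Fin N × Fin n → ℂ) → ℂ := fun x =>
    U ⬝ᵥ (linRes (noiseWeight d d' (n : ℝ)) A s x *ᵥ V) - U ⬝ᵥ (T *ᵥ V) with hG
  have hGb : BddMeas G := (bddMeas_linRes_form _ A hs U V).sub (BddMeas.const _)
  have hbil : ∀ ω, bilin u (resolventMat (sigmaMat d d' A (Matrix.of fun i j => X i j ω)) z
      - detEquiv d d' A a a' z) v = s⁻¹ * G fun k => X k.1 k.2 ω := by
    intro ω
    rw [resolventMat_eq hs hsz, (detEquiv_eq (A := A) hW hs hsz hfix.re_nonneg).1, ← smul_sub,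
      bilin, Matrix.smul_mulVec, dotProduct_smul, smul_eq_mul, Matrix.sub_mulVec, dotProduct_sub,
      dotProduct_toBlocks₁₁, dotProduct_toBlocks₁₁]
    rfl
  have hXm : Measurable fun ω (k : Fin N × Fin n) => X k.1 k.2 ω :=
    measurable_pi_lambda _ fun k => hX.measurable _ _
  have hpi : P.map (fun ω (k : Fin N × Fin n) => X k.1 k.2 ω) = Measure.pi μ :=
    hX.indep.map_fun_eq_pi_map fun k => (hX.measurable _ _).aemeasurable
  have hcomp : BddMeas fun ω => G fun k => X k.1 k.2 ω := hGb.comp hXm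
  simp only [hbil, norm_mul, mul_pow]
  refine ⟨((hcomp.norm.pow _).integrable P).const_mul _, ?_⟩
  rw [integral_const_mul]
  have h1 : ∫ ω, ‖G fun k => X k.1 k.2 ω‖ ^ (2 * (q + 1)) ∂P
      = ∫ x, (‖G x‖ ^ 2) ^ (q + 1) ∂(Measure.pi μ) := by
    rw [← hpi, integral_map hXm.aemeasurable
      ((hGb.norm.pow 2).pow (q + 1)).meas.aestronglyMeasurable]
    simp only [pow_mul]
  have h2 := integral_form_sub_fixedPoint_pow_le A μ q hW hSh hs (by positivity : 0 ≤ 1 + |M|)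
    (fun k => (hlaw k).of_le (by omega)) (fun k => (hlaw k).of_le le_rfl) hfix U V
  rw [hU, hV, normSq2_extendZero, normSq2_extendZero, normSq2_star, normSq2_ofLp,
    normSq2_ofLp] at h2
  have h3 : ‖s⁻¹‖ ≤ 1 / s.re := by
    rw [norm_inv, ← one_div]
    exact one_div_le_one_div_of_le hs (Complex.re_le_norm s)
  rw [h1, mul_assoc]
  refine mul_le_mul (pow_le_pow_left₀ (norm_nonneg _) h3 _) h2
    (integral_nonneg fun x => by positivity) (by positivity)

end Transfer

section Solution

variable {N n : ℕ} {d : Fin N → ℝ} {d' : Fin n → ℝ} {A : Matrix (Fin N) (Fin n) ℂ}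

lemma IsCanonicalSolution.isFixedPoint {β R : ℝ} (hW : WeightBounds d d' (n : ℝ) β R)
    {γ γ' : ℂ → ℂ} (h : IsCanonicalSolution d d' A γ γ') {s z : ℂ} (hz : z ∉ nonnegReals)
    (hs : 0 < s.re) (hsz : s ^ 2 = -z) :
    IsFixedPoint A d d' (n : ℝ) s (scaledPair s (γ z) (γ' z)) := by
  have hre : ∀ b, 0 ≤ (scaledPair s (γ z) (γ' z) b).re := by
    intro b
    cases b
    · exact re_mul_nonneg_of_isStieltjesTransform h.stieltjes_tilde hz hs hsz
    · exact re_mul_nonneg_of_isStieltjesTransform h.stieltjes hz hs hsz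
  exact (isFixedPoint_scaledPair_iff hW hs hsz hre).2 ⟨h.eq z hz, h.eq_tilde z hz⟩

/-- Existence of the solution of the canonical system. -/
theorem exists_isCanonicalSolution {β R : ℝ} (hW : WeightBounds d d' (n : ℝ) β R) :
    ∃ δ δ' : ℂ → ℂ, IsCanonicalSolution d d' A δ δ' := by
  have hrt : ∀ z : ℂ, ∃ s : ℂ, z ∉ nonnegReals → 0 < s.re ∧ s ^ 2 = -z := by
    intro z
    by_cases hz : z ∈ nonnegReals
    · exact ⟨0, fun h => absurd hz h⟩
    · obtain ⟨s, hs⟩ := exists_sqrt_neg hz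
      exact ⟨s, fun _ => hs⟩
  choose rt hrt using hrt
  obtain ⟨F, hF, hfix⟩ := exists_fixedPoint hW A
  have hpt : ∀ z, z ∉ nonnegReals → IsFixedPoint A d d' (n : ℝ) (rt z)
      (scaledPair (rt z) ((rt z)⁻¹ * F true (rt z)) ((rt z)⁻¹ * F false (rt z))) := by
    intro z hz
    obtain ⟨hs, -⟩ := hrt z hz
    have h1 : scaledPair (rt z) ((rt z)⁻¹ * F true (rt z)) ((rt z)⁻¹ * F false (rt z))
        = fun b => F b (rt z) := by
      funext b
      cases b <;> exact mul_inv_cancel_left₀ (ne_zero_of_re_pos hs) _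
    rw [h1]
    exact hfix _ hs
  refine ⟨fun z => (rt z)⁻¹ * F true (rt z), fun z => (rt z)⁻¹ * F false (rt z),
    isStieltjesTransform_of_isPoleAverage (hF true) hrt,
    isStieltjesTransform_of_isPoleAverage (hF false) hrt, fun z hz => ?_, fun z hz => ?_⟩
  · obtain ⟨hs, hsz⟩ := hrt z hz
    exact ((isFixedPoint_scaledPair_iff hW hs hsz (hpt z hz).re_nonneg).1 (hpt z hz)).1
  · obtain ⟨hs, hsz⟩ := hrt z hz
    exact ((isFixedPoint_scaledPair_iff hW hs hsz (hpt z hz).re_nonneg).1 (hpt z hz)).2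

/-- Uniqueness of the solution of the canonical system. -/
theorem IsCanonicalSolution.unique {β R τ α : ℝ} (hW : WeightBounds d d' (n : ℝ) β R)
    (hSh : ShapeBounds A d d' (n : ℝ) τ α) {γ γ' δ δ' : ℂ → ℂ}
    (hγ : IsCanonicalSolution d d' A γ γ') (hδ : IsCanonicalSolution d d' A δ δ') {z : ℂ}
    (hz : z ∉ nonnegReals) : γ z = δ z ∧ γ' z = δ' z := by
  obtain ⟨s, hs, hsz⟩ := exists_sqrt_neg hz
  have h := IsFixedPoint.unique hW hSh hs (hγ.isFixedPoint hW hz hs hsz)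
    (hδ.isFixedPoint hW hz hs hsz)
  have hs0 := ne_zero_of_re_pos hs
  exact ⟨mul_left_cancel₀ hs0 (congrFun h true), mul_left_cancel₀ hs0 (congrFun h false)⟩

end Solution

section Polynomials

lemma coeff_one_add_X_pow_nonneg (D k : ℕ) :
    0 ≤ ((1 + Polynomial.X : Polynomial ℝ) ^ D).coeff k := by
  rw [Polynomial.coeff_one_add_X_pow]
  positivity

/-- Bounds on `s` in terms of `z`, where `s ^ 2 = -z`. -/
lemma sqrt_bounds {s z : ℂ} (hz : z ∉ nonnegReals) (hs : 0 < s.re) (hsz : s ^ 2 = -z) :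
    1 / s.re ≤ 2 * ((1 + ‖z‖) * (1 + 1 / Metric.infDist z nonnegReals)) ∧
      ‖s‖ ≤ 2 * ((1 + ‖z‖) * (1 + 1 / Metric.infDist z nonnegReals)) := by
  set ρ := Metric.infDist z nonnegReals with hρ
  have hρ0 : 0 < ρ := infDist_pos hz
  have hnorm : ‖s‖ ^ 2 = ‖z‖ := by rw [← norm_pow, hsz, norm_neg]
  have hS : ‖s‖ ≤ 1 + ‖z‖ := by nlinarith [sq_nonneg (‖s‖ - 1), norm_nonneg s]
  have hρ1 : 0 ≤ 1 / ρ := by positivity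
  have h1 : 1 / s.re ≤ 2 * ‖s‖ * (1 / ρ) := by
    rw [mul_one_div, div_le_div_iff₀ hs hρ0, one_mul]
    linarith [infDist_le hs hsz]
  constructor
  · refine h1.trans ?_
    calc _ ≤ 2 * (1 + ‖z‖) * (1 + 1 / ρ) := by gcongr; linarith
      _ = _ := by ring
  · nlinarith [norm_nonneg z, mul_nonneg (norm_nonneg z) hρ1]

end Polynomials

end BilinearResolvent

end

theorem theorem1 (p : ℕ) (hp : 1 ≤ p) (ratioMin ratioMax dMin dMax dMin' dMax' aMax M : ℝ)
    (hratio : 0 < ratioMin) (hdMin : 0 < dMin) (hdMin' : 0 < dMin') :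
    ∃ Φ Ψ : Polynomial ℝ, (∀ k, 0 ≤ Φ.coeff k) ∧ (∀ k, 0 ≤ Ψ.coeff k) ∧
      ∀ (N n : ℕ) (d : Fin N → ℝ) (d' : Fin n → ℝ) (A : Matrix (Fin N) (Fin n) ℂ),
        BilinearResolvent.ModelBounds ratioMin ratioMax dMin dMax dMin' dMax' aMax d d' A →
        ∃ δ δ' : ℂ → ℂ,
          BilinearResolvent.IsCanonicalSolution d d' A δ δ' ∧
          (∀ γ γ' : ℂ → ℂ, BilinearResolvent.IsCanonicalSolution d d' A γ γ' →
            ∀ z : ℂ, z ∉ BilinearResolvent.nonnegReals → γ z = δ z ∧ γ' z = δ' z) ∧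
          ∀ (Ω : Type*) [MeasurableSpace Ω] (P : MeasureTheory.Measure Ω)
            [MeasureTheory.IsProbabilityMeasure P] (X : Fin N → Fin n → Ω → ℂ),
            BilinearResolvent.IsIIDArray P p M X →
            ∀ (u v : EuclideanSpace ℂ (Fin N)) (z : ℂ), z ∉ BilinearResolvent.nonnegReals →
              MeasureTheory.Integrable (fun ω => ‖BilinearResolvent.bilin u
                (BilinearResolvent.resolventMat (BilinearResolvent.sigmaMat d d' A
                    (Matrix.of fun i j => X i j ω)) z
                  - BilinearResolvent.detEquiv d d' A (δ z) (δ' z) z) v‖ ^ (2 * p)) P ∧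
              ∫ ω, ‖BilinearResolvent.bilin u
                (BilinearResolvent.resolventMat (BilinearResolvent.sigmaMat d d' A
                    (Matrix.of fun i j => X i j ω)) z
                  - BilinearResolvent.detEquiv d d' A (δ z) (δ' z) z) v‖ ^ (2 * p) ∂P
                ≤ (1 / (n : ℝ) ^ p) * Φ.eval ‖z‖
                  * Ψ.eval (1 / Metric.infDist z BilinearResolvent.nonnegReals)
                  * ‖u‖ ^ (2 * p) * ‖v‖ ^ (2 * p) := by
  obtain ⟨q, rfl⟩ : ∃ q, p = q + 1 := ⟨p - 1, by omega⟩
  obtain ⟨C, D, hC, hgrowth⟩ := BilinearResolvent.polyGrowth_totalConst (1 + |M|)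
    (|dMax| + |dMax'|) (|ratioMax| + 1) (min (ratioMin * dMin) dMin') |aMax| q
  refine ⟨Polynomial.C (C * 2 ^ D) * (1 + Polynomial.X) ^ D, (1 + Polynomial.X) ^ D, fun k => ?_,
    BilinearResolvent.coeff_one_add_X_pow_nonneg D, fun N n d d' A h => ?_⟩
  · rw [Polynomial.coeff_C_mul]
    exact mul_nonneg (by positivity) (BilinearResolvent.coeff_one_add_X_pow_nonneg D k)
  have hW := h.weightBounds
  have hSh := h.shapeBounds hratio hdMin hdMin'
  obtain ⟨δ, δ', hδ⟩ := BilinearResolvent.exists_isCanonicalSolution (A := A) hW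
  refine ⟨δ, δ', hδ, fun γ γ' hγ z hz => hγ.unique hW hSh hδ hz, ?_⟩
  intro Ω _ P _ X hX u v z hz
  obtain ⟨s, hs, hsz⟩ := BilinearResolvent.exists_sqrt_neg hz
  obtain ⟨hint, hle⟩ := BilinearResolvent.integral_bilin_le hW hSh hs hsz
    (hδ.isFixedPoint hW hz hs hsz) hX u v
  refine ⟨hint, hle.trans ?_⟩
  obtain ⟨hL, hS⟩ := BilinearResolvent.sqrt_bounds hz hs hsz
  have hρ : 0 ≤ 1 / Metric.infDist z BilinearResolvent.nonnegReals :=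
    one_div_nonneg.2 Metric.infDist_nonneg
  have hK : 1 ≤ 2 * ((1 + ‖z‖) * (1 + 1 / Metric.infDist z BilinearResolvent.nonnegReals)) := by
    nlinarith [norm_nonneg z, mul_nonneg (norm_nonneg z) hρ]
  have hbound := (le_abs_self _).trans
    (hgrowth _ (1 / s.re) ‖s‖ hK (by positivity) hL (norm_nonneg s) hS)
  refine (mul_le_mul_of_nonneg_right hbound (by positivity)).trans_eq ?_
  simp only [Polynomial.eval_mul, Polynomial.eval_C, Polynomial.eval_pow, Polynomial.eval_add,
    Polynomial.eval_one, Polynomial.eval_X, div_pow, mul_pow, pow_mul]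
  ring
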